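/- Let a single-category instance of chores consist of a finite set $N$ of agents, a finite set $M$ of items, values $v_i(g)\le 0$ for $i\in N$, $g\in M$ (extended additively to bundles, $v_i(S)=\sum_{g\in S}v_i(g)$), and quotas $q^-,q^+\in\mathbb{Z}_{\ge 0}$ with $q^-|N|\le |M|\le q^+|N|$. An allocation is an ordered partition $(A_i)_{i\in N}$ of $M$ into possibly empty bundles; it is feasible if $q^-\le |A_i|\le q^+$ for all $i\in N$. The maximin share of agent $i$ is $\mu_i=\max_{P}\min_{k\in N}v_i(P_k)$, where $P=(P_k)_{k\in N}$ ranges over all feasible allocations, and a feasible allocation $A$ is an $\alpha$-MMS allocation if $v_i(A_i)\ge\alpha\,\mu_i$ for all $i\in N$. Theorem. For every single-category instance of chores, a $\left(\frac{3-(\max\{|N|,1\})^{-1}}{2}\right)$-MMS allocation (that is, a $\frac{3n-1}{2n}$-MMS allocation if $n=|N|\ge 1$) exists and can be computed in time $O(|N||M|\log|M|)$, in the uniform cost model with real arithmetic and with a constant-time oracle for the values $v_i(g)$. (For $|M|\le 1$, where $\log|M|$ vanishes or is undefined, the time is $O(1)$.) -/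

import Mathlib

/-! ### Fair division of chores with a lower and an upper quota -/

/-- A single-category instance with set of agents `N` and set of items `M`: `v i g` is the value of
item `g` for agent `i`, and every bundle must contain at least `lo` and at most `hi` items, where
`lo * |N| ≤ |M| ≤ hi * |N|`. -/
structure FairInstance (N M : Type*) [Fintype N] [Fintype M] where
  v : N → M → ℝ
  lo : ℕ
  hi : ℕ
  lo_mul_le : lo * Fintype.card N ≤ Fintype.card M
  le_hi_mul : Fintype.card M ≤ hi * Fintype.card N

namespace FairInstance

variable {N M : Type*} [Fintype N] [Fintype M]

/-- All items are chores: no agent has a positive value for an item. -/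
def IsChores (I : FairInstance N M) : Prop := ∀ i g, I.v i g ≤ 0

/-- The additive value of a bundle. -/
noncomputable def value (I : FairInstance N M) (i : N) (S : Finset M) : ℝ := ∑ g ∈ S, I.v i g

/-- `A` is a feasible allocation: an ordered partition of the items (empty parts are allowed) in
which every bundle respects both quotas. -/
def IsFeasible (I : FairInstance N M) (A : N → Finset M) : Prop :=
  (∀ g, ∃! i, g ∈ A i) ∧ ∀ i, I.lo ≤ (A i).card ∧ (A i).card ≤ I.hi

/-- The maximin share of agent `i`: the maximum over the feasible allocations `P` of the minimum
over `k` of the value of `P k` for `i`. Both extrema range over finite sets, and these are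
non-empty as soon as there is an agent `i`. -/
noncomputable def mms (I : FairInstance N M) (i : N) : ℝ :=
  sSup {x | ∃ P : N → Finset M, I.IsFeasible P ∧ x = ⨅ k, I.value i (P k)}

/-- `A` is an `α`-MMS allocation. -/
def IsApproxMMS (I : FairInstance N M) (α : ℝ) (A : N → Finset M) : Prop :=
  I.IsFeasible A ∧ ∀ i, α * I.mms i ≤ I.value i (A i)

end FairInstance

/-! ### A random access machine with real numbers, a valuation oracle and uniform cost

The memory consists of arrays of natural numbers and arrays of real numbers. A program names
arrays by constants, so that it uses finitely many of them; the position within an array is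
computed at run time. Every arithmetic operation, memory access, comparison, oracle query,
assignment and branching costs one step. There is no rounding of real numbers to integers. -/

namespace RealRAM

/-- The memory: position `j` of array number `a` of each of the two kinds. -/
structure Mem where
  nat : ℕ → ℕ → ℕ
  real : ℕ → ℕ → ℝ

/-- Expressions for natural numbers (subtraction is truncated, division rounds down). -/
inductive NExp where
  | const (k : ℕ)
  | load (a : ℕ) (j : NExp)
  | add (e f : NExp)
  | sub (e f : NExp)
  | mul (e f : NExp)
  | div (e f : NExp)

/-- Expressions for real numbers; `query i g` asks the oracle for the value of the single item `g`
for agent `i`. -/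
inductive RExp where
  | ofNat (e : NExp)
  | load (a : ℕ) (j : NExp)
  | query (i g : NExp)
  | add (e f : RExp)
  | sub (e f : RExp)
  | mul (e f : RExp)
  | div (e f : RExp)

/-- Tests. -/
inductive BExp where
  | natLE (e f : NExp)
  | realLE (e f : RExp)
  | not (b : BExp)
  | and (b c : BExp)

/-- Programs. -/
inductive Prog where
  | skip
  | setNat (a : ℕ) (j e : NExp)
  | setReal (a : ℕ) (j : NExp) (e : RExp)
  | seq (p q : Prog)
  | ite (b : BExp) (p q : Prog)
  | while (b : BExp) (p : Prog)

def NExp.eval (s : Mem) : NExp → ℕ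
  | const k => k
  | load a j => s.nat a (j.eval s)
  | add e f => e.eval s + f.eval s
  | sub e f => e.eval s - f.eval s
  | mul e f => e.eval s * f.eval s
  | div e f => e.eval s / f.eval s

/-- The number of steps to evaluate an expression: its number of operations. -/
def NExp.cost : NExp → ℕ
  | const _ => 1
  | load _ j => j.cost + 1
  | add e f => e.cost + f.cost + 1
  | sub e f => e.cost + f.cost + 1
  | mul e f => e.cost + f.cost + 1
  | div e f => e.cost + f.cost + 1

/-- The value of a real expression, where `o` is the oracle. -/
noncomputable def RExp.eval (o : ℕ → ℕ → ℝ) (s : Mem) : RExp → ℝ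
  | ofNat e => (e.eval s : ℝ)
  | load a j => s.real a (j.eval s)
  | query i g => o (i.eval s) (g.eval s)
  | add e f => e.eval o s + f.eval o s
  | sub e f => e.eval o s - f.eval o s
  | mul e f => e.eval o s * f.eval o s
  | div e f => e.eval o s / f.eval o s

def RExp.cost : RExp → ℕ
  | ofNat e => e.cost + 1
  | load _ j => j.cost + 1
  | query i g => i.cost + g.cost + 1
  | add e f => e.cost + f.cost + 1
  | sub e f => e.cost + f.cost + 1
  | mul e f => e.cost + f.cost + 1
  | div e f => e.cost + f.cost + 1

/-- The test `b` succeeds. -/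
def BExp.Holds (o : ℕ → ℕ → ℝ) (s : Mem) : BExp → Prop
  | natLE e f => e.eval s ≤ f.eval s
  | realLE e f => e.eval o s ≤ f.eval o s
  | not b => ¬ b.Holds o s
  | and b c => b.Holds o s ∧ c.Holds o s

def BExp.cost : BExp → ℕ
  | natLE e f => e.cost + f.cost + 1
  | realLE e f => e.cost + f.cost + 1
  | not b => b.cost + 1
  | and b c => b.cost + c.cost + 1

/-- Write `x` at position `j` of array `a` of natural numbers. -/
def Mem.setNat (s : Mem) (a j x : ℕ) : Mem :=
  { s with nat := Function.update s.nat a (Function.update (s.nat a) j x) }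

/-- Write `x` at position `j` of array `a` of real numbers. -/
noncomputable def Mem.setReal (s : Mem) (a j : ℕ) (x : ℝ) : Mem :=
  { s with real := Function.update s.real a (Function.update (s.real a) j x) }

/-- `Exec o p s t s'`: with oracle `o`, program `p` started in memory `s` halts after exactly `t`
steps in memory `s'`. -/
inductive Exec (o : ℕ → ℕ → ℝ) : Prog → Mem → ℕ → Mem → Prop
  | skip (s : Mem) : Exec o .skip s 1 s
  | setNat (a : ℕ) (j e : NExp) (s : Mem) :
      Exec o (.setNat a j e) s (j.cost + e.cost + 1) (s.setNat a (j.eval s) (e.eval s))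
  | setReal (a : ℕ) (j : NExp) (e : RExp) (s : Mem) :
      Exec o (.setReal a j e) s (j.cost + e.cost + 1) (s.setReal a (j.eval s) (e.eval o s))
  | seq {p q : Prog} {s s' s'' : Mem} {t t' : ℕ} :
      Exec o p s t s' → Exec o q s' t' s'' → Exec o (.seq p q) s (t + t') s''
  | ite_true {b : BExp} {p q : Prog} {s s' : Mem} {t : ℕ} :
      b.Holds o s → Exec o p s t s' → Exec o (.ite b p q) s (b.cost + t + 1) s'
  | ite_false {b : BExp} {p q : Prog} {s s' : Mem} {t : ℕ} :
      ¬ b.Holds o s → Exec o q s t s' → Exec o (.ite b p q) s (b.cost + t + 1) s'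
  | while_true {b : BExp} {p : Prog} {s s' s'' : Mem} {t t' : ℕ} :
      b.Holds o s → Exec o p s t s' → Exec o (.while b p) s' t' s'' →
      Exec o (.while b p) s (b.cost + t + t' + 1) s''
  | while_false {b : BExp} {p : Prog} {s : Mem} :
      ¬ b.Holds o s → Exec o (.while b p) s (b.cost + 1) s

end RealRAM

/-! ### Instances as inputs, allocations as outputs -/

namespace FairInstance

variable {n m : ℕ}

/-- The valuation oracle of an instance with numbered agents and items; a query outside the range
is answered by `0`. -/
noncomputable def oracle (I : FairInstance (Fin n) (Fin m)) (i g : ℕ) : ℝ :=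
  if h : i < n ∧ g < m then I.v ⟨i, h.1⟩ ⟨g, h.2⟩ else 0

/-- The initial memory: array `0` of natural numbers starts with the number of agents, the number
of items and the two quotas, and everything else is zero. -/
def input (I : FairInstance (Fin n) (Fin m)) : RealRAM.Mem where
  nat a j := if a = 0 then [n, m, I.lo, I.hi].getD j 0 else 0
  real _ _ := 0

end FairInstance

/-- The memory `s` represents the allocation `A`: position `g` of array `1` of natural numbers
holds the agent that receives item `g`. -/
def RealRAM.Mem.Represents {n m : ℕ} (s : RealRAM.Mem) (A : Fin n → Finset (Fin m)) : Prop :=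
  ∀ (i : Fin n) (g : Fin m), g ∈ A i ↔ s.nat 1 g = i

/-! If there are at most as many items as agents, giving every agent at most one item suffices,
since the maximin share is at most the value of any single item. Let m > n from now on, and replace
values by costs. Ranks of items, sorted by increasing cost, are allocated first, as if all agents
had the same order: rank `r` costs agent `x` the amount `c x r`. Finally the owners of the ranks
pick actual items, cheapest rank first. When rank `r` picks, only `r` items are gone, so the pick
costs at most `c x r`.

The maximin share is replaced by a computable bound τ (`IsProxy`). If all bundles of an allocation
cost at most μ, then some l bundles contain the l dearest items, and the quotas force at least
`fillCount` further items into them, so the l dearest and that many cheapest items together cost at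
most lμ. By pigeonhole two of the n + 1 dearest items share a bundle, so twice the cheapest of these
costs at most μ. The least number with both properties is τ, and the maximin share is at most -τ
(`mms_le`).

The n dearest items are large, the others small; a small item costs at most τ/2. Every bag gets one
large item, the cheapest remaining one first, and a window of consecutive remaining small items. The
window moves up along a fixed path on which its cost increases for everybody. With δ = 1/(2n), the
bag goes to an agent who is the last to reach her threshold (1 - δ)τ. One step earlier she had not
exceeded it, so the bag costs her at most (1 - δ)τ + τ/2 = (3 - 1/n)τ/2. Every other remaining agent
finds the bag worth at least (1 - δ)τ, unless the window has reached the last small item. Therefore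
the invariant `CanBear`, that any l remaining agents can bear the l dearest items and the small
items forced on them at cost (l + ε)τ, survives with ε increased by δ (`CanBear.step`). If already
the first window is taken, the invariant with l = 1 bounds the bag by (1 + ε)τ, where ε ≤ (n -
1)/(2n), which is again at most (3 - 1/n)τ/2. The combinatorial core is `fillCount_step`: the path
is such that the small items forced on l agents after a removal lie below the window, or form with
it a part of those forced on l + 1 agents before.

Sorting with a tournament tree takes O(m log m) steps per agent and dominates. When a bag leaves,
windows with the same end index become dearer, so the window of each agent only ever moves down:
O(m) moves per agent in all rounds together (`potential`). Adapting the cost of a window to the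
removal of d small items takes O(d) steps (`runs_shiftCost`). The numerical step bounds are
generous. -/

namespace RealRAM

/-! ### Notation for programs and evaluation rules. -/

instance : Add NExp := ⟨.add⟩
instance : Sub NExp := ⟨.sub⟩
instance : Mul NExp := ⟨.mul⟩
instance : Div NExp := ⟨.div⟩
instance (k : ℕ) : OfNat NExp k := ⟨.const k⟩
instance : Add RExp := ⟨.add⟩
instance : Sub RExp := ⟨.sub⟩
instance : Div RExp := ⟨.div⟩

/-- The value of a scalar variable, kept at position `0` of its own array. -/
def NExp.var (a : ℕ) : NExp := .load a (.const 0)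

/-- The maximum of two expressions. -/
def NExp.sup (e f : NExp) : NExp := e + (f - e)

/-- The minimum of two expressions. -/
def NExp.inf (e f : NExp) : NExp := e - (e - f)

/-- The test `e < f`. -/
def BExp.natLT (e f : NExp) : BExp := .natLE (e + 1) f

/-- Assignment to a scalar variable. -/
def Prog.setVar (a : ℕ) (e : NExp) : Prog := .setNat a (.const 0) e

infixr:30 " ;; " => Prog.seq

section Eval

variable (o : ℕ → ℕ → ℝ) (s : Mem)

@[simp] theorem NExp.eval_const (k : ℕ) : (NExp.const k).eval s = k := rfl
@[simp] theorem NExp.eval_ofNat (k : ℕ) :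
    (no_index (OfNat.ofNat k) : NExp).eval s = OfNat.ofNat k := rfl
@[simp] theorem NExp.eval_load (a : ℕ) (j : NExp) :
    (NExp.load a j).eval s = s.nat a (j.eval s) := rfl
@[simp] theorem NExp.eval_var (a : ℕ) : (NExp.var a).eval s = s.nat a 0 := rfl
@[simp] theorem NExp.eval_add (e f : NExp) : (e + f).eval s = e.eval s + f.eval s := rfl
@[simp] theorem NExp.eval_sub (e f : NExp) : (e - f).eval s = e.eval s - f.eval s := rfl
@[simp] theorem NExp.eval_mul (e f : NExp) : (e * f).eval s = e.eval s * f.eval s := rfl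
@[simp] theorem NExp.eval_div (e f : NExp) : (e / f).eval s = e.eval s / f.eval s := rfl

@[simp] theorem NExp.eval_sup (e f : NExp) : (e.sup f).eval s = max (e.eval s) (f.eval s) := by
  simp only [NExp.sup, NExp.eval_add, NExp.eval_sub]; omega

@[simp] theorem NExp.eval_inf (e f : NExp) : (e.inf f).eval s = min (e.eval s) (f.eval s) := by
  simp only [NExp.inf, NExp.eval_sub]; omega

@[simp] theorem RExp.eval_ofNat (e : NExp) : (RExp.ofNat e).eval o s = (e.eval s : ℝ) := rfl
@[simp] theorem RExp.eval_load (a : ℕ) (j : NExp) :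
    (RExp.load a j).eval o s = s.real a (j.eval s) := rfl
@[simp] theorem RExp.eval_query (i g : NExp) :
    (RExp.query i g).eval o s = o (i.eval s) (g.eval s) := rfl
@[simp] theorem RExp.eval_add (e f : RExp) : (e + f).eval o s = e.eval o s + f.eval o s := rfl
@[simp] theorem RExp.eval_sub (e f : RExp) : (e - f).eval o s = e.eval o s - f.eval o s := rfl
@[simp] theorem RExp.eval_div (e f : RExp) : (e / f).eval o s = e.eval o s / f.eval o s := rfl

@[simp] theorem BExp.holds_natLE (e f : NExp) :
    (BExp.natLE e f).Holds o s ↔ e.eval s ≤ f.eval s := Iff.rfl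
@[simp] theorem BExp.holds_natLT (e f : NExp) :
    (BExp.natLT e f).Holds o s ↔ e.eval s < f.eval s := Iff.rfl
@[simp] theorem BExp.holds_realLE (e f : RExp) :
    (BExp.realLE e f).Holds o s ↔ e.eval o s ≤ f.eval o s := Iff.rfl
@[simp] theorem BExp.holds_and (b c : BExp) :
    (BExp.and b c).Holds o s ↔ b.Holds o s ∧ c.Holds o s := Iff.rfl

@[simp] theorem Mem.nat_setNat (a j x b k : ℕ) :
    (s.setNat a j x).nat b k = if b = a ∧ k = j then x else s.nat b k := by
  unfold Mem.setNat
  by_cases hb : b = a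
  · subst hb; simp [Function.update_apply]
  · simp [hb]

@[simp] theorem Mem.real_setNat (a j x : ℕ) : (s.setNat a j x).real = s.real := rfl

@[simp] theorem Mem.nat_setReal (a j : ℕ) (x : ℝ) : (s.setReal a j x).nat = s.nat := rfl

@[simp] theorem Mem.real_setReal (a j : ℕ) (x : ℝ) (b k : ℕ) :
    (s.setReal a j x).real b k = if b = a ∧ k = j then x else s.real b k := by
  unfold Mem.setReal
  by_cases hb : b = a
  · subst hb; simp [Function.update_apply]
  · simp [hb]

end Eval

/-! ### Loop-free programs -/

/-- The program contains no loop. -/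
def Prog.loopFree : Prog → Bool
  | .skip => true
  | .setNat _ _ _ => true
  | .setReal _ _ _ => true
  | .seq p q => p.loopFree && q.loopFree
  | .ite _ p q => p.loopFree && q.loopFree
  | .while _ _ => false

/-- The final memory of a loop-free program. -/
noncomputable def Prog.run (o : ℕ → ℕ → ℝ) : Prog → Mem → Mem
  | .skip, s => s
  | .setNat a j e, s => s.setNat a (j.eval s) (e.eval s)
  | .setReal a j e, s => s.setReal a (j.eval s) (e.eval o s)
  | .seq p q, s => q.run o (p.run o s)
  | .ite b p q, s => open Classical in if b.Holds o s then p.run o s else q.run o s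
  | .while _ _, s => s

/-- A bound for the number of steps of a loop-free program. -/
def Prog.bound : Prog → ℕ
  | .skip => 1
  | .setNat _ j e => j.cost + e.cost + 1
  | .setReal _ j e => j.cost + e.cost + 1
  | .seq p q => p.bound + q.bound
  | .ite b p q => b.cost + max p.bound q.bound + 1
  | .while _ _ => 0

theorem Prog.exec_of_loopFree (o : ℕ → ℕ → ℝ) {p : Prog} (h : p.loopFree = true) (s : Mem) :
    ∃ t ≤ p.bound, Exec o p s t (p.run o s) := by
  induction p generalizing s with
  | skip => exact ⟨1, le_rfl, .skip s⟩
  | setNat a j e => exact ⟨_, le_rfl, .setNat a j e s⟩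
  | setReal a j e => exact ⟨_, le_rfl, .setReal a j e s⟩
  | seq p q ihp ihq =>
    simp only [loopFree, Bool.and_eq_true] at h
    obtain ⟨t, ht, hp⟩ := ihp h.1 s
    obtain ⟨t', ht', hq⟩ := ihq h.2 (p.run o s)
    exact ⟨t + t', by simp only [bound]; omega, .seq hp hq⟩
  | ite b p q ihp ihq =>
    simp only [loopFree, Bool.and_eq_true] at h
    by_cases hb : b.Holds o s
    · obtain ⟨t, ht, hp⟩ := ihp h.1 s
      refine ⟨b.cost + t + 1, by simp only [bound]; omega, ?_⟩
      simp only [run, if_pos hb]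
      exact .ite_true hb hp
    · obtain ⟨t, ht, hq⟩ := ihq h.2 s
      refine ⟨b.cost + t + 1, by simp only [bound]; omega, ?_⟩
      simp only [run, if_neg hb]
      exact .ite_false hb hq
  | _ => simp [loopFree] at h

/-! ### Frames -/

/-- The arrays of natural numbers to which a program writes. -/
def Prog.natWrites : Prog → List ℕ
  | .skip => []
  | .setNat a _ _ => [a]
  | .setReal _ _ _ => []
  | .seq p q => p.natWrites ++ q.natWrites
  | .ite _ p q => p.natWrites ++ q.natWrites
  | .while _ p => p.natWrites

/-- The arrays of real numbers to which a program writes. -/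
def Prog.realWrites : Prog → List ℕ
  | .skip => []
  | .setNat _ _ _ => []
  | .setReal a _ _ => [a]
  | .seq p q => p.realWrites ++ q.realWrites
  | .ite _ p q => p.realWrites ++ q.realWrites
  | .while _ p => p.realWrites

/-- The memories `s` and `s'` agree in all arrays to which `p` does not write. -/
structure Prog.Frame (p : Prog) (s s' : Mem) : Prop where
  nat : ∀ a, a ∉ p.natWrites → s'.nat a = s.nat a
  real : ∀ a, a ∉ p.realWrites → s'.real a = s.real a

theorem Prog.Frame.refl (p : Prog) (s : Mem) : p.Frame s s := ⟨fun _ _ => rfl, fun _ _ => rfl⟩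

theorem Prog.Frame.trans {p : Prog} {s s' s'' : Mem} (h : p.Frame s s') (h' : p.Frame s' s'') :
    p.Frame s s'' :=
  ⟨fun a ha => (h'.nat a ha).trans (h.nat a ha), fun a ha => (h'.real a ha).trans (h.real a ha)⟩

/-- Whether an array occurs in the list of writes is decidable, so for a concrete program the
preservation of an array reduces to `by decide`. -/
theorem Exec.frame {o : ℕ → ℕ → ℝ} {p : Prog} {s s' : Mem} {t : ℕ} (h : Exec o p s t s') :
    p.Frame s s' := by
  induction h with
  | skip s => exact .refl _ _
  | setNat a j e s =>
    refine ⟨fun b hb => ?_, fun b _ => rfl⟩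
    simp only [Prog.natWrites, List.mem_singleton] at hb
    funext k
    simp [hb]
  | setReal a j e s =>
    refine ⟨fun b _ => rfl, fun b hb => ?_⟩
    simp only [Prog.realWrites, List.mem_singleton] at hb
    funext k
    simp [hb]
  | @seq p q s s' s'' t t' _ _ ih ih' =>
    refine Prog.Frame.trans (s' := s') ⟨fun a ha => ih.nat a ?_, fun a ha => ih.real a ?_⟩
      ⟨fun a ha => ih'.nat a ?_, fun a ha => ih'.real a ?_⟩ <;>
    simp_all [Prog.natWrites, Prog.realWrites]
  | ite_true _ _ ih =>
    refine ⟨fun a ha => ih.nat a ?_, fun a ha => ih.real a ?_⟩ <;>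
    simp_all [Prog.natWrites, Prog.realWrites]
  | ite_false _ _ ih =>
    refine ⟨fun a ha => ih.nat a ?_, fun a ha => ih.real a ?_⟩ <;>
    simp_all [Prog.natWrites, Prog.realWrites]
  | while_true _ _ _ ih ih' =>
    exact Prog.Frame.trans ⟨fun a ha => ih.nat a ha, fun a ha => ih.real a ha⟩ ih'
  | while_false _ => exact .refl _ _

/-! ### A program logic with time credits -/

/-- From memory `s` and with `k` time credits, `p` halts, and `Q` holds for the credits that are
left over and the final memory. -/
def Prog.Runs (o : ℕ → ℕ → ℝ) (p : Prog) (s : Mem) (k : ℕ) (Q : ℕ → Mem → Prop) : Prop :=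
  ∃ t s' k', Exec o p s t s' ∧ t + k' ≤ k ∧ Q k' s'

namespace Prog.Runs

variable {o : ℕ → ℕ → ℝ} {p q : Prog} {s : Mem} {k : ℕ} {Q Q' : ℕ → Mem → Prop}

/-- Handing the frame to the continuation keeps untouched arrays out of the specifications of the
subprograms. -/
theorem mono (h : p.Runs o s k Q) (hQ : ∀ k' s', p.Frame s s' → Q k' s' → Q' k' s') :
    p.Runs o s k Q' := by
  obtain ⟨t, s', k', he, ht, hq⟩ := h
  exact ⟨t, s', k', he, ht, hQ k' s' he.frame hq⟩

theorem seq (h : p.Runs o s k (fun k' s' => q.Runs o s' k' Q)) : (p ;; q).Runs o s k Q := by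
  obtain ⟨t, s', k', he, ht, t', s'', k'', he', ht', hq⟩ := h
  exact ⟨t + t', s'', k'', .seq he he', by omega, hq⟩

theorem ite {b : BExp} (hk : b.cost + 1 ≤ k)
    (ht : b.Holds o s → p.Runs o s (k - (b.cost + 1)) Q)
    (hf : ¬ b.Holds o s → q.Runs o s (k - (b.cost + 1)) Q) : (Prog.ite b p q).Runs o s k Q := by
  by_cases hb : b.Holds o s
  · obtain ⟨t, s', k', he, ht, hq⟩ := ht hb
    exact ⟨_, s', k', .ite_true hb he, by omega, hq⟩
  · obtain ⟨t, s', k', he, ht, hq⟩ := hf hb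
    exact ⟨_, s', k', .ite_false hb he, by omega, hq⟩

/-- Loop-free programs; `C` is any bound for their number of steps. -/
theorem straight (C : ℕ) (h : p.loopFree = true) (hC : p.bound ≤ C) (hk : C ≤ k)
    (hQ : Q (k - C) (p.run o s)) : p.Runs o s k Q := by
  obtain ⟨t, ht, he⟩ := exec_of_loopFree o h s
  exact ⟨t, _, k - C, he, by omega, hQ⟩

/-- The rule for loops: credits are part of the invariant, so that no separate variant is
needed. -/
theorem loop {b : BExp} (C : ℕ) (Inv : ℕ → Mem → Prop) (hC : b.cost + 1 ≤ C) (h0 : Inv k s)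
    (h : ∀ k' s', p.Frame s s' → Inv k' s' → C ≤ k' ∧
      (b.Holds o s' → p.Runs o s' (k' - C) Inv) ∧ (¬ b.Holds o s' → Q (k' - C) s')) :
    (Prog.while b p).Runs o s k Q := by
  -- Induction on the credits: each pass consumes at least `C ≥ b.cost + 1 > 0` of them, so
  -- termination needs no further measure.
  have key : ∀ k' s', p.Frame s s' → Inv k' s' → (Prog.while b p).Runs o s' k' Q := by
    intro k'
    induction k' using Nat.strong_induction_on with
    | _ k' ih =>
      intro s' hf hi
      obtain ⟨hk, ht, hq⟩ := h k' s' hf hi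
      by_cases hb : b.Holds o s'
      · obtain ⟨t, s₁, k₁, he, hle, hi'⟩ := ht hb
        obtain ⟨t', s₂, k₂, he', hle', hq'⟩ := ih k₁ (by omega) s₁ (hf.trans he.frame) hi'
        exact ⟨_, s₂, k₂, .while_true hb he he', by omega, hq'⟩
      · exact ⟨_, s', _, .while_false hb, by omega, hq hb⟩
  exact key k s (.refl _ _) h0

end Prog.Runs

end RealRAM


/-! ### Tournament trees -/

/-- In the tournament tree `T`, node `i` holds the better one of the items of its two children. -/
def IsWinner (key : ℕ → ℝ) (T : ℕ → ℕ) (i : ℕ) : Prop :=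
  (T i = T (2 * i) ∨ T i = T (2 * i + 1)) ∧
    key (T i) ≤ key (T (2 * i)) ∧ key (T i) ≤ key (T (2 * i + 1))

section Tournament

variable {m : ℕ} {key : ℕ → ℝ} {T : ℕ → ℕ}

theorem tournament_lt (hT : ∀ g < m, T (m + g) = g) (hw : ∀ i, 1 ≤ i → i < m → IsWinner key T i)
    (i : ℕ) (hi : 1 ≤ i) (him : i < 2 * m) : T i < m := by
  induction h : 2 * m - i using Nat.strong_induction_on generalizing i with
  | _ d ih =>
    by_cases hlt : i < m
    · rcases (hw i hi hlt).1 with h' | h' <;> rw [h']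
      · exact ih _ (by omega) (2 * i) (by omega) (by omega) rfl
      · exact ih _ (by omega) (2 * i + 1) (by omega) (by omega) rfl
    · have := hT (i - m) (by omega)
      rw [show m + (i - m) = i by omega] at this
      omega

/-- Along the path from `i` to the root, passing from a node to its parent `i / 2` never increases
the key. -/
theorem tournament_root_le (hw : ∀ i, 1 ≤ i → i < m → IsWinner key T i)
    (i : ℕ) (hi : 1 ≤ i) (him : i < 2 * m) : key (T 1) ≤ key (T i) := by
  induction i using Nat.strong_induction_on with
  | _ i ih =>
    rcases Nat.lt_or_ge i 2 with h | h
    · rw [show i = 1 by omega]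
    · refine (ih (i / 2) (by omega) (by omega) (by omega)).trans ?_
      have := (hw (i / 2) (by omega) (by omega)).2
      rcases Nat.even_or_odd' i with ⟨c, hc | hc⟩
      · rw [show i / 2 = c by omega] at this ⊢
        rw [hc]; exact this.1
      · rw [show i / 2 = c by omega] at this ⊢
        rw [hc]; exact this.2

/-- Only the ancestors of a leaf hold its item. -/
theorem tournament_ancestor (hT : ∀ g < m, T (m + g) = g)
    (hw : ∀ i, 1 ≤ i → i < m → IsWinner key T i)
    (i : ℕ) (hi : 1 ≤ i) (him : i < 2 * m) : ∃ e, i = (m + T i) / 2 ^ e := by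
  induction h : 2 * m - i using Nat.strong_induction_on generalizing i with
  | _ d ih =>
    by_cases hlt : i < m
    · rcases (hw i hi hlt).1 with h' | h' <;> rw [h']
      · obtain ⟨e, he⟩ := ih _ (by omega) (2 * i) (by omega) (by omega) rfl
        exact ⟨e + 1, by rw [pow_succ, ← Nat.div_div_eq_div_mul, ← he]; omega⟩
      · obtain ⟨e, he⟩ := ih _ (by omega) (2 * i + 1) (by omega) (by omega) rfl
        exact ⟨e + 1, by rw [pow_succ, ← Nat.div_div_eq_div_mul, ← he]; omega⟩
    · have := hT (i - m) (by omega)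
      rw [show m + (i - m) = i by omega] at this
      exact ⟨0, by omega⟩

end Tournament

/-! ### Correctness of selection sort. -/

/-- `f` lists the `m` items by increasing cost `c`, where `v` is the value of an item. -/
structure IsSorting (m : ℕ) (v : ℕ → ℝ) (f : ℕ → ℕ) (c : ℕ → ℝ) : Prop where
  lt : ∀ r < m, f r < m
  inj : ∀ r < m, ∀ r' < m, f r = f r' → r = r'
  cost : ∀ r < m, c r = -v (f r)
  mono : ∀ r r', r ≤ r' → r' < m → c r ≤ c r'

/-- State of the selection sort after the items of ranks `q, …, m - 1` have been extracted. -/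
structure IsPartialSorting (m q : ℕ) (v key : ℕ → ℝ) (f : ℕ → ℕ) (c : ℕ → ℝ) : Prop where
  lt : ∀ r, q ≤ r → r < m → f r < m
  inj : ∀ r r', q ≤ r → r < m → q ≤ r' → r' < m → f r = f r' → r = r'
  cost : ∀ r, q ≤ r → r < m → c r = -v (f r)
  mono : ∀ r r', q ≤ r → r ≤ r' → r' < m → c r ≤ c r'
  key_eq_one : ∀ r, q ≤ r → r < m → key (f r) = 1
  key_eq : ∀ g < m, (∀ r, q ≤ r → r < m → f r ≠ g) → key g = v g
  le : ∀ g < m, (∀ r, q ≤ r → r < m → f r ≠ g) → ∀ r, q ≤ r → r < m → -v g ≤ c r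

theorem IsPartialSorting.sorting {m : ℕ} {v key : ℕ → ℝ} {f : ℕ → ℕ} {c : ℕ → ℝ}
    (h : IsPartialSorting m 0 v key f c) : IsSorting m v f c where
  lt r hr := h.lt r (Nat.zero_le _) hr
  inj r hr r' hr' := h.inj r r' (Nat.zero_le _) hr (Nat.zero_le _) hr'
  cost r hr := h.cost r (Nat.zero_le _) hr
  mono r r' := h.mono r r' (Nat.zero_le _)

/-- Extraction of an item whose key is minimal. -/
theorem IsPartialSorting.step {m q : ℕ} {v key key' : ℕ → ℝ} {f f' : ℕ → ℕ} {c c' : ℕ → ℝ}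
    (h : IsPartialSorting m (q + 1) v key f c) (hq : q < m) (hv : ∀ g, v g ≤ 0) {g : ℕ}
    (hg : g < m) (hmin : ∀ g' < m, key g ≤ key g')
    (hf : ∀ r, q < r → r < m → f' r = f r) (hfq : f' q = g)
    (hc : ∀ r, q < r → r < m → c' r = c r) (hcq : c' q = -key g)
    (hk : ∀ g', g' ≠ g → key' g' = key g') (hkg : key' g = 1) :
    IsPartialSorting m q v key' f' c' := by
  -- Only m - q - 1 items have been extracted, so one is left, and its key is its value, which is at
  -- most 0.
  have hfree : ∃ g' < m, ∀ r, q + 1 ≤ r → r < m → f r ≠ g' := by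
    by_contra hcon
    push Not at hcon
    have hsub : Finset.range m ⊆ (Finset.Ico (q + 1) m).image f := by
      intro g' hg'
      obtain ⟨r, h1, h2, h3⟩ := hcon g' (Finset.mem_range.1 hg')
      exact Finset.mem_image.2 ⟨r, Finset.mem_Ico.2 ⟨h1, h2⟩, h3⟩
    have := (Finset.card_le_card hsub).trans Finset.card_image_le
    simp at this
    omega
  -- Extracted items carry the key 1, which exceeds every value of a chore; a minimal key therefore
  -- belongs to an item that is still present.
  have hgfree : ∀ r, q + 1 ≤ r → r < m → f r ≠ g := by
    intro r h1 h2 h3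
    obtain ⟨g', hg', hfr⟩ := hfree
    have h4 := hmin g' hg'
    rw [← h3, h.key_eq_one r h1 h2, h.key_eq g' hg' hfr] at h4
    linarith [hv g']
  have hkeyg : key g = v g := h.key_eq g hg hgfree
  have hcg : c' q = -v g := by rw [hcq, hkeyg]
  refine ⟨?_, ?_, ?_, ?_, ?_, ?_, ?_⟩
  · intro r h1 h2
    rcases h1.eq_or_lt with rfl | h1
    · rwa [hfq]
    · rw [hf r h1 h2]; exact h.lt r h1 h2
  · intro r r' h1 h2 h1' h2' heq
    rcases h1.eq_or_lt with rfl | h1 <;> rcases h1'.eq_or_lt with rfl | h1'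
    · rfl
    · rw [hfq, hf r' h1' h2'] at heq; exact absurd heq.symm (hgfree r' h1' h2')
    · rw [hfq, hf r h1 h2] at heq; exact absurd heq (hgfree r h1 h2)
    · rw [hf r h1 h2, hf r' h1' h2'] at heq; exact h.inj r r' h1 h2 h1' h2' heq
  · intro r h1 h2
    rcases h1.eq_or_lt with rfl | h1
    · rw [hcg, hfq]
    · rw [hf r h1 h2, hc r h1 h2]; exact h.cost r h1 h2
  · intro r r' h1 h2 h3
    rcases h1.eq_or_lt with rfl | h1
    · rcases h2.eq_or_lt with rfl | h2
      · rfl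
      · rw [hcg, hc r' h2 h3]; exact h.le g hg hgfree r' h2 h3
    · rw [hc r h1 (by omega), hc r' (by omega) h3]; exact h.mono r r' h1 h2 h3
  · intro r h1 h2
    rcases h1.eq_or_lt with rfl | h1
    · rw [hfq, hkg]
    · rw [hf r h1 h2, hk _ (hgfree r h1 h2)]; exact h.key_eq_one r h1 h2
  · intro g' hg' hne
    have hgg : g' ≠ g := by rintro rfl; exact hne q le_rfl hq hfq
    rw [hk g' hgg]
    exact h.key_eq g' hg' fun r h1 h2 => by rw [← hf r h1 h2]; exact hne r (by omega) h2
  · intro g' hg' hne r h1 h2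
    have hne' : ∀ r, q + 1 ≤ r → r < m → f r ≠ g' := fun r h1 h2 => by
      rw [← hf r h1 h2]; exact hne r (by omega) h2
    rcases h1.eq_or_lt with rfl | h1
    · have := hmin g' hg'
      rw [h.key_eq g' hg' hne'] at this
      rw [hcq]; linarith
    · rw [hc r h1 h2]; exact h.le g' hg' hne' r h1 h2

theorem mul_add_inj {m x q x' q' : ℕ} (hq : q < m) (hq' : q' < m) :
    x * m + q = x' * m + q' ↔ x = x' ∧ q = q' := by
  constructor
  · intro h
    have h1 : (x * m + q) / m = x := by
      rw [mul_comm, Nat.mul_add_div (by omega), Nat.div_eq_of_lt hq, add_zero]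
    have h2 : (x' * m + q') / m = x' := by
      rw [mul_comm, Nat.mul_add_div (by omega), Nat.div_eq_of_lt hq', add_zero]
    have : x = x' := by rw [← h1, h, h2]
    subst this
    exact ⟨rfl, by omega⟩
  · rintro ⟨rfl, rfl⟩; rfl

namespace RealRAM.Chores

/-! ### The program

The arrays of natural numbers are: `1` the output, `2` a tournament tree, `3` the items sorted by
each agent, `4` the ranks of the remaining small items, `5` the owners of the ranks, `6` the flags
of the agents that are served, `7` and `8` the ends of the current window of each agent, `9` the
position of each agent in her list, `10` the flags of the items that are taken. The arrays of real
numbers are: `0` the keys of the items in the tree, `1` the costs sorted by each agent, `2` prefix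
sums of these, `3` the thresholds, `4` the costs of the current windows, `5` the current maximum.
The other arrays hold scalar variables. -/

/-- The number of agents. -/
def agents : NExp := .load 0 0

/-- The number of items. -/
def items : NExp := .load 0 1

/-- Play the match at node `13` of the tournament tree. -/
def playMatch : Prog :=
  .ite (.realLE (.load 0 (.load 2 (2 * .var 13))) (.load 0 (.load 2 (2 * .var 13 + 1))))
    (.setNat 2 (.var 13) (.load 2 (2 * .var 13)))
    (.setNat 2 (.var 13) (.load 2 (2 * .var 13 + 1)))

/-- Load the values of agent `11` into the leaves. -/
def loadLeaves : Prog :=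
  .setVar 12 0 ;;
  .while (.natLT (.var 12) items)
    (.setReal 0 (.var 12) (.query (.var 11) (.var 12)) ;;
     .setNat 2 (items + .var 12) (.var 12) ;;
     .setVar 12 (.var 12 + 1))

/-- Play all matches. -/
def buildTree : Prog :=
  .setVar 13 (items - 1) ;;
  .while (.natLE 1 (.var 13)) (playMatch ;; .setVar 13 (.var 13 - 1))

/-- Repeat the matches on the path from node `13` to the root. -/
def repairPath : Prog :=
  .while (.natLE 1 (.var 13)) (playMatch ;; .setVar 13 (.var 13 / 2))

/-- Move the item at the root to rank `12` of the list of agent `11`. -/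
def extractRoot : Prog :=
  .setVar 12 (.var 12 - 1) ;;
  .setVar 23 (.load 2 1) ;;
  .setNat 3 (.var 11 * items + .var 12) (.var 23) ;;
  .setReal 1 (.var 11 * items + .var 12) (.ofNat 0 - .load 0 (.var 23)) ;;
  .setReal 0 (.var 23) (.ofNat 1) ;;
  .setVar 13 ((items + .var 23) / 2)

/-- Sort the items by the costs for agent `11`. -/
def sortOne : Prog :=
  loadLeaves ;; buildTree ;; .setVar 12 items ;;
  .while (.natLE 1 (.var 12)) (extractRoot ;; repairPath)

/-- Sort the items for every agent. -/
def sortAll : Prog :=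
  .setVar 11 0 ;; .while (.natLT (.var 11) agents) (sortOne ;; .setVar 11 (.var 11 + 1))

variable {o : ℕ → ℕ → ℝ} {s : Mem} {k n m x : ℕ}

theorem run_playMatch (o : ℕ → ℕ → ℝ) (s : Mem) : ∃ g, playMatch.run o s = s.setNat 2 (s.nat 13 0) g ∧
    (g = s.nat 2 (2 * s.nat 13 0) ∨ g = s.nat 2 (2 * s.nat 13 0 + 1)) ∧
    s.real 0 g ≤ s.real 0 (s.nat 2 (2 * s.nat 13 0)) ∧
    s.real 0 g ≤ s.real 0 (s.nat 2 (2 * s.nat 13 0 + 1)) := by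
  unfold playMatch Prog.run
  split
  · rename_i h
    simp at h
    exact ⟨_, rfl, Or.inl rfl, le_rfl, h⟩
  · rename_i h
    simp at h
    exact ⟨_, rfl, Or.inr rfl, h.le, le_rfl⟩

theorem runs_loadLeaves (hm : s.nat 0 1 = m) (hx : s.nat 11 0 = x) (hk : 50 * (m + 1) ≤ k) :
    loadLeaves.Runs o s k fun k' s' => k - 50 * (m + 1) ≤ k' ∧
      (∀ g < m, s'.real 0 g = o x g) ∧ ∀ g < m, s'.nat 2 (m + g) = g := by
  refine .seq (.straight 10 (by decide) (by decide) (by omega) ?_)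
  simp only [Prog.run, Prog.setVar]
  refine .loop 10 (fun k' s' => k - 50 * (m + 1) + 40 * (m - s'.nat 12 0) + 20 ≤ k' ∧
    s'.nat 12 0 ≤ m ∧ (∀ g < s'.nat 12 0, s'.real 0 g = o x g) ∧
    ∀ g < s'.nat 12 0, s'.nat 2 (m + g) = g) (by decide) ?_ ?_
  · simp; omega
  · rintro k' s' hf ⟨hk', hle, h1, h2⟩
    have hm' : s'.nat 0 1 = m := by rw [hf.nat 0 (by decide)]; simpa using hm
    have hx' : s'.nat 11 0 = x := by rw [hf.nat 11 (by decide)]; simpa using hx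
    refine ⟨by omega, fun hb => ?_, fun hb => ?_⟩
    · simp [items, hm'] at hb
      refine .straight 30 (by decide) (by decide) (by omega) ?_
      simp [Prog.run, items, hm', hx']
      refine ⟨by omega, by omega, fun g hg => ?_, fun g hg => ?_⟩
      · split
        · rename_i h; rw [h]
        · exact h1 g (by omega)
      · by_cases h : g = s'.nat 12 0
        · simp [h]
        · simp [h]; exact h2 g (by omega)
    · simp [items, hm'] at hb
      have : s'.nat 12 0 = m := le_antisymm hle hb
      rw [this] at h1 h2 hk'
      exact ⟨by omega, h1, h2⟩

theorem runs_buildTree (hm : s.nat 0 1 = m) (hk : 60 * (m + 1) ≤ k) :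
    buildTree.Runs o s k fun k' s' => k - 60 * (m + 1) ≤ k' ∧ s'.real = s.real ∧
      (∀ i, m ≤ i → s'.nat 2 i = s.nat 2 i) ∧
      ∀ i, 1 ≤ i → i < m → IsWinner (s'.real 0) (s'.nat 2) i := by
  refine .seq (.straight 10 (by decide) (by decide) (by omega) ?_)
  simp only [Prog.run, Prog.setVar]
  refine .loop 10 (fun k' s' => k - 60 * (m + 1) + 60 * s'.nat 13 0 + 50 ≤ k' ∧ s'.nat 13 0 ≤ m - 1 ∧
    (∀ i, m ≤ i → s'.nat 2 i = s.nat 2 i) ∧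
    ∀ i, s'.nat 13 0 < i → i < m → IsWinner (s'.real 0) (s'.nat 2) i) (by decide) ?_ ?_
  · simp [items, hm]
    refine ⟨by omega, fun i h1 h2 => by omega⟩
  · rintro k' s' hf ⟨hk', hle, h1, h2⟩
    have hr : s'.real = s.real := funext fun a => by
      rw [hf.real a (by simp [Prog.realWrites, playMatch])]; rfl
    refine ⟨by omega, fun hb => ?_, fun hb => ?_⟩
    · simp at hb
      refine .straight 40 (by decide) (by decide) (by omega) ?_
      obtain ⟨g, hg, hor, hle1, hle2⟩ := run_playMatch o s'
      simp [Prog.run, hg]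
      generalize s'.nat 13 0 = i at *
      refine ⟨by omega, by omega, fun j hj => ?_, fun j hj hjm => ?_⟩
      · rw [if_neg (by omega)]; exact h1 j hj
      · unfold IsWinner
        rcases eq_or_ne j i with rfl | hne
        · simp [show ¬ 2 * j = j by omega, show ¬ 2 * j + 1 = j by omega]
          exact ⟨hor, hle1, hle2⟩
        · simp [hne, show ¬ 2 * j = i by omega, show ¬ 2 * j + 1 = i by omega]
          exact h2 j (by omega) hjm
    · simp at hb
      exact ⟨by omega, hr, h1, fun i hi him => h2 i (by omega) him⟩

/-- Only node `13` and its ancestors may be wrong. Each match repairs the lowest of them and leaves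
the path from its parent, and an index below `2 ^ e` is halved at most `e` times before it vanishes.
-/
theorem runs_repairPath {e : ℕ} (he : s.nat 13 0 < 2 ^ e) (hmi : s.nat 13 0 < m)
    (hk : 60 * (e + 1) ≤ k)
    (hw : ∀ i, 1 ≤ i → i < m → IsWinner (s.real 0) (s.nat 2) i ∨ ∃ d, i = s.nat 13 0 / 2 ^ d) :
    repairPath.Runs o s k fun k' s' => k - 60 * (e + 1) ≤ k' ∧ s'.real = s.real ∧
      (∀ i, m ≤ i → s'.nat 2 i = s.nat 2 i) ∧
      ∀ i, 1 ≤ i → i < m → IsWinner (s'.real 0) (s'.nat 2) i := by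
  refine .loop 10 (fun k' s' => s'.nat 13 0 < m ∧
    (∃ e', s'.nat 13 0 < 2 ^ e' ∧ k - 60 * (e + 1) + 60 * e' + 50 ≤ k') ∧
    (∀ i, m ≤ i → s'.nat 2 i = s.nat 2 i) ∧
    ∀ i, 1 ≤ i → i < m → IsWinner (s'.real 0) (s'.nat 2) i ∨ ∃ d, i = s'.nat 13 0 / 2 ^ d)
    (by decide) ?_ ?_
  · exact ⟨hmi, ⟨e, he, by omega⟩, fun _ _ => rfl, hw⟩
  · rintro k' s' hf ⟨hlt, ⟨e', he', hk'⟩, h1, h2⟩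
    have hr : s'.real = s.real := funext fun a => by
      rw [hf.real a (by simp [Prog.realWrites, playMatch, Prog.setVar])]
    refine ⟨by omega, fun hb => ?_, fun hb => ?_⟩
    · simp at hb
      obtain ⟨d, rfl⟩ : ∃ d, e' = d + 1 := by
        cases e' with
        | zero => simp at he'; omega
        | succ d => exact ⟨d, rfl⟩
      refine .straight 40 (by decide) (by decide) (by omega) ?_
      obtain ⟨g, hg, hor, hle1, hle2⟩ := run_playMatch o s'
      simp [Prog.run, Prog.setVar, hg]
      generalize s'.nat 13 0 = i at *
      refine ⟨by omega, ⟨d, by rw [pow_succ] at he'; omega, by omega⟩, fun j hj => ?_,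
        fun j hj hjm => ?_⟩
      · rw [if_neg (by omega)]; exact h1 j hj
      · rcases eq_or_ne j i with rfl | hne
        · left
          unfold IsWinner
          simp [show ¬ 2 * j = j by omega, show ¬ 2 * j + 1 = j by omega]
          exact ⟨hor, hle1, hle2⟩
        -- Node `i` is a child of its parent only, so the new entry at `i` cannot spoil the match at
        -- any other node.
        by_cases hpar : j = i / 2
        · exact Or.inr ⟨0, by simpa using hpar⟩
        rcases h2 j hj hjm with h | ⟨c, hc⟩
        · left
          unfold IsWinner
          simp [hne, show ¬ 2 * j = i by omega, show ¬ 2 * j + 1 = i by omega]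
          exact h
        · right
          cases c with
          | zero => simp at hc; exact absurd hc hne
          | succ c => exact ⟨c, by rw [hc, pow_succ', Nat.div_div_eq_div_mul]⟩
    · simp at hb
      refine ⟨by omega, hr, h1, fun i hi him => ?_⟩
      rcases h2 i hi him with h | ⟨d, hd⟩
      · exact h
      · rw [hb] at hd; simp at hd; omega

end RealRAM.Chores

namespace RealRAM.Chores

variable {o : ℕ → ℕ → ℝ} {s : Mem} {k n m x : ℕ}

theorem runs_sortOne (hm : s.nat 0 1 = m) (hx : s.nat 11 0 = x) (ho : ∀ i g, o i g ≤ 0)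
    (hm1 : 1 ≤ m) {e : ℕ} (he : m ≤ 2 ^ e) (hk : 400 * (m * (e + 1)) ≤ k) :
    sortOne.Runs o s k fun k' s' => k - 400 * (m * (e + 1)) ≤ k' ∧
      IsSorting m (o x) (fun r => s'.nat 3 (x * m + r)) (fun r => s'.real 1 (x * m + r)) ∧
      ∀ y r, y ≠ x → r < m → s'.nat 3 (y * m + r) = s.nat 3 (y * m + r) ∧
        s'.real 1 (y * m + r) = s.real 1 (y * m + r) := by
  have hb1 : m ≤ m * (e + 1) := Nat.le_mul_of_pos_right _ (by omega)
  refine .seq ((runs_loadLeaves hm hx (by omega)).mono ?_)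
  rintro k₁ s₁ hf₁ ⟨hk₁, hkey, hleaf⟩
  have hm₁ : s₁.nat 0 1 = m := by rw [hf₁.nat 0 (by decide), hm]
  refine .seq ((runs_buildTree hm₁ (by omega)).mono ?_)
  rintro k₂ s₂ hf₂ ⟨hk₂, hreal₂, hT₂, hw₂⟩
  have hm₂ : s₂.nat 0 1 = m := by rw [hf₂.nat 0 (by decide), hm₁]
  have hx₂ : s₂.nat 11 0 = x := by
    rw [hf₂.nat 11 (by decide), hf₁.nat 11 (by decide), hx]
  refine .seq (.straight 10 (by decide) (by decide) (by omega) ?_)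
  simp only [Prog.run, Prog.setVar]
  have hnat₂ : s₂.nat 3 = s.nat 3 := by rw [hf₂.nat 3 (by decide), hf₁.nat 3 (by decide)]
  have hre₂ : s₂.real 1 = s.real 1 := by rw [hf₂.real 1 (by decide), hf₁.real 1 (by decide)]
  refine .loop 10 (fun k' s' => k - 400 * (m * (e + 1)) + s'.nat 12 0 * (70 + 60 * (e + 1)) + 20 ≤ k' ∧
    s'.nat 12 0 ≤ m ∧ (∀ g < m, s'.nat 2 (m + g) = g) ∧
    (∀ i, 1 ≤ i → i < m → IsWinner (s'.real 0) (s'.nat 2) i) ∧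
    IsPartialSorting m (s'.nat 12 0) (o x) (s'.real 0) (fun r => s'.nat 3 (x * m + r))
      (fun r => s'.real 1 (x * m + r)) ∧
    ∀ y r, y ≠ x → r < m → s'.nat 3 (y * m + r) = s.nat 3 (y * m + r) ∧
        s'.real 1 (y * m + r) = s.real 1 (y * m + r)) (by decide) ?_ ?_
  · simp [items, hm₂, hnat₂, hre₂]
    refine ⟨?_, fun g hg => ?_, hw₂, ?_⟩
    · have : m * (70 + 60 * (e + 1)) = 70 * m + 60 * (m * (e + 1)) := by ring
      omega
    · rw [hT₂ _ (by omega)]; exact hleaf g hg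
    · refine ⟨fun r h1 h2 => ?_, fun r r' h1 h2 => ?_, fun r h1 h2 => ?_, fun r r' h1 h2 => ?_,
        fun r h1 h2 => ?_, fun g hg _ => ?_, fun g hg _ r h1 h2 => ?_⟩ <;> try omega
      rw [hreal₂]; exact hkey g hg
  · rintro k' s' hf ⟨hk', hle, hleaf', hw', hps, hoth⟩
    have hm' : s'.nat 0 1 = m := by rw [hf.nat 0 (by decide)]; simpa using hm₂
    have hx' : s'.nat 11 0 = x := by rw [hf.nat 11 (by decide)]; simpa using hx₂
    refine ⟨by omega, fun hb => ?_, fun hb => ?_⟩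
    · simp at hb
      obtain ⟨q, hq⟩ : ∃ q, s'.nat 12 0 = q + 1 := ⟨s'.nat 12 0 - 1, by omega⟩
      rw [hq] at hk' hps hle
      have hroot : s'.nat 2 1 < m := tournament_lt hleaf' hw' 1 le_rfl (by omega)
      have hmin : ∀ g' < m, s'.real 0 (s'.nat 2 1) ≤ s'.real 0 g' := fun g' hg' => by
        have := tournament_root_le hw' (m + g') (by omega) (by omega)
        rwa [hleaf' g' hg'] at this
      have hexp : (q + 1) * (70 + 60 * (e + 1)) = q * (70 + 60 * (e + 1)) + 70 + 60 * (e + 1) := by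
        ring
      refine .seq (.straight 60 (by decide) (by decide) (by omega) ?_)
      set g := s'.nat 2 1 with hg
      refine (runs_repairPath (m := m) (e := e) ?_ ?_ ?_ ?_).mono ?_
      · simp [extractRoot, Prog.run, Prog.setVar, items, hm', hq, ← hg]; omega
      · simp [extractRoot, Prog.run, Prog.setVar, items, hm', hq, ← hg]; omega
      · omega
      · intro i hi him
        simp [extractRoot, Prog.run, Prog.setVar, items, hm', hq, ← hg]
        -- A node that is not an ancestor of the leaf of `g` does not hold `g`, and neither do its
        -- children, so the new key of `g` is irrelevant to its match.
        by_cases hanc : ∃ d, i = (m + g) / 2 ^ d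
        · right
          obtain ⟨d, hd⟩ := hanc
          cases d with
          | zero => simp at hd; omega
          | succ d => exact ⟨d, by rw [hd, pow_succ', Nat.div_div_eq_div_mul]⟩
        · left
          push Not at hanc
          have hnot : ∀ i', 1 ≤ i' → i' < 2 * m → (∀ d, i' ≠ (m + g) / 2 ^ d) → s'.nat 2 i' ≠ g := by
            intro i' h1 h2 h3 h4
            obtain ⟨d, hd⟩ := tournament_ancestor hleaf' hw' i' h1 h2
            rw [h4] at hd
            exact h3 d hd
          have h0 := hnot i hi (by omega) hanc
          have h1 := hnot (2 * i) (by omega) (by omega) fun d hd => hanc (d + 1) (by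
            rw [pow_succ, ← Nat.div_div_eq_div_mul, ← hd]; omega)
          have h2 := hnot (2 * i + 1) (by omega) (by omega) fun d hd => hanc (d + 1) (by
            rw [pow_succ, ← Nat.div_div_eq_div_mul, ← hd]; omega)
          have := hw' i hi him
          unfold IsWinner at this ⊢
          simp [h0, h1, h2]
          exact this
      · rintro k₃ s₃ hf₃ ⟨hk₃, hreal₃, hT₃, hw₃⟩
        have e12 : s₃.nat 12 0 = q := by
          rw [hf₃.nat 12 (by decide)]; simp [extractRoot, Prog.run, Prog.setVar, hq]
        have e3 : ∀ j, s₃.nat 3 j = if j = x * m + q then g else s'.nat 3 j := fun j => by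
          rw [hf₃.nat 3 (by decide)]
          simp [extractRoot, Prog.run, Prog.setVar, items, hm', hx', hq, ← hg]
        have e1 : ∀ j, s₃.real 1 j = if j = x * m + q then - s'.real 0 g else s'.real 1 j :=
          fun j => by
            rw [hreal₃]
            simp [extractRoot, Prog.run, Prog.setVar, items, hm', hx', hq, ← hg]
        have e0 : ∀ j, s₃.real 0 j = if j = g then 1 else s'.real 0 j := fun j => by
          rw [hreal₃]
          simp [extractRoot, Prog.run, Prog.setVar, items, hm', hx', hq, ← hg]
        refine ⟨?_, ?_, ?_, hw₃, ?_, ?_⟩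
        · rw [e12]; omega
        · omega
        · intro g' hg'
          rw [hT₃ _ (by omega)]
          simp [extractRoot, Prog.run, Prog.setVar]
          exact hleaf' g' hg'
        · rw [e12]
          refine hps.step (g := g) (by omega) (ho x) hroot hmin ?_ ?_ ?_ ?_ ?_ ?_
          · intro r h1 h2
            rw [e3, if_neg (by omega)]
          · rw [e3, if_pos rfl]
          · intro r h1 h2
            rw [e1, if_neg (by omega)]
          · rw [e1, if_pos rfl]
          · intro g' hg'
            rw [e0, if_neg hg']
          · rw [e0, if_pos rfl]
        · intro y r hy hr
          have : ¬ y * m + r = x * m + q := fun h => hy ((mul_add_inj hr (by omega)).1 h).1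
          rw [e3, e1, if_neg this, if_neg this]
          exact hoth y r hy hr
    · simp at hb
      rw [hb] at hps hk'
      exact ⟨by omega, hps.sorting, hoth⟩

theorem runs_sortAll (hn : s.nat 0 0 = n) (hm : s.nat 0 1 = m) (ho : ∀ i g, o i g ≤ 0)
    (hm1 : 1 ≤ m) {e : ℕ} (he : m ≤ 2 ^ e) (hk : 500 * ((n + 1) * (m * (e + 1))) ≤ k) :
    sortAll.Runs o s k fun k' s' => k - 500 * ((n + 1) * (m * (e + 1))) ≤ k' ∧
      ∀ x < n, IsSorting m (o x) (fun r => s'.nat 3 (x * m + r))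
        (fun r => s'.real 1 (x * m + r)) := by
  have hb1 : 1 ≤ m * (e + 1) := Nat.mul_pos hm1 (by omega)
  set b := m * (e + 1) with hb
  have hex : (n + 1) * b = n * b + b := by ring
  refine .seq (.straight 10 (by decide) (by decide) (by omega) ?_)
  simp only [Prog.run, Prog.setVar]
  refine .loop 10 (fun k' s' => s'.nat 11 0 ≤ n ∧
    k - 500 * ((n + 1) * b) + (n - s'.nat 11 0) * (500 * b) + 20 ≤ k' ∧
    ∀ y < s'.nat 11 0, IsSorting m (o y) (fun r => s'.nat 3 (y * m + r))
        (fun r => s'.real 1 (y * m + r))) (by decide) ?_ ?_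
  · have : n * (500 * b) = 500 * (n * b) := by ring
    simp; omega
  · rintro k' s' hf ⟨hle, hk', hs⟩
    have hn' : s'.nat 0 0 = n := by rw [hf.nat 0 (by decide)]; simpa using hn
    have hm' : s'.nat 0 1 = m := by rw [hf.nat 0 (by decide)]; simpa using hm
    refine ⟨by omega, fun hc => ?_, fun hc => ?_⟩
    · simp [agents, hn'] at hc
      obtain ⟨d, hd⟩ : ∃ d, n - s'.nat 11 0 = d + 1 := ⟨n - s'.nat 11 0 - 1, by omega⟩
      have hex' : (d + 1) * (500 * b) = d * (500 * b) + 500 * b := by ring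
      rw [hd] at hk'
      refine .seq ((runs_sortOne hm' rfl ho hm1 he (by omega)).mono ?_)
      rintro k₁ s₁ hf₁ ⟨hk₁, hs₁, hoth⟩
      have e11 : s₁.nat 11 0 = s'.nat 11 0 := by rw [hf₁.nat 11 (by decide)]
      refine .straight 10 (by decide) (by decide) (by omega) ?_
      simp [Prog.run, e11]
      refine ⟨by omega, ?_, fun y hy => ?_⟩
      · rw [show n - (s'.nat 11 0 + 1) = d by omega]; omega
      · rcases eq_or_ne y (s'.nat 11 0) with rfl | hne
        · exact hs₁
        · have h0 := hs y (by omega)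
          refine ⟨fun r hr => ?_, fun r hr r' hr' h => ?_, fun r hr => ?_, fun r r' hr hr' => ?_⟩
          · simp only [(hoth y r hne hr).1]; exact h0.lt r hr
          · simp only [(hoth y r hne hr).1, (hoth y r' hne hr').1] at h
            exact h0.inj r hr r' hr' h
          · simp only [(hoth y r hne hr).1, (hoth y r hne hr).2]; exact h0.cost r hr
          · simp only [(hoth y r hne (by omega)).2, (hoth y r' hne hr').2]
            exact h0.mono r r' hr hr'
    · simp [agents, hn'] at hc
      have : s'.nat 11 0 = n := by omega
      rw [this] at hs
      exact ⟨by omega, hs⟩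

end RealRAM.Chores


/-! ### The bound that replaces the maximin share. -/

/-- If `N` bundles with at least `lw` and at most `up` small items each are filled with `E` small
items, then any `l` of the bundles together get at least this number of small items. -/
def fillCount (lw up N E l : ℕ) : ℕ := max (l * lw) (E - (N - l) * up)

/-- A lower bound `τ` for the cost of the worst bundle of any allocation of `m` items, sorted by
increasing cost `c`, to `n` agents. -/
structure IsProxy (n m lw up : ℕ) (c : ℕ → ℝ) (τ : ℝ) : Prop where
  fill : ∀ l, 1 ≤ l → l ≤ n → ∑ r ∈ Finset.Ico (m - l) m, c r +
    ∑ r ∈ Finset.range (fillCount lw up n (m - n) l), c r ≤ l * τ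
  pair : c (m - n - 1) + c (m - n - 1) ≤ τ
  least : ∀ μ, (∀ l : ℕ, 1 ≤ l → l ≤ n → ∑ r ∈ Finset.Ico (m - l) m, c r +
    ∑ r ∈ Finset.range (fillCount lw up n (m - n) l), c r ≤ l * μ) →
    c (m - n - 1) + c (m - n - 1) ≤ μ → τ ≤ μ

namespace RealRAM.Chores

/-- Compute the prefix sums of the costs for agent `11`. -/
def prefixSums : Prog :=
  .setReal 2 0 (.ofNat 0) ;; .setVar 12 0 ;;
  .while (.natLT (.var 12) items)
    (.setReal 2 (.var 12 + 1) (.load 2 (.var 12) + .load 1 (.var 11 * items + .var 12)) ;;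
     .setVar 12 (.var 12 + 1))

/-- Compute a lower bound for the maximin share of agent `11`. -/
def maximizeProxy : Prog :=
  .setReal 5 0 (.load 1 (.var 11 * items + (items - agents - 1)) +
    .load 1 (.var 11 * items + (items - agents - 1))) ;;
  .setVar 25 1 ;;
  .while (.natLE (.var 25) agents)
    (.setReal 6 0 ((.load 2 items - .load 2 (items - .var 25) +
        .load 2 (.sup (.var 25 * .var 16) (items - agents - (agents - .var 25) * .var 17))) /
          .ofNat (.var 25)) ;;
     .ite (.realLE (.load 5 0) (.load 6 0)) (.setReal 5 0 (.load 6 0)) .skip ;;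
     .setVar 25 (.var 25 + 1))

/-- Compute the thresholds of all agents. -/
def thresholds : Prog :=
  .setVar 11 0 ;;
  .while (.natLT (.var 11) agents)
    (prefixSums ;; maximizeProxy ;;
     .setReal 3 (.var 11) (.load 5 0 - .load 5 0 / .ofNat (2 * agents)) ;;
     .setVar 11 (.var 11 + 1))

variable {o : ℕ → ℕ → ℝ} {s : Mem} {k n m x lw up : ℕ}

theorem runs_prefixSums (hm : s.nat 0 1 = m) (hx : s.nat 11 0 = x) (hk : 60 * (m + 1) ≤ k) :
    prefixSums.Runs o s k fun k' s' => k - 60 * (m + 1) ≤ k' ∧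
      ∀ q ≤ m, s'.real 2 q = ∑ r ∈ Finset.range q, s.real 1 (x * m + r) := by
  refine .seq (.straight 10 (by decide) (by decide) (by omega) ?_)
  refine .seq (.straight 10 (by decide) (by decide) (by omega) ?_)
  simp only [Prog.run, Prog.setVar]
  refine .loop 10 (fun k' s' => k - 60 * (m + 1) + 60 * (m - s'.nat 12 0) + 20 ≤ k' ∧
    s'.nat 12 0 ≤ m ∧
    ∀ q ≤ s'.nat 12 0, s'.real 2 q = ∑ r ∈ Finset.range q, s.real 1 (x * m + r))
    (by decide) ?_ ?_
  · simp; omega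
  · rintro k' s' hf ⟨hk', hle, h1⟩
    have hm' : s'.nat 0 1 = m := by rw [hf.nat 0 (by decide)]; simpa using hm
    have hx' : s'.nat 11 0 = x := by rw [hf.nat 11 (by decide)]; simpa using hx
    have hr' : ∀ j, s'.real 1 j = s.real 1 j := fun j => by rw [hf.real 1 (by decide)]; simp
    refine ⟨by omega, fun hb => ?_, fun hb => ?_⟩
    · simp [items, hm'] at hb
      refine .straight 40 (by decide) (by decide) (by omega) ?_
      simp [Prog.run, items, hm', hx']
      refine ⟨by omega, by omega, fun q hq => ?_⟩
      by_cases h : q = s'.nat 12 0 + 1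
      · rw [if_pos h, h, Finset.sum_range_succ, h1 _ le_rfl, hr']
      · rw [if_neg h]; exact h1 q (by omega)
    · simp [items, hm'] at hb
      have : s'.nat 12 0 = m := le_antisymm hle hb
      rw [this] at h1 hk'
      exact ⟨by omega, h1⟩

/-- Every condition on τ is a lower bound, after division by `l`. Hence the running maximum of these
finitely many bounds satisfies all conditions seen so far and stays below every number that
satisfies them all. -/
theorem runs_maximizeProxy (hn : s.nat 0 0 = n) (hm : s.nat 0 1 = m) (hx : s.nat 11 0 = x)
    (hlw : s.nat 16 0 = lw) (hup : s.nat 17 0 = up) (hfit : n * lw ≤ m - n)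
    {c : ℕ → ℝ} (hc : ∀ r < m, s.real 1 (x * m + r) = c r) (hn1 : n < m)
    (hP : ∀ q ≤ m, s.real 2 q = ∑ r ∈ Finset.range q, c r)
    (hk : 150 * (n + 1) ≤ k) :
    maximizeProxy.Runs o s k fun k' s' => k - 150 * (n + 1) ≤ k' ∧
      IsProxy n m lw up c (s'.real 5 0) := by
  refine .seq (.straight 60 (by decide) (by decide) (by omega) ?_)
  refine .seq (.straight 10 (by decide) (by decide) (by omega) ?_)
  simp only [Prog.run, Prog.setVar]
  refine .loop 10 (fun k' s' => k - 150 * (n + 1) + 100 * (n + 1 - s'.nat 25 0) + 20 ≤ k' ∧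
    1 ≤ s'.nat 25 0 ∧ s'.nat 25 0 ≤ n + 1 ∧
    (∀ l, 1 ≤ l → l < s'.nat 25 0 → ∑ r ∈ Finset.Ico (m - l) m, c r +
      ∑ r ∈ Finset.range (fillCount lw up n (m - n) l), c r ≤ l * s'.real 5 0) ∧
    c (m - n - 1) + c (m - n - 1) ≤ s'.real 5 0 ∧
    ∀ μ, (∀ l : ℕ, 1 ≤ l → l ≤ n → ∑ r ∈ Finset.Ico (m - l) m, c r +
      ∑ r ∈ Finset.range (fillCount lw up n (m - n) l), c r ≤ l * μ) →
      c (m - n - 1) + c (m - n - 1) ≤ μ → s'.real 5 0 ≤ μ)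
    (by decide) ?_ ?_
  · simp [items, agents, hn, hm, hx, hc (m - n - 1) (by omega)]
    refine ⟨by omega, fun l h1 h2 => by omega⟩
  · rintro k' s' hf ⟨hk', hge, hle, h1, h2, h3⟩
    have hn' : s'.nat 0 0 = n := by rw [hf.nat 0 (by decide)]; simpa using hn
    have hm' : s'.nat 0 1 = m := by rw [hf.nat 0 (by decide)]; simpa using hm
    have hlw' : s'.nat 16 0 = lw := by rw [hf.nat 16 (by decide)]; simpa using hlw
    have hup' : s'.nat 17 0 = up := by rw [hf.nat 17 (by decide)]; simpa using hup
    have hP' : ∀ q ≤ m, s'.real 2 q = ∑ r ∈ Finset.range q, c r := fun q hq => by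
      rw [hf.real 2 (by decide)]; simpa using hP q hq
    refine ⟨by omega, fun hb => ?_, fun hb => ?_⟩
    · simp [agents, hn'] at hb
      -- Prefix sums are stored only up to position `m`.
      have hfc : fillCount lw up n (m - n) (s'.nat 25 0) ≤ m := by
        unfold fillCount
        have : s'.nat 25 0 * lw ≤ n * lw := Nat.mul_le_mul_right _ hb
        refine max_le (by omega) (by omega)
      have hbound : ∀ a : ℝ, (∑ r ∈ Finset.Ico (m - s'.nat 25 0) m, c r +
          ∑ r ∈ Finset.range (fillCount lw up n (m - n) (s'.nat 25 0)), c r) / (s'.nat 25 0 : ℝ) ≤ a ↔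
          ∑ r ∈ Finset.Ico (m - s'.nat 25 0) m, c r +
          ∑ r ∈ Finset.range (fillCount lw up n (m - n) (s'.nat 25 0)), c r ≤ s'.nat 25 0 * a :=
        fun a => by
          rw [div_le_iff₀ (by exact_mod_cast hge), mul_comm a]
      have hcand : (s'.real 2 m - s'.real 2 (m - s'.nat 25 0) + s'.real 2
          (max (s'.nat 25 0 * lw) (m - n - (n - s'.nat 25 0) * up))) =
          ∑ r ∈ Finset.Ico (m - s'.nat 25 0) m, c r +
          ∑ r ∈ Finset.range (fillCount lw up n (m - n) (s'.nat 25 0)), c r := by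
        rw [hP' _ le_rfl, hP' _ (by omega), Finset.sum_Ico_eq_sub _ (by omega)]
        rw [← hP' _ hfc]
        rfl
      refine .straight 80 (by decide) (by decide) (by omega) ?_
      by_cases hcmp : s'.real 5 0 ≤ (∑ r ∈ Finset.Ico (m - s'.nat 25 0) m, c r +
          ∑ r ∈ Finset.range (fillCount lw up n (m - n) (s'.nat 25 0)), c r) / (s'.nat 25 0 : ℝ) <;>
        simp [Prog.run, items, agents, hn', hm', hlw', hup', hcand, hcmp]
      · refine ⟨by omega, by omega, fun l hl1 hl2 => ?_, h2.trans hcmp, fun μ hμ hμ' => ?_⟩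
        · rcases Nat.lt_or_eq_of_le hl2 with hl | rfl
          · exact (h1 l hl1 hl).trans (by gcongr)
          · exact (hbound _).1 le_rfl
        · exact (hbound _).2 (hμ _ hge hb)
      · refine ⟨by omega, by omega, fun l hl1 hl2 => ?_, h2, h3⟩
        rcases Nat.lt_or_eq_of_le hl2 with hl | rfl
        · exact h1 l hl1 hl
        · exact (hbound _).1 (not_le.1 hcmp).le
    · simp [agents, hn'] at hb
      exact ⟨by omega, fun l hl1 hl2 => h1 l hl1 (by omega), h2, h3⟩

/-- The threshold is (1 - δ)τ with δ = 1/(2n): a round may weaken the invariant by δ, and at most n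
- 1 rounds precede the bag of an agent. -/
theorem runs_thresholds (hn : s.nat 0 0 = n) (hm : s.nat 0 1 = m)
    (hlw : s.nat 16 0 = lw) (hup : s.nat 17 0 = up) (hn1 : n < m) (hfit : n * lw ≤ m - n)
    (hk : 400 * ((n + 1) * m) ≤ k) :
    thresholds.Runs o s k fun k' s' => k - 400 * ((n + 1) * m) ≤ k' ∧
      ∀ x < n, ∃ τ, IsProxy n m lw up (fun r => s.real 1 (x * m + r)) τ ∧
        s'.real 3 x = τ - τ / (2 * n) := by
  have hex : (n + 1) * m = n * m + m := by ring
  refine .seq (.straight 10 (by decide) (by decide) (by omega) ?_)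
  simp only [Prog.run, Prog.setVar]
  refine .loop 10 (fun k' s' => s'.nat 11 0 ≤ n ∧
    k - 400 * ((n + 1) * m) + (n - s'.nat 11 0) * (400 * m) + 20 ≤ k' ∧
    ∀ y < s'.nat 11 0, ∃ τ, IsProxy n m lw up (fun r => s.real 1 (y * m + r)) τ ∧
        s'.real 3 y = τ - τ / (2 * n)) (by decide) ?_ ?_
  · have : n * (400 * m) = 400 * (n * m) := by ring
    simp; omega
  · rintro k' s' hf ⟨hle, hk', hs⟩
    have hn' : s'.nat 0 0 = n := by rw [hf.nat 0 (by decide)]; simpa using hn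
    have hm' : s'.nat 0 1 = m := by rw [hf.nat 0 (by decide)]; simpa using hm
    have hlw' : s'.nat 16 0 = lw := by rw [hf.nat 16 (by decide)]; simpa using hlw
    have hup' : s'.nat 17 0 = up := by rw [hf.nat 17 (by decide)]; simpa using hup
    have hr' : ∀ j, s'.real 1 j = s.real 1 j := fun j => by rw [hf.real 1 (by decide)]; simp
    refine ⟨by omega, fun hc => ?_, fun hc => ?_⟩
    · simp [agents, hn'] at hc
      obtain ⟨d, hd⟩ : ∃ d, n - s'.nat 11 0 = d + 1 := ⟨n - s'.nat 11 0 - 1, by omega⟩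
      have hex' : (d + 1) * (400 * m) = d * (400 * m) + 400 * m := by ring
      rw [hd] at hk'
      refine .seq ((runs_prefixSums hm' rfl (by omega)).mono ?_)
      rintro k₁ s₁ hf₁ ⟨hk₁, hP⟩
      have e11 : s₁.nat 11 0 = s'.nat 11 0 := by rw [hf₁.nat 11 (by decide)]
      refine .seq ((runs_maximizeProxy (n := n) (m := m) (x := s'.nat 11 0) (lw := lw) (up := up)
        (c := fun r => s.real 1 (s'.nat 11 0 * m + r)) ?_ ?_ e11 ?_ ?_ hfit ?_ hn1 ?_
        (by omega)).mono ?_)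
      · rw [hf₁.nat 0 (by decide), hn']
      · rw [hf₁.nat 0 (by decide), hm']
      · rw [hf₁.nat 16 (by decide), hlw']
      · rw [hf₁.nat 17 (by decide), hup']
      · intro r hr
        rw [hf₁.real 1 (by decide), hr']
      · intro q hq
        rw [hP q hq]
        exact Finset.sum_congr rfl fun r _ => hr' _
      rintro k₂ s₂ hf₂ ⟨hk₂, hprox⟩
      have e11' : s₂.nat 11 0 = s'.nat 11 0 := by rw [hf₂.nat 11 (by decide), e11]
      have hn₂ : s₂.nat 0 0 = n := by rw [hf₂.nat 0 (by decide), hf₁.nat 0 (by decide), hn']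
      refine .straight 30 (by decide) (by decide) (by omega) ?_
      simp [Prog.run, e11', agents, hn₂]
      refine ⟨by omega, ?_, fun y hy => ?_⟩
      · rw [show n - (s'.nat 11 0 + 1) = d by omega]; omega
      · rcases eq_or_ne y (s'.nat 11 0) with rfl | hne
        · exact ⟨_, hprox, by simp⟩
        · rw [if_neg hne, hf₂.real 3 (by decide), hf₁.real 3 (by decide)]
          exact hs y (by omega)
    · simp [agents, hn'] at hc
      have : s'.nat 11 0 = n := by omega
      rw [this] at hs
      exact ⟨by omega, hs⟩

end RealRAM.Chores


/-! ### Bags -/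

/-- Prefix sums. -/
def prefixSum (β : ℕ → ℝ) (q : ℕ) : ℝ := ∑ i ∈ Finset.range q, β i

theorem prefixSum_succ (β : ℕ → ℝ) (q : ℕ) : prefixSum β (q + 1) = prefixSum β q + β q :=
  Finset.sum_range_succ _ _

theorem prefixSum_mono {β : ℕ → ℝ} {E : ℕ} (hβ : ∀ i < E, 0 ≤ β i) {a b : ℕ} (hab : a ≤ b)
    (hb : b ≤ E) : prefixSum β a ≤ prefixSum β b :=
  Finset.sum_le_sum_of_subset_of_nonneg (Finset.range_subset_range.2 hab) fun i hi _ =>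
    hβ i (by simp at hi; omega)

/-- The windows that are tried for a bag, one for each end `b`: first a window of `lw` small items
slides upwards until it starts at `o`, then it grows to `up` items, and then it slides again. -/
def windowStart (lw up o b : ℕ) : ℕ := max (min (b - lw) o) (b - up)

/-- The number of remaining agents whose bags must be small in the worst case. -/
def pivot (lw up N E : ℕ) : ℕ := ((N - 1) * up + lw - E + (up - lw) - 1) / (up - lw)

/-- The end of the first window. -/
def firstEnd (lw up N E : ℕ) : ℕ := max lw (E - (N - 1) * up)

section Window

variable {lw up o b N E p : ℕ}

theorem windowStart_le : windowStart lw up o b ≤ b := by unfold windowStart; omega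

theorem windowStart_mono {o' b' : ℕ} (ho : o ≤ o') (hb : b ≤ b') :
    windowStart lw up o b ≤ windowStart lw up o' b' := by unfold windowStart; omega

theorem windowStart_succ_le (hlu : lw ≤ up) :
    windowStart lw up o (b + 1) ≤ windowStart lw up o b + 1 := by unfold windowStart; omega

theorem windowStart_diff_mono (hlu : lw ≤ up) {b' : ℕ} (hb : b ≤ b') :
    b - windowStart lw up o b ≤ b' - windowStart lw up o b' := by unfold windowStart; omega

/-- For l < N the inequality on the right says `(l + 1) * lw ≤ E - (N - (l + 1)) * up`, so from the
pivot on the second term of `fillCount` for l + 1 agents is decisive. The estimates for the path use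
the pivot only through this equivalence. For `lw = up` the division by zero yields 0, in accordance
with `N * lw ≤ E`. -/
theorem pivot_le_iff (hlu : lw ≤ up) (hN : 1 ≤ N) (hE : N * lw ≤ E) (l : ℕ) :
    pivot lw up N E ≤ l ↔ (N - 1) * up + lw ≤ E + l * (up - lw) := by
  unfold pivot
  rcases hlu.eq_or_lt with rfl | hlt
  · have : (N - 1) * lw + lw = N * lw := by
      obtain ⟨N, rfl⟩ : ∃ M, N = M + 1 := ⟨N - 1, by omega⟩
      simp; ring
    simp; omega
  · obtain ⟨d, hd⟩ : ∃ d, up - lw = d + 1 := ⟨up - lw - 1, by omega⟩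
    rw [hd, ← Nat.lt_succ_iff, Nat.div_lt_iff_lt_mul (by omega)]
    have : l.succ * (d + 1) = l * (d + 1) + (d + 1) := by rw [Nat.succ_eq_add_one]; ring
    omega

/-- One agent leaves with at most `up` items, so `(N - 1) * up - E` does not grow. Thus the path of
windows is never raised between rounds, on which the monotone movement of the pointers depends. -/
theorem pivot_mono (hlu : lw ≤ up) (hN : 2 ≤ N) (hE : N * lw ≤ E) {d : ℕ} (hd : d ≤ up)
    (hE' : (N - 1) * lw ≤ E - d) (hdE : d ≤ E) :
    pivot lw up (N - 1) (E - d) ≤ pivot lw up N E := by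
  rw [pivot_le_iff hlu (by omega) hE']
  have := (pivot_le_iff hlu (by omega) hE (pivot lw up N E)).1 le_rfl
  have h2 : (N - 1) * up = (N - 1 - 1) * up + up := by
    obtain ⟨M, rfl⟩ : ∃ M, N = M + 2 := ⟨N - 2, by omega⟩
    simp; ring
  omega

/-- Every window on the path from `firstEnd` on fits into one bag, and what it leaves behind can
still be distributed among N - 1 bags. -/
theorem windowStart_size (hlu : lw ≤ up) (hN : 1 ≤ N) (hE : N * lw ≤ E) (hE' : E ≤ N * up)
    (hp : firstEnd lw up N E ≤ p) (hpE : p ≤ E) :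
    lw ≤ p - windowStart lw up (pivot lw up N E * lw) p ∧
    p - windowStart lw up (pivot lw up N E * lw) p ≤ up ∧
    (N - 1) * lw ≤ E - (p - windowStart lw up (pivot lw up N E * lw) p) ∧
    E - (p - windowStart lw up (pivot lw up N E * lw) p) ≤ (N - 1) * up := by
  have hiff := pivot_le_iff hlu hN hE
  set u := pivot lw up N E
  obtain ⟨M, rfl⟩ : ∃ M, N = M + 1 := ⟨N - 1, by omega⟩
  have e1 : (M + 1) * lw = M * lw + lw := by ring
  have e2 : (M + 1) * up = M * up + up := by ring
  rw [e1] at hE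
  rw [e2] at hE'
  simp only [Nat.add_sub_cancel] at *
  unfold firstEnd at hp
  simp only [Nat.add_sub_cancel] at hp
  obtain ⟨t, rfl⟩ : ∃ t, up = lw + t := ⟨up - lw, by omega⟩
  simp only [Nat.add_sub_cancel_left] at hiff
  have e3 : M * (lw + t) = M * lw + M * t := by ring
  have huM : u ≤ M := (hiff M).2 (by omega)
  have h0 := hiff 0
  simp only [Nat.le_zero, Nat.zero_mul, add_zero] at h0
  refine ⟨by unfold windowStart; omega, by unfold windowStart; omega, ?_, ?_⟩
  -- If the pivot is N - 1, then the window has size `lw` or leaves `(N - 1) * lw` items below its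
  -- start. If it is smaller, then `E` is so large that even the loss of `up` items is harmless.
  · rcases huM.eq_or_lt with h | h
    · rw [h]; unfold windowStart; omega
    · obtain ⟨r, rfl⟩ : ∃ r, M = r + 1 := ⟨M - 1, by omega⟩
      have h1 := (hiff r).1 (by omega)
      have e4 : (r + 1) * t = r * t + t := by ring
      have e5 : (r + 1) * lw = r * lw + lw := by ring
      unfold windowStart; omega
  -- With pivot 0 the window grows from position 0 at once, and `firstEnd` makes it long enough.
  -- With a positive pivot, `E < (N - 1) * up + lw`, so that removing `lw` items suffices.
  · by_cases hu : u = 0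
    · rw [hu]; unfold windowStart; simp; omega
    · have : ¬ (M * (lw + t) + lw ≤ E) := fun h => hu (h0.2 h)
      unfold windowStart; omega

/-- The first window thus consists of the cheapest small items, as many as a single agent must
accept, and the invariant for l = 1 applies to it. -/
theorem windowStart_firstEnd (hlu : lw ≤ up) (hN : 1 ≤ N) (hE : N * lw ≤ E) (hE' : E ≤ N * up) :
    windowStart lw up (pivot lw up N E * lw) (firstEnd lw up N E) = 0 := by
  have h0 := pivot_le_iff hlu hN hE 0
  simp only [Nat.le_zero, Nat.zero_mul, add_zero] at h0
  obtain ⟨M, rfl⟩ : ∃ M, N = M + 1 := ⟨N - 1, by omega⟩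
  have e2 : (M + 1) * up = M * up + up := by ring
  simp only [Nat.add_sub_cancel] at *
  unfold firstEnd windowStart
  simp only [Nat.add_sub_cancel]
  by_cases hu : pivot lw up (M + 1) E = 0
  · rw [hu]; simp; omega
  · have : ¬ (M * up + lw ≤ E) := fun h => hu (h0.2 h)
    omega

theorem firstEnd_le (hN : 1 ≤ N) (hE : N * lw ≤ E) : firstEnd lw up N E ≤ E := by
  have : 1 * lw ≤ N * lw := Nat.mul_le_mul_right _ hN
  unfold firstEnd; omega

/-- After a bag has been given away, the small items that any `l` of the remaining agents must
accept either all lie below the bag, or they lie together with the bag among the small items that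
any `l + 1` of the agents had to accept before. -/
theorem fillCount_step (hlu : lw ≤ up) (hE : N * lw ≤ E) (hpE : p ≤ E) (hp : lw ≤ p) {l a : ℕ}
    (hl : 1 ≤ l) (hlN : l ≤ N - 1)
    (ha : a = windowStart lw up (pivot lw up N E * lw) p) :
    (fillCount lw up (N - 1) (E - (p - a)) l ≤ a ∧
      fillCount lw up (N - 1) (E - (p - a)) l ≤ fillCount lw up N E l) ∨
    (p ≠ E ∧ a ≤ fillCount lw up (N - 1) (E - (p - a)) l ∧
      fillCount lw up (N - 1) (E - (p - a)) l + (p - a) ≤ fillCount lw up N E (l + 1)) := by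
  have hiff := pivot_le_iff hlu (by omega) hE
  set u := pivot lw up N E
  obtain ⟨W, rfl⟩ : ∃ W, N = W + l + 1 := ⟨N - 1 - l, by omega⟩
  have e0 : W + l + 1 - 1 = W + l := by omega
  have e1 : W + l + 1 - (l + 1) = W := by omega
  have e2 : W + l - l = W := by omega
  have e3 : W + l + 1 - l = W + 1 := by omega
  unfold fillCount
  rw [e0, e1, e2, e3]
  rw [e0] at hiff
  have f1 : (l + 1) * lw = l * lw + lw := by ring
  have f2 : (W + 1) * up = W * up + up := by ring
  rw [f1, f2]
  have f3 : (W + l + 1) * lw = W * lw + l * lw + lw := by ring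
  rw [f3] at hE
  have f4 : ∀ k, k * (up - lw) = k * up - k * lw := fun k => Nat.mul_sub _ _ _
  have f5 : ∀ k, k * lw ≤ k * up := fun k => Nat.mul_le_mul_left _ hlu
  have f6 : (W + l) * up = W * up + l * up := by ring
  rw [f6] at hiff
  have h1 := hiff l
  rw [f4] at h1
  have h2 := f5 l
  unfold windowStart at ha
  rcases Nat.lt_trichotomy l u with hlt | heq | hgt
  -- Below the pivot, the new count is `l * lw`, and the old count for l + 1 is `(l + 1) * lw`. A
  -- window that starts below `l * lw` is still in the first phase and has size exactly `lw`.
  · have h3 : l * lw + lw ≤ u * lw := by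
      rw [← f1]; exact Nat.mul_le_mul_right _ hlt
    have h4 : ¬ (u ≤ l) := by omega
    rw [h1] at h4
    omega
  · rw [← heq] at ha hiff h1
    have h4 := h1.1 le_rfl
    have h5 := hiff (l - 1)
    rw [f4] at h5
    obtain ⟨r, rfl⟩ : ∃ r, l = r + 1 := ⟨l - 1, by omega⟩
    simp only [Nat.add_sub_cancel] at h5
    have g1 : (r + 1) * up = r * up + up := by ring
    have g2 : (r + 1) * lw = r * lw + lw := by ring
    have g3 := f5 r
    have h6 : ¬ (r + 1 ≤ r) := by omega
    rw [h5] at h6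
    omega
  -- Above the pivot, the new count is what `W * up` leaves over. A window shorter than `up` starts
  -- at most at `u * lw`, below that count; a window of size `up` makes the new count equal to the
  -- old count for `l`.
  · have h3 : u * lw ≤ l * lw := Nat.mul_le_mul_right _ hgt.le
    have h5 := hiff (l - 1)
    rw [f4] at h5
    obtain ⟨r, rfl⟩ : ∃ r, l = r + 1 := ⟨l - 1, by omega⟩
    simp only [Nat.add_sub_cancel] at h5
    have g1 : (r + 1) * up = r * up + up := by ring
    have g2 : (r + 1) * lw = r * lw + lw := by ring
    have g3 := f5 r
    have g4 : u * lw ≤ r * lw := Nat.mul_le_mul_right _ (by omega)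
    have h6 : u ≤ r := by omega
    rw [h5] at h6
    have h7 : W * up + up + (r + 1) * lw ≤ E := by omega
    clear hiff h1 h2 h5 h6 f1 f2 f3 f4 f5 f6 g1 g2 g3 g4 hE
    generalize (r + 1) * lw = x at *
    generalize W * up = y at *
    generalize u * lw = z at *
    by_cases hs : up ≤ p - z
    · have ha' : a = p - up := by omega
      by_cases hpx : p ≤ up + x ∧ p ≠ E <;> omega
    · by_cases hpx : p = E <;> omega

end Window

/-! ### Removal of a window, and costs of windows. -/

/-- Removal of the entries at the positions `a, …, a + d - 1`. -/
def removeWindow {α : Type*} (a d : ℕ) (β : ℕ → α) (q : ℕ) : α :=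
  if q < a then β q else β (q + d)

section Removal

variable {β : ℕ → ℝ} {E a d : ℕ}

theorem prefixSum_removeWindow_of_le {q : ℕ} (hq : q ≤ a) :
    prefixSum (removeWindow a d β) q = prefixSum β q :=
  Finset.sum_congr rfl fun i hi => if_pos (by simp at hi; omega)

theorem prefixSum_removeWindow_of_ge {q : ℕ} (hq : a ≤ q) :
    prefixSum (removeWindow a d β) q = prefixSum β (q + d) - (prefixSum β (a + d) - prefixSum β a) := by
  induction q, hq using Nat.le_induction with
  | base => rw [prefixSum_removeWindow_of_le le_rfl]; ring
  | succ q hq ih =>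
    rw [prefixSum_succ, ih, show q + 1 + d = q + d + 1 by omega, prefixSum_succ, removeWindow,
      if_neg (by omega)]
    ring

theorem sum_range_add (β : ℕ → ℝ) (q d : ℕ) :
    ∑ t ∈ Finset.range d, β (q + t) = prefixSum β (q + d) - prefixSum β q := by
  unfold prefixSum
  rw [Finset.sum_range_add]; ring

/-- How a prefix sum changes when a window is removed. -/
theorem prefixSum_removeWindow (q : ℕ) :
    prefixSum (removeWindow a d β) q =
      prefixSum β q + ∑ t ∈ Finset.range d, (β (max q a + t) - β (a + t)) := by
  rw [Finset.sum_sub_distrib, sum_range_add, sum_range_add]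
  rcases le_total q a with h | h
  · rw [prefixSum_removeWindow_of_le h, max_eq_right h]; ring
  · rw [prefixSum_removeWindow_of_ge h, max_eq_left h]; ring

theorem le_removeWindow (hβ : ∀ i j, i ≤ j → j < E → β i ≤ β j) {i : ℕ} (hi : i + d < E) :
    β i ≤ removeWindow a d β i := by
  unfold removeWindow
  split
  · exact le_rfl
  · exact hβ _ _ (by omega) hi

end Removal

/-- The cost of the window with end `b`. -/
def windowCost (lw up o : ℕ) (β : ℕ → ℝ) (b : ℕ) : ℝ :=
  prefixSum β b - prefixSum β (windowStart lw up o b)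

section WindowCost

variable {lw up o E : ℕ} {β : ℕ → ℝ}

/-- When the end advances by one, the window gains item `q` and loses at most one item, which is no
dearer. -/
theorem windowCost_mono (hlu : lw ≤ up) (h0 : ∀ i < E, 0 ≤ β i)
    (hβ : ∀ i j, i ≤ j → j < E → β i ≤ β j) {b b' : ℕ} (hb : b ≤ b') (hE : b' ≤ E) :
    windowCost lw up o β b ≤ windowCost lw up o β b' := by
  induction b', hb using Nat.le_induction with
  | base => exact le_rfl
  | succ q hq ih =>
    refine (ih (by omega)).trans ?_
    unfold windowCost
    have h1 := windowStart_succ_le (o := o) (b := q) hlu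
    have h2 := windowStart_mono (lw := lw) (up := up) (le_refl o) (show q ≤ q + 1 by omega)
    have h3 := windowStart_le (lw := lw) (up := up) (o := o) (b := q)
    rw [prefixSum_succ]
    rcases (show windowStart lw up o (q + 1) = windowStart lw up o q ∨
      windowStart lw up o (q + 1) = windowStart lw up o q + 1 by omega) with h | h
    · rw [h]; linarith [h0 q (by omega)]
    · rw [h, prefixSum_succ]; linarith [hβ _ q h3 (by omega)]

/-- The start never moves down, so the new item is the only possible increase. This gives the
receiver's excess of at most one small item over her threshold. -/
theorem windowCost_le_add {b : ℕ} (h0 : ∀ i < E, 0 ≤ β i) (hE : b + 1 ≤ E) :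
    windowCost lw up o β (b + 1) ≤ windowCost lw up o β b + β b := by
  unfold windowCost
  have h2 := windowStart_mono (lw := lw) (up := up) (le_refl o) (show b ≤ b + 1 by omega)
  have h3 := windowStart_le (lw := lw) (up := up) (o := o) (b := b + 1)
  have := prefixSum_mono h0 h2 (by omega)
  rw [prefixSum_succ]
  linarith

/-- Windows become more expensive when a window is removed and the path of windows is lowered. -/
theorem windowCost_le_removeWindow {o' a d b : ℕ} (ho : o' ≤ o) (h0 : ∀ i < E, 0 ≤ β i)
    (hβ : ∀ i j, i ≤ j → j < E → β i ≤ β j) (hb : b + d ≤ E) :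
    windowCost lw up o β b ≤ windowCost lw up o' (removeWindow a d β) b := by
  unfold windowCost
  have h2 := windowStart_mono (lw := lw) (up := up) ho (le_refl b)
  have h3 := windowStart_le (lw := lw) (up := up) (o := o) (b := b)
  -- Position by position, the list after the removal is at least as dear; lowering the start adds
  -- further items of nonnegative cost.
  have h4 : prefixSum β b - prefixSum β (windowStart lw up o b) ≤
      prefixSum (removeWindow a d β) b - prefixSum (removeWindow a d β) (windowStart lw up o b) := by
    unfold prefixSum
    rw [← Finset.sum_Ico_eq_sub _ h3, ← Finset.sum_Ico_eq_sub _ h3]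
    refine Finset.sum_le_sum fun i hi => le_removeWindow hβ ?_
    simp at hi; omega
  have h5 : prefixSum (removeWindow a d β) (windowStart lw up o' b) ≤
      prefixSum (removeWindow a d β) (windowStart lw up o b) := by
    refine prefixSum_mono (E := b) (fun i hi => ?_) h2 h3
    exact (h0 i (by omega)).trans (le_removeWindow hβ (by omega))
  linarith

end WindowCost

/-! ### The invariant of the rounds. -/

section Rounds

variable {m lw up N E : ℕ} {c β : ℕ → ℝ} {τ ε δ : ℝ} {p a : ℕ}

/-- The invariant of the bags: any `l` of the remaining `N` agents can bear the `l` largest of the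
remaining large items and as many small items as they must accept. -/
def CanBear (m lw up N E : ℕ) (c β : ℕ → ℝ) (τ ε : ℝ) : Prop :=
  ∀ l : ℕ, 1 ≤ l → l ≤ N → ∑ r ∈ Finset.Ico (m - l) m, c r +
    prefixSum β (fillCount lw up N E l) ≤ (l + ε) * τ

/-- If the items newly forced on l agents lie below the window, the old inequality for l is enough.
Otherwise the window and these items lie in what l + 1 agents had to accept, and the bag, worth at
least (1 - δ)τ, is subtracted from the old inequality for l + 1. -/
theorem CanBear.step (h : CanBear m lw up N E c β τ ε) (hlu : lw ≤ up) (hN : N ≤ m)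
    (hE : N * lw ≤ E) (h0 : ∀ i < E, 0 ≤ β i) (hc : ∀ r r', r ≤ r' → r' < m → c r ≤ c r')
    (hpE : p ≤ E) (hp : lw ≤ p) (ha : a = windowStart lw up (pivot lw up N E * lw) p)
    (hτ : 0 ≤ δ * τ)
    (hval : p = E ∨ (1 - δ) * τ ≤ c (m - N) + windowCost lw up (pivot lw up N E * lw) β p) :
    CanBear m lw up (N - 1) (E - (p - a)) c (removeWindow a (p - a) β) τ (ε + δ) := by
  intro l hl hlN
  have hap : a ≤ p := ha ▸ windowStart_le
  have hfit : ∀ k, k ≤ N → fillCount lw up N E k ≤ E := fun k hk => by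
    have := Nat.mul_le_mul_right lw hk
    unfold fillCount; omega
  rcases fillCount_step hlu hE hpE hp hl hlN ha with ⟨h1, h2⟩ | ⟨h1, h2, h3⟩
  · rw [prefixSum_removeWindow_of_le h1]
    have h4 := h l hl (by omega)
    have h5 := prefixSum_mono h0 h2 (hfit l (by omega))
    linarith
  · have hval' := hval.resolve_left h1
    rw [prefixSum_removeWindow_of_ge h2]
    have h4 := h (l + 1) (by omega) (by omega)
    have h5 := prefixSum_mono h0 h3 (hfit (l + 1) (by omega))
    have h6 : ∑ r ∈ Finset.Ico (m - (l + 1)) m, c r =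
        c (m - (l + 1)) + ∑ r ∈ Finset.Ico (m - l) m, c r := by
      rw [Finset.sum_eq_sum_Ico_succ_bot (by omega), show m - (l + 1) + 1 = m - l by omega]
    have h7 := hc (m - N) (m - (l + 1)) (by omega) (by omega)
    unfold windowCost at hval'
    rw [← ha] at hval'
    rw [show a + (p - a) = p by omega]
    push_cast at h4
    linarith

/-- The cost of the bag for its receiver. -/
theorem CanBear.receiver (h : CanBear m lw up N E c β τ ε) (hlu : lw ≤ up) (hN : 1 ≤ N) (hNm : N ≤ m)
    (hE : N * lw ≤ E) (hE' : E ≤ N * up)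
    (h0 : ∀ i < E, 0 ≤ β i) (hc : ∀ r r', r ≤ r' → r' < m → c r ≤ c r')
    (hβ : ∀ i < E, β i ≤ τ / 2) {α : ℝ} (hε : (1 + ε) * τ ≤ α * τ)
    (hα : (1 - δ) * τ + τ / 2 ≤ α * τ)
    (hp : p = firstEnd lw up N E ∨ ∃ b, p = b + 1 ∧ b + 1 ≤ E ∧
      c (m - N) + windowCost lw up (pivot lw up N E * lw) β b ≤ (1 - δ) * τ) :
    c (m - N) + windowCost lw up (pivot lw up N E * lw) β p ≤ α * τ := by
  rcases hp with rfl | ⟨b, rfl, hbE, hb⟩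
  · unfold windowCost
    -- For the first window the invariant for l = 1 yields (1 + ε)τ, even with the dearest large
    -- item in the bag.
    rw [windowStart_firstEnd hlu hN hE hE']
    have h1 := h 1 le_rfl hN
    have h2 : fillCount lw up N E 1 = firstEnd lw up N E := by
      unfold fillCount firstEnd; simp
    rw [h2, Finset.sum_eq_sum_Ico_succ_bot (by omega), show m - 1 + 1 = m by omega] at h1
    simp at h1
    have h3 := hc (m - N) (m - 1) (by omega) (by omega)
    simp [prefixSum] at h1 ⊢
    linarith
  -- Otherwise the preceding window did not exceed the threshold, and a single small item, of cost
  -- at most τ/2, has been added to the bound.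
  · have := windowCost_le_add (lw := lw) (up := up) (o := pivot lw up N E * lw) h0 hbE
    linarith [hβ b (by omega)]

end Rounds


/-! ### The state between two rounds. -/

/-- State after `j` bags: `R` lists the remaining `E` small items, `own` the owners of the items
that are given away, `done` flags the agents that are served, and `B` collects their bags. -/
structure BagState (n m lw up : ℕ) (c : ℕ → ℕ → ℝ) (τ : ℕ → ℝ) (j E : ℕ) (R own done : ℕ → ℕ)
    (B : ℕ → Finset ℕ) : Prop where
  low : (n - j) * lw ≤ E
  high : E ≤ (n - j) * up
  strictMono : ∀ i i', i < i' → i' < E → R i < R i'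
  lt : ∀ i < E, R i < m - n
  active : ((Finset.range n).filter fun x => done x = 0).card = n - j
  cover : ∀ r < m, (∃ i < E, R i = r) ∨ m - n + j ≤ r ∨ ∃ x < n, done x ≠ 0 ∧ r ∈ B x
  mem : ∀ x < n, done x ≠ 0 → ∀ r ∈ B x, r < m - n + j ∧ (∀ i < E, R i ≠ r) ∧ own r = x
  size : ∀ x < n, done x ≠ 0 → lw + 1 ≤ (B x).card ∧ (B x).card ≤ up + 1
  cost : ∀ x < n, done x ≠ 0 → ∑ r ∈ B x, c x r ≤ (3 - (n : ℝ)⁻¹) / 2 * τ x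
  bear : ∀ x < n, done x = 0 →
    CanBear m lw up (n - j) E (c x) (fun i => c x (R i)) (τ x) (j / (2 * n))

/-- The assumptions on the costs `c` of the sorted items and on the bounds `τ`. -/
structure SortedCosts (n m lw up : ℕ) (c : ℕ → ℕ → ℝ) (τ : ℕ → ℝ) : Prop where
  agents_pos : 1 ≤ n
  lt : n < m
  le : lw ≤ up
  low : n * lw ≤ m - n
  high : m - n ≤ n * up
  nonneg : ∀ x < n, ∀ r < m, 0 ≤ c x r
  mono : ∀ x < n, ∀ r r', r ≤ r' → r' < m → c x r ≤ c x r'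
  proxy : ∀ x < n, IsProxy n m lw up (c x) (τ x)

section

variable {n m lw up : ℕ} {c : ℕ → ℕ → ℝ} {τ : ℕ → ℝ}

/-- This is the purpose of the field `pair`: no small item is dearer than rank `m - n - 1`. -/
theorem SortedCosts.small_le (h : SortedCosts n m lw up c τ) {x r : ℕ} (hx : x < n)
    (hr : r < m - n) : c x r ≤ τ x / 2 := by
  have h1 := (h.proxy x hx).pair
  have h2 := h.mono x hx r (m - n - 1) (by omega) (by omega)
  linarith

theorem SortedCosts.proxy_nonneg (h : SortedCosts n m lw up c τ) {x : ℕ} (hx : x < n) :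
    0 ≤ τ x := by
  have h1 := (h.proxy x hx).pair
  have h2 := h.nonneg x hx (m - n - 1) (by have := h.lt; omega)
  linarith

theorem SortedCosts.bagState_zero (h : SortedCosts n m lw up c τ) (own : ℕ → ℕ) {done : ℕ → ℕ}
    (hd : ∀ x < n, done x = 0) {R : ℕ → ℕ} (hR : ∀ i < m - n, R i = i) (B : ℕ → Finset ℕ) :
    BagState n m lw up c τ 0 (m - n) R own done B where
  low := h.low
  high := h.high
  strictMono i i' hi hi' := by rw [hR i (by omega), hR i' hi']; exact hi
  lt i hi := by rw [hR i hi]; exact hi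
  active := by
    rw [Finset.filter_true_of_mem fun x hx => hd x (Finset.mem_range.1 hx), Finset.card_range]
    rfl
  cover r hr := by
    rcases Nat.lt_or_ge r (m - n) with h | h
    · exact Or.inl ⟨r, h, hR r h⟩
    · exact Or.inr (Or.inl h)
  mem x hx hdx := absurd (hd x hx) hdx
  size x hx hdx := absurd (hd x hx) hdx
  cost x hx hdx := absurd (hd x hx) hdx
  bear x hx _ := by
    intro l hl hln
    have h1 := (h.proxy x hx).fill l hl hln
    have h2 : fillCount lw up n (m - n) l ≤ m - n := by
      have h3 := Nat.mul_le_mul_right lw hln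
      have h4 := h.low
      have h5 : l * lw ≤ n * lw := by simpa using h3
      unfold fillCount; omega
    have h3 : prefixSum (fun i => c x (R i)) (fillCount lw up (n - 0) (m - n) l) =
        ∑ r ∈ Finset.range (fillCount lw up n (m - n) l), c x r :=
      Finset.sum_congr rfl fun i hi => by
        simp at hi
        simp only
        rw [hR i (by omega)]
    rw [h3]
    simpa using h1

variable {j E p a rec : ℕ} {R own done R' own' done' : ℕ → ℕ} {B : ℕ → Finset ℕ}

theorem BagState.small_nonneg (hs : BagState n m lw up c τ j E R own done B)
    (h : SortedCosts n m lw up c τ) {x : ℕ} (hx : x < n) : ∀ i < E, 0 ≤ c x (R i) :=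
  fun i hi => h.nonneg x hx _ (by have := hs.lt i hi; omega)

theorem BagState.small_mono (hs : BagState n m lw up c τ j E R own done B)
    (h : SortedCosts n m lw up c τ) {x : ℕ} (hx : x < n) :
    ∀ i i', i ≤ i' → i' < E → c x (R i) ≤ c x (R i') := by
  intro i i' hi hi'
  rcases hi.eq_or_lt with rfl | hlt
  · exact le_rfl
  · exact h.mono x hx _ _ (hs.strictMono i i' hlt hi').le (by have := hs.lt i' hi'; omega)

/-- The state after the bag of the largest item `m - n + j` and the window from `a` to `p` has been
given to the agent `rec`. -/
theorem BagState.step (hs : BagState n m lw up c τ j E R own done B)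
    (h : SortedCosts n m lw up c τ) (hj : j < n)
    (hp : firstEnd lw up (n - j) E ≤ p) (hpE : p ≤ E)
    (ha : a = windowStart lw up (pivot lw up (n - j) E * lw) p)
    (hrec : rec < n) (hrecd : done rec = 0)
    (hval : ∀ x < n, done x = 0 → p = E ∨ τ x - τ x / (2 * n) ≤ c x (m - n + j) +
      windowCost lw up (pivot lw up (n - j) E * lw) (fun i => c x (R i)) p)
    (hrecp : p = firstEnd lw up (n - j) E ∨ ∃ b, p = b + 1 ∧ b + 1 ≤ E ∧ c rec (m - n + j) +
      windowCost lw up (pivot lw up (n - j) E * lw) (fun i => c rec (R i)) b ≤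
        τ rec - τ rec / (2 * n))
    (hR' : ∀ i < E - (p - a), R' i = removeWindow a (p - a) R i)
    (hownt : own' (m - n + j) = rec) (hownw : ∀ i, a ≤ i → i < p → own' (R i) = rec)
    (howno : ∀ r, r ≠ m - n + j → (∀ i, a ≤ i → i < p → R i ≠ r) → own' r = own r)
    (hdr : done' rec ≠ 0) (hdo : ∀ x, x ≠ rec → done' x = done x) :
    ∃ B', BagState n m lw up c τ (j + 1) (E - (p - a)) R' own' done' B' := by
  have hn := h.agents_pos
  have hlt := h.lt
  have hlu := h.le
  have hap : a ≤ p := ha ▸ windowStart_le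
  obtain ⟨z1, z2, z3, z4⟩ := windowStart_size hlu (by omega) hs.low hs.high hp hpE
  rw [← ha] at z1 z2 z3 z4
  have hnj : n - (j + 1) = n - j - 1 := by omega
  have hmj : m - (n - j) = m - n + j := by omega
  have hlwp : lw ≤ p := by omega
  set bag : Finset ℕ := insert (m - n + j) ((Finset.Ico a p).image R) with hbag
  have hinj : ∀ i i', i < E → i' < E → R i = R i' → i = i' := by
    intro i i' hi hi' heq
    rcases Nat.lt_trichotomy i i' with hh | hh | hh
    · have := hs.strictMono i i' hh hi'; omega
    · exact hh
    · have := hs.strictMono i' i hh hi; omega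
  have hinjOn : Set.InjOn R (Finset.Ico a p : Finset ℕ) := by
    intro i hi i' hi' heq
    simp at hi hi'
    exact hinj i i' (by omega) (by omega) heq
  have hnotin : m - n + j ∉ (Finset.Ico a p).image R := by
    intro hmem
    obtain ⟨i, hi, hri⟩ := Finset.mem_image.1 hmem
    have := hs.lt i (by simp at hi; omega)
    omega
  have hcard : bag.card = p - a + 1 := by
    rw [hbag, Finset.card_insert_of_notMem hnotin, Finset.card_image_of_injOn hinjOn, Nat.card_Ico]
  have hR'eq : ∀ i < E - (p - a), ∃ i' < E, R' i = R i' ∧ (i' < a ∨ p ≤ i') ∧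
      i' = if i < a then i else i + (p - a) := by
    intro i hi
    rw [hR' i hi]
    unfold removeWindow
    split
    · rename_i hia
      exact ⟨i, by omega, rfl, Or.inl hia, rfl⟩
    · exact ⟨i + (p - a), by omega, rfl, by omega, rfl⟩
  have hbagmem : ∀ r ∈ bag, r = m - n + j ∨ ∃ i, a ≤ i ∧ i < p ∧ R i = r := by
    intro r hr
    rw [hbag, Finset.mem_insert, Finset.mem_image] at hr
    rcases hr with hr | ⟨i, hi, hri⟩
    · exact Or.inl hr
    · simp at hi; exact Or.inr ⟨i, hi.1, hi.2, hri⟩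
  have hold : ∀ x < n, done' x ≠ 0 → x ≠ rec → done x ≠ 0 := fun x _ h1 h2 => by
    rw [← hdo x h2]; exact h1
  refine ⟨Function.update B rec bag, ?_, ?_, ?_, ?_, ?_, ?_, ?_, ?_, ?_, ?_⟩
  · rw [hnj]; exact z3
  · rw [hnj]; exact z4
  · intro i i' hi hi'
    obtain ⟨k, hk, e1, _, e2⟩ := hR'eq i (by omega)
    obtain ⟨k', hk', e1', _, e2'⟩ := hR'eq i' hi'
    rw [e1, e1']
    refine hs.strictMono k k' ?_ hk'
    rw [e2, e2']
    split <;> split <;> omega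
  · intro i hi
    obtain ⟨k, hk, e1, _, _⟩ := hR'eq i hi
    rw [e1]; exact hs.lt k hk
  · have heq : (Finset.range n).filter (fun x => done' x = 0) =
        ((Finset.range n).filter fun x => done x = 0).erase rec := by
      ext x
      simp only [Finset.mem_filter, Finset.mem_range, Finset.mem_erase]
      rcases eq_or_ne x rec with rfl | hne
      · simp [hdr]
      · rw [hdo x hne]; simp [hne]
    rw [heq, Finset.card_erase_of_mem (by simp [hrec, hrecd]), hs.active]
    omega
  · intro r hr
    by_cases hrt : r = m - n + j
    · exact Or.inr (Or.inr ⟨rec, hrec, hdr, by simp [hbag, hrt]⟩)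
    rcases hs.cover r hr with ⟨i, hi, hri⟩ | hge | ⟨x, hx, hdx, hrx⟩
    · by_cases hia : i < a
      · exact Or.inl ⟨i, by omega, by rw [hR' i (by omega), removeWindow, if_pos hia, hri]⟩
      by_cases hip : i < p
      · refine Or.inr (Or.inr ⟨rec, hrec, hdr, ?_⟩)
        rw [Function.update_self, hbag, Finset.mem_insert, Finset.mem_image]
        exact Or.inr ⟨i, by simp; omega, hri⟩
      · refine Or.inl ⟨i - (p - a), by omega, ?_⟩
        rw [hR' _ (by omega), removeWindow, if_neg (by omega),
          show i - (p - a) + (p - a) = i by omega, hri]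
    · exact Or.inr (Or.inl (by omega))
    · have hxr : x ≠ rec := by rintro rfl; exact hdx hrecd
      exact Or.inr (Or.inr ⟨x, hx, by rw [hdo x hxr]; exact hdx, by
        rw [Function.update_of_ne hxr]; exact hrx⟩)
  · intro x hx hdx r hr
    rcases eq_or_ne x rec with rfl | hxr
    · rw [Function.update_self] at hr
      rcases hbagmem r hr with rfl | ⟨i, h1, h2, rfl⟩
      · refine ⟨by omega, fun i hi => ?_, hownt⟩
        obtain ⟨k, hk, e1, _, _⟩ := hR'eq i hi
        have := hs.lt k hk
        rw [e1]; omega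
      · refine ⟨by have := hs.lt i (by omega); omega, fun i' hi' heq => ?_, hownw i h1 h2⟩
        obtain ⟨k, hk, e1, e2, _⟩ := hR'eq i' hi'
        rw [e1] at heq
        have := hinj k i hk (by omega) heq
        omega
    · rw [Function.update_of_ne hxr] at hr
      obtain ⟨h1, h2, h3⟩ := hs.mem x hx (hold x hx hdx hxr) r hr
      refine ⟨by omega, fun i hi => ?_, ?_⟩
      · obtain ⟨k, hk, e1, _, _⟩ := hR'eq i hi
        rw [e1]; exact h2 k hk
      · rw [howno r (by omega) fun i _ h4 => h2 i (by omega), h3]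
  · intro x hx hdx
    rcases eq_or_ne x rec with rfl | hxr
    · rw [Function.update_self, hcard]; omega
    · rw [Function.update_of_ne hxr]; exact hs.size x hx (hold x hx hdx hxr)
  · intro x hx hdx
    rcases eq_or_ne x rec with rfl | hxr
    · rw [Function.update_self, hbag, Finset.sum_insert hnotin, Finset.sum_image hinjOn]
      have hτ := h.proxy_nonneg hx
      have hn0 : (0 : ℝ) < n := by exact_mod_cast hn
      have hjn : (j : ℝ) + 1 ≤ n := by exact_mod_cast hj
      have key := (hs.bear x hx hrecd).receiver (p := p) (δ := 1 / (2 * n))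
        (α := (3 - (n : ℝ)⁻¹) / 2) hlu (by omega) (by omega)
        hs.low hs.high (hs.small_nonneg h hx) (h.mono x hx)
        (fun i hi => h.small_le hx (hs.lt i hi)) ?_ ?_ ?_
      · unfold windowCost at key
        rw [← ha, hmj] at key
        unfold prefixSum at key
        rwa [← Finset.sum_Ico_eq_sub _ hap] at key
      · refine mul_le_mul_of_nonneg_right ?_ hτ
        -- At most n - 1 bags came before, so 1 + ε ≤ 1 + (n - 1)/(2n) = (3 - 1/n)/2.
        have e1 : (j : ℝ) / (2 * n) ≤ (n - 1) / (2 * n) := by gcongr; linarith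
        have e2 : ((n : ℝ) - 1) / (2 * n) = (1 - (n : ℝ)⁻¹) / 2 := by field_simp
        linarith
      -- With δ = 1/(2n), threshold plus one small item gives exactly the claimed ratio, so both
      -- cases of the receiver's bound meet there.
      · have : (1 - 1 / (2 * (n : ℝ))) * τ x + τ x / 2 = (3 - (n : ℝ)⁻¹) / 2 * τ x := by
          field_simp; ring
        exact this.le
      · rcases hrecp with e | ⟨b, e1, e2, e3⟩
        · exact Or.inl e
        · refine Or.inr ⟨b, e1, e2, ?_⟩
          rw [hmj]
          refine e3.trans (le_of_eq ?_)
          ring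
    · rw [Function.update_of_ne hxr]; exact hs.cost x hx (hold x hx hdx hxr)
  · intro x hx hdx
    have hxr : x ≠ rec := by rintro rfl; exact hdr hdx
    have hdx' : done x = 0 := by rw [← hdo x hxr]; exact hdx
    have hτ := h.proxy_nonneg hx
    have key := (hs.bear x hx hdx').step (p := p) (a := a) (δ := 1 / (2 * n)) hlu (by omega)
      hs.low (hs.small_nonneg h hx) (h.mono x hx) hpE hlwp ha (by positivity) ?_
    · intro l hl hlN
      have h1 := key l hl (by omega)
      have hfit : fillCount lw up (n - (j + 1)) (E - (p - a)) l ≤ E - (p - a) := by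
        have h3 := Nat.mul_le_mul_right lw hlN
        rw [hnj] at h3
        unfold fillCount; omega
      have h2 : prefixSum (fun i => c x (R' i)) (fillCount lw up (n - (j + 1)) (E - (p - a)) l) =
          prefixSum (removeWindow a (p - a) fun i => c x (R i))
            (fillCount lw up (n - j - 1) (E - (p - a)) l) := by
        rw [hnj]
        rw [hnj] at hfit
        refine Finset.sum_congr rfl fun i hi => ?_
        simp only
        rw [hR' i (by simp at hi; omega)]
        unfold removeWindow
        split <;> rfl
      rw [h2]
      refine h1.trans (le_of_eq ?_)
      push_cast
      ring
    · rcases hval x hx hdx' with e | e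
      · exact Or.inl e
      · right
        rw [hmj]
        refine le_trans (le_of_eq ?_) e
        ring

/-- When all agents are served, their bags form the bundles of an allocation. -/
theorem BagState.final (hs : BagState n m lw up c τ n E R own done B)
    (h : SortedCosts n m lw up c τ) : (∀ r < m, own r < n) ∧ ∀ x < n,
      lw + 1 ≤ ((Finset.range m).filter fun r => own r = x).card ∧
      ((Finset.range m).filter fun r => own r = x).card ≤ up + 1 ∧
      ∑ r ∈ (Finset.range m).filter (fun r => own r = x), c x r ≤ (3 - (n : ℝ)⁻¹) / 2 * τ x := by
  have hlt := h.lt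
  have hE : E = 0 := by have := hs.high; simpa using this
  have hdone : ∀ x < n, done x ≠ 0 := by
    intro x hx hd
    have := hs.active
    rw [Nat.sub_self, Finset.card_eq_zero] at this
    exact Finset.notMem_empty x (this ▸ by simp [hx, hd])
  have hcov : ∀ r < m, ∃ x < n, r ∈ B x := by
    intro r hr
    rcases hs.cover r hr with ⟨i, hi, _⟩ | hge | ⟨x, hx, _, hrx⟩
    · omega
    · omega
    · exact ⟨x, hx, hrx⟩
  have hB : ∀ x < n, (Finset.range m).filter (fun r => own r = x) = B x := by
    intro x hx
    ext r
    simp only [Finset.mem_filter, Finset.mem_range]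
    constructor
    · rintro ⟨hr, hrx⟩
      obtain ⟨y, hy, hry⟩ := hcov r hr
      have := (hs.mem y hy (hdone y hy) r hry).2.2
      rw [hrx] at this
      rwa [this]
    · intro hr
      have := hs.mem x hx (hdone x hx) r hr
      exact ⟨by omega, this.2.2⟩
  refine ⟨fun r hr => ?_, fun x hx => ?_⟩
  · obtain ⟨x, hx, hrx⟩ := hcov r hr
    rw [(hs.mem x hx (hdone x hx) r hrx).2.2]
    exact hx
  · rw [hB x hx]
    exact ⟨(hs.size x hx (hdone x hx)).1, (hs.size x hx (hdone x hx)).2, hs.cost x hx (hdone x hx)⟩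

end


/-! ### The window pointer of a single agent. -/

/-- The window of an agent between two rounds: `S` is the cost of the window from `A` to `e`, and all
windows with a later end reach the threshold `thr`. -/
structure IsPointer (lw up o E : ℕ) (β : ℕ → ℝ) (top thr : ℝ) (A e : ℕ) (S : ℝ) : Prop where
  end_le : e ≤ E
  start_le : windowStart lw up o e ≤ A
  cost : S = prefixSum β e - prefixSum β A
  later : ∀ b, e < b → b ≤ E → thr ≤ top + windowCost lw up o β b

/-- At the end `q` the windows of an agent start to reach the threshold. -/
structure IsCrossing (lw up o E b₀ : ℕ) (β : ℕ → ℝ) (top thr : ℝ) (q : ℕ) : Prop where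
  ge : b₀ ≤ q
  le : q ≤ E
  reached : ∀ p, q ≤ p → p ≤ E → p = E ∨ thr ≤ top + windowCost lw up o β p
  minimal : q = b₀ ∨ ∃ b, q = b + 1 ∧ b + 1 ≤ E ∧ top + windowCost lw up o β b ≤ thr

/-- If the window that ends at `e` is below the threshold, the crossing is `e + 1`; if it is not,
then `e = 0` and everything has crossed. The result is clamped between the first legal end `b₀` and
`E`. -/
theorem IsPointer.isCrossing {lw up o E b₀ : ℕ} {β : ℕ → ℝ} {top thr : ℝ} {A e : ℕ} {S : ℝ}
    (h : IsPointer lw up o E β top thr A e S) (hA : A = windowStart lw up o e)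
    (hlu : lw ≤ up) (h0 : ∀ i < E, 0 ≤ β i) (hβ : ∀ i j, i ≤ j → j < E → β i ≤ β j)
    (hb₀ : b₀ ≤ E) (hterm : e = 0 ∨ top + S < thr) {w : ℕ}
    (hw : (thr ≤ top + S ∧ w = e) ∨ (top + S < thr ∧ w = e + 1)) :
    IsCrossing lw up o E b₀ β top thr (max b₀ (min w E)) := by
  have hS : S = windowCost lw up o β e := by rw [h.cost, hA]; rfl
  rw [hS] at hterm hw
  have hle := h.end_le
  refine ⟨le_max_left _ _, by omega, fun p hp hpE => ?_, ?_⟩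
  · rcases hpE.eq_or_lt with hE | hlt
    · exact Or.inl hE
    right
    rcases hw with ⟨h1, rfl⟩ | ⟨h1, rfl⟩
    · have := windowCost_mono (o := o) hlu h0 hβ (show w ≤ p by omega) hpE
      linarith
    · exact h.later p (by omega) hpE
  · by_cases hq : max b₀ (min w E) = b₀
    · exact Or.inl hq
    right
    rcases hw with ⟨h1, rfl⟩ | ⟨h1, rfl⟩
    · rcases hterm with h2 | h2
      · omega
      · linarith
    · refine ⟨max b₀ (min (e + 1) E) - 1, by omega, by omega, ?_⟩
      have := windowCost_mono (o := o) hlu h0 hβ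
        (show max b₀ (min (e + 1) E) - 1 ≤ e by omega) hle
      linarith

namespace RealRAM.Chores

/-- The start of the window with end `b`. -/
def startExp (b : NExp) : NExp := .sup (.inf (b - .var 16) (.var 18)) (b - .var 17)

/-- The cost for agent `11` of the remaining small item number `q`. -/
def smallCost (q : NExp) : RExp := .load 1 (.var 11 * items + .load 4 q)

/-- The cost for agent `11` of the current bag with her current window. -/
def bagCost : RExp :=
  .load 1 (.var 11 * items + (items - agents + .var 15)) + .load 4 (.var 11)

/-- Lower the start of the window of agent `11`. -/
def lowerStart : Prog :=
  .setNat 7 (.var 11) (.load 7 (.var 11) - 1) ;;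
  .setReal 4 (.var 11) (.load 4 (.var 11) + smallCost (.load 7 (.var 11)))

/-- Lower the end of the window of agent `11`. -/
def lowerEnd : Prog :=
  .setNat 8 (.var 11) (.load 8 (.var 11) - 1) ;;
  .setReal 4 (.var 11) (.load 4 (.var 11) - smallCost (.load 8 (.var 11)))

/-- Lower the start of the window of agent `11` to its place on the path of windows. -/
def alignWindow : Prog :=
  .while (.natLT (startExp (.load 8 (.var 11))) (.load 7 (.var 11))) lowerStart

/-- Lower the window of agent `11` until it does not reach the threshold. -/
def lowerWindow : Prog :=
  .while (.and (.natLE 1 (.load 8 (.var 11))) (.realLE (.load 3 (.var 11)) bagCost))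
    (lowerEnd ;;
     .ite (.natLT (startExp (.load 8 (.var 11))) (.load 7 (.var 11))) lowerStart .skip)

/-- Let agent `11` compete for the current bag. -/
def compete : Prog :=
  .ite (.realLE (.load 3 (.var 11)) bagCost) (.setVar 24 (.load 8 (.var 11)))
    (.setVar 24 (.load 8 (.var 11) + 1)) ;;
  .setVar 24 (.sup (.var 26) (.inf (.var 24) (.var 14))) ;;
  .ite (.natLE (.var 19) (.var 24)) (.setVar 19 (.var 24) ;; .setVar 20 (.var 11)) .skip

/-- Find the window of agent `11`. -/
def scanAgent : Prog := alignWindow ;; lowerWindow ;; compete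

variable {o : ℕ → ℕ → ℝ} {s : Mem} {k n m x lw up st E j : ℕ} {β : ℕ → ℝ} {top thr : ℝ}

/-- The memory `s` stores the data on which the windows of agent `x` depend. -/
structure Shows (s : Mem) (n m x lw up st E j : ℕ) (β : ℕ → ℝ) (top thr : ℝ) : Prop where
  agents_eq : s.nat 0 0 = n
  items_eq : s.nat 0 1 = m
  agent_eq : s.nat 11 0 = x
  lw_eq : s.nat 16 0 = lw
  up_eq : s.nat 17 0 = up
  st_eq : s.nat 18 0 = st
  E_eq : s.nat 14 0 = E
  j_eq : s.nat 15 0 = j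
  small : ∀ q < E, s.real 1 (x * m + s.nat 4 q) = β q
  top_eq : s.real 1 (x * m + (m - n + j)) = top
  thr_eq : s.real 3 x = thr

theorem Shows.of_frame {s s' : Mem} {p : Prog} (h : Shows s n m x lw up st E j β top thr)
    (hf : p.Frame s s')
    (hn : ∀ a ∈ [0, 4, 11, 14, 15, 16, 17, 18], a ∉ p.natWrites)
    (hr : ∀ a ∈ [1, 3], a ∉ p.realWrites) :
    Shows s' n m x lw up st E j β top thr := by
  have h0 := hf.nat 0 (hn 0 (by decide))
  have h4 := hf.nat 4 (hn 4 (by decide))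
  have h11 := hf.nat 11 (hn 11 (by decide))
  have h14 := hf.nat 14 (hn 14 (by decide))
  have h15 := hf.nat 15 (hn 15 (by decide))
  have h16 := hf.nat 16 (hn 16 (by decide))
  have h17 := hf.nat 17 (hn 17 (by decide))
  have h18 := hf.nat 18 (hn 18 (by decide))
  have r1 := hf.real 1 (hr 1 (by decide))
  have r3 := hf.real 3 (hr 3 (by decide))
  exact ⟨by rw [h0, h.agents_eq], by rw [h0, h.items_eq], by rw [h11, h.agent_eq], by rw [h16, h.lw_eq],
    by rw [h17, h.up_eq], by rw [h18, h.st_eq], by rw [h14, h.E_eq], by rw [h15, h.j_eq],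
    fun q hq => by rw [r1, h4, h.small q hq], by rw [r1, h.top_eq], by rw [r3, h.thr_eq]⟩

theorem Shows.eval_startExp (h : Shows s n m x lw up st E j β top thr) (b : NExp) :
    (startExp b).eval s = windowStart lw up st (b.eval s) := by
  simp [startExp, windowStart, h.lw_eq, h.up_eq, h.st_eq]

theorem Shows.eval_bagCost (h : Shows s n m x lw up st E j β top thr) :
    bagCost.eval o s = top + s.real 4 x := by
  simp [bagCost, Chores.items, Chores.agents, h.items_eq, h.agents_eq, h.agent_eq, h.j_eq, h.top_eq]

/-- Only the entries of agent `x` have been changed. -/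
def SameOthers (x : ℕ) (s s' : Mem) : Prop :=
  ∀ y, y ≠ x → s'.nat 7 y = s.nat 7 y ∧ s'.nat 8 y = s.nat 8 y ∧ s'.real 4 y = s.real 4 y

theorem SameOthers.trans {s s' s'' : Mem} (h : SameOthers x s s') (h' : SameOthers x s' s'') :
    SameOthers x s s'' := fun y hy =>
  ⟨(h' y hy).1.trans (h y hy).1, (h' y hy).2.1.trans (h y hy).2.1,
    (h' y hy).2.2.trans (h y hy).2.2⟩

theorem Shows.run_lowerStart (h : Shows s n m x lw up st E j β top thr) {A : ℕ}
    (hA : s.nat 7 x = A + 1) (hAE : A < E) :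
    (lowerStart.run o s).nat 7 x = A ∧ (lowerStart.run o s).nat 8 x = s.nat 8 x ∧
    (lowerStart.run o s).real 4 x = s.real 4 x + β A ∧ SameOthers x s (lowerStart.run o s) := by
  have := h.small A hAE
  simp [lowerStart, smallCost, Prog.run, h.agent_eq, hA, Chores.items, h.items_eq, this, SameOthers]
  intro y hy
  simp [hy]

theorem Shows.run_lowerEnd (h : Shows s n m x lw up st E j β top thr) {e : ℕ}
    (he : s.nat 8 x = e + 1) (heE : e < E) :
    (lowerEnd.run o s).nat 8 x = e ∧ (lowerEnd.run o s).nat 7 x = s.nat 7 x ∧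
    (lowerEnd.run o s).real 4 x = s.real 4 x - β e ∧ SameOthers x s (lowerEnd.run o s) := by
  have := h.small e heE
  simp [lowerEnd, smallCost, Prog.run, h.agent_eq, he, Chores.items, h.items_eq, this, SameOthers]
  intro y hy
  simp [hy]

/-- A lower pivot lowers the path, so the stored start may lie above the path for the same end.
Every correction is paid for by the decrease of the start. -/
theorem runs_alignWindow (h : Shows s n m x lw up st E j β top thr)
    (hp : IsPointer lw up st E β top thr (s.nat 7 x) (s.nat 8 x) (s.real 4 x))
    (hAE : s.nat 7 x ≤ E) (hk : 100 * s.nat 7 x + 50 ≤ k) :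
    alignWindow.Runs o s k fun k' s' => k + 100 * s'.nat 7 x ≤ k' + 100 * s.nat 7 x + 50 ∧
      SameOthers x s s' ∧ s'.nat 8 x = s.nat 8 x ∧
      s'.nat 7 x = windowStart lw up st (s'.nat 8 x) ∧
      IsPointer lw up st E β top thr (s'.nat 7 x) (s'.nat 8 x) (s'.real 4 x) := by
  refine .loop 50 (fun k' s' => k + 100 * s'.nat 7 x ≤ k' + 100 * s.nat 7 x ∧
      SameOthers x s s' ∧ s'.nat 8 x = s.nat 8 x ∧ s'.nat 7 x ≤ E ∧
      IsPointer lw up st E β top thr (s'.nat 7 x) (s'.nat 8 x) (s'.real 4 x)) (by decide)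
    ⟨le_rfl, fun _ _ => ⟨rfl, rfl, rfl⟩, rfl, hAE, hp⟩ ?_
  rintro k' s' hf ⟨hk', hso, h8, h7, hp'⟩
  have h' := h.of_frame hf (by decide) (by decide)
  refine ⟨by omega, fun hb => ?_, fun hb => ?_⟩
  · simp only [BExp.holds_natLT, h'.eval_startExp] at hb
    simp [h'.agent_eq] at hb
    obtain ⟨A, hA⟩ : ∃ A, s'.nat 7 x = A + 1 := ⟨s'.nat 7 x - 1, by omega⟩
    refine .straight 50 (by decide) (by decide) (by omega) ?_
    obtain ⟨e1, e2, e3, e4⟩ := h'.run_lowerStart (o := o) hA (by omega)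
    rw [e1, e2, e3]
    refine ⟨by omega, hso.trans e4, h8, by omega, hp'.end_le, by omega, ?_, hp'.later⟩
    rw [hp'.cost, hA, prefixSum_succ]; ring
  · simp only [BExp.holds_natLT, h'.eval_startExp] at hb
    simp [h'.agent_eq] at hb
    exact ⟨by omega, hso, h8, le_antisymm hb hp'.start_le, hp'⟩

/-- Each pass establishes the threshold property of one more end before discarding it. The 200
credits of a pass come from the decrease of the end. -/
theorem runs_lowerWindow (h : Shows s n m x lw up st E j β top thr) (hlu : lw ≤ up)
    (hp : IsPointer lw up st E β top thr (s.nat 7 x) (s.nat 8 x) (s.real 4 x))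
    (hA : s.nat 7 x = windowStart lw up st (s.nat 8 x))
    (hk : 200 * (s.nat 7 x + s.nat 8 x) + 50 ≤ k) :
    lowerWindow.Runs o s k fun k' s' =>
      k + 200 * (s'.nat 7 x + s'.nat 8 x) ≤ k' + 200 * (s.nat 7 x + s.nat 8 x) + 50 ∧
      SameOthers x s s' ∧
      s'.nat 7 x = windowStart lw up st (s'.nat 8 x) ∧
      (s'.nat 8 x = 0 ∨ top + s'.real 4 x < thr) ∧
      IsPointer lw up st E β top thr (s'.nat 7 x) (s'.nat 8 x) (s'.real 4 x) := by
  refine .loop 50 (fun k' s' =>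
      k + 200 * (s'.nat 7 x + s'.nat 8 x) ≤ k' + 200 * (s.nat 7 x + s.nat 8 x) ∧
      SameOthers x s s' ∧
      s'.nat 7 x = windowStart lw up st (s'.nat 8 x) ∧
      IsPointer lw up st E β top thr (s'.nat 7 x) (s'.nat 8 x) (s'.real 4 x)) (by decide)
    ⟨le_rfl, fun _ _ => ⟨rfl, rfl, rfl⟩, hA, hp⟩ ?_
  rintro k' s' hf ⟨hk', hso, h7, hp'⟩
  have h' := h.of_frame hf (by decide) (by decide)
  refine ⟨by omega, fun hb => ?_, fun hb => ?_⟩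
  · simp only [BExp.holds_and, BExp.holds_realLE, h'.eval_bagCost] at hb
    simp [h'.agent_eq, h'.thr_eq] at hb
    obtain ⟨e, he⟩ : ∃ e, s'.nat 8 x = e + 1 := ⟨s'.nat 8 x - 1, by omega⟩
    have heE : e + 1 ≤ E := he ▸ hp'.end_le
    have hcost := hp'.cost
    have hlater := hp'.later
    have hthis : thr ≤ top + windowCost lw up st β (e + 1) := by
      have := hb.2
      rw [hcost, h7, he] at this
      exact this
    have hlater' : ∀ b, e < b → b ≤ E → thr ≤ top + windowCost lw up st β b := by
      intro b hb1 hb2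
      rcases (show e + 1 ≤ b by omega).eq_or_lt with rfl | hlt
      · exact hthis
      · exact hlater b (by omega) hb2
    obtain ⟨e1, e2, e3, e4⟩ := h'.run_lowerEnd (o := o) he (by omega)
    have hf₁ : lowerEnd.Frame s' (lowerEnd.run o s') :=
      (Prog.exec_of_loopFree o (p := lowerEnd) rfl s').choose_spec.2.frame
    have h₁ := h'.of_frame hf₁ (by decide) (by decide)
    -- When the end drops by one, the start drops by at most one, so a single conditional step
    -- realigns the window.
    have w1 := windowStart_succ_le (o := st) (b := e) hlu
    have w2 := windowStart_mono (lw := lw) (up := up) (le_refl st) (show e ≤ e + 1 by omega)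
    have w3 := windowStart_le (lw := lw) (up := up) (o := st) (b := e)
    rw [he] at h7
    refine .straight 150 (by decide) (by decide) (by omega) ?_
    simp only [Prog.run, BExp.holds_natLT, h₁.eval_startExp]
    simp only [NExp.eval_load, NExp.eval_var, h₁.agent_eq, e1, e2]
    split
    · rename_i hlt
      obtain ⟨A, hA'⟩ : ∃ A, s'.nat 7 x = A + 1 := ⟨s'.nat 7 x - 1, by omega⟩
      obtain ⟨f1, f2, f3, f4⟩ := h₁.run_lowerStart (o := o) (e2.trans hA') (by omega)
      rw [f1, f2, f3, e1, e3]
      have hAe : A = windowStart lw up st e := by omega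
      refine ⟨by omega, (hso.trans e4).trans f4, hAe, by omega, hAe.ge, ?_, hlater'⟩
      rw [hcost, he, hA', prefixSum_succ, prefixSum_succ]; ring
    · rename_i hlt
      rw [e1, e2, e3]
      refine ⟨by omega, hso.trans e4, by omega, by omega, by omega, ?_, hlater'⟩
      rw [hcost, he, prefixSum_succ]; ring
  · simp only [BExp.holds_and, BExp.holds_realLE, h'.eval_bagCost] at hb
    simp [h'.agent_eq, h'.thr_eq] at hb
    refine ⟨by omega, hso, h7, ?_, hp'⟩
    rcases Nat.eq_zero_or_pos (s'.nat 8 x) with h8 | h8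
    · exact Or.inl h8
    · exact Or.inr (hb h8)

theorem runs_scanAgent (h : Shows s n m x lw up st E j β top thr) (hlu : lw ≤ up)
    (h0 : ∀ i < E, 0 ≤ β i) (hβ : ∀ i j, i ≤ j → j < E → β i ≤ β j)
    (hp : IsPointer lw up st E β top thr (s.nat 7 x) (s.nat 8 x) (s.real 4 x))
    (hAE : s.nat 7 x ≤ E) (hb : s.nat 26 0 ≤ E)
    (hk : 200 * (s.nat 7 x + s.nat 8 x) + 200 ≤ k) :
    scanAgent.Runs o s k fun k' s' =>
      k + 200 * (s'.nat 7 x + s'.nat 8 x) ≤ k' + 200 * (s.nat 7 x + s.nat 8 x) + 200 ∧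
      SameOthers x s s' ∧
      s'.nat 7 x = windowStart lw up st (s'.nat 8 x) ∧
      IsPointer lw up st E β top thr (s'.nat 7 x) (s'.nat 8 x) (s'.real 4 x) ∧
      ∃ q, IsCrossing lw up st E (s.nat 26 0) β top thr q ∧
        ((s.nat 19 0 ≤ q ∧ s'.nat 19 0 = q ∧ s'.nat 20 0 = x) ∨
         (q < s.nat 19 0 ∧ s'.nat 19 0 = s.nat 19 0 ∧ s'.nat 20 0 = s.nat 20 0)) := by
  refine .seq ((runs_alignWindow h hp hAE (by omega)).mono ?_)
  rintro k₁ s₁ hf₁ ⟨hk₁, hso₁, h8₁, h7₁, hp₁⟩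
  have h₁ := h.of_frame hf₁ (by decide) (by decide)
  have h7le : s₁.nat 7 x ≤ s.nat 7 x := by rw [h7₁, h8₁]; exact hp.start_le
  refine .seq ((runs_lowerWindow h₁ hlu hp₁ h7₁ (by omega)).mono ?_)
  rintro k₂ s₂ hf₂ ⟨hk₂, hso₂, h7₂, hterm, hp₂⟩
  have h₂ := h₁.of_frame hf₂ (by decide) (by decide)
  have e26 : s₂.nat 26 0 = s.nat 26 0 := by
    rw [hf₂.nat 26 (by decide), hf₁.nat 26 (by decide)]
  have e19 : s₂.nat 19 0 = s.nat 19 0 := by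
    rw [hf₂.nat 19 (by decide), hf₁.nat 19 (by decide)]
  have e20 : s₂.nat 20 0 = s.nat 20 0 := by
    rw [hf₂.nat 20 (by decide), hf₁.nat 20 (by decide)]
  have cross := fun w hw => hp₂.isCrossing (w := w) h7₂ hlu h0 hβ hb hterm hw
  refine .straight 100 (by decide) (by decide) (by omega) ?_
  have hfin : ∀ w, ((thr ≤ top + s₂.real 4 x ∧ w = s₂.nat 8 x) ∨
      (top + s₂.real 4 x < thr ∧ w = s₂.nat 8 x + 1)) →
      (compete.run o s₂).nat 7 = s₂.nat 7 ∧ (compete.run o s₂).nat 8 = s₂.nat 8 ∧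
      (compete.run o s₂).real = s₂.real ∧
      ((s.nat 19 0 ≤ max (s.nat 26 0) (min w E) ∧
        (compete.run o s₂).nat 19 0 = max (s.nat 26 0) (min w E) ∧
        (compete.run o s₂).nat 20 0 = x) ∨
       (max (s.nat 26 0) (min w E) < s.nat 19 0 ∧ (compete.run o s₂).nat 19 0 = s.nat 19 0 ∧
        (compete.run o s₂).nat 20 0 = s.nat 20 0)) := by
    intro w hw
    have hx := h₂.agent_eq
    have hE := h₂.E_eq
    have hthr := h₂.thr_eq
    have hbag := h₂.eval_bagCost (o := o)
    have hfirst : (Prog.ite (.realLE (.load 3 (.var 11)) bagCost) (.setVar 24 (.load 8 (.var 11)))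
        (.setVar 24 (.load 8 (.var 11) + 1))).run o s₂ = s₂.setNat 24 0 w := by
      rw [Prog.run]
      simp only [BExp.holds_realLE, RExp.eval_load, NExp.eval_var, hx, hthr]
      rw [hbag]
      rcases hw with ⟨h1, rfl⟩ | ⟨h1, rfl⟩
      · rw [if_pos h1]; simp [Prog.run, Prog.setVar, hx]
      · rw [if_neg h1.not_ge]; simp [Prog.run, Prog.setVar, hx]
    rw [compete, Prog.run, hfirst]
    by_cases h19 : s.nat 19 0 ≤ max (s.nat 26 0) (min w E)
    · simp [Prog.run, Prog.setVar, hx, hE, e26, e19, h19]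
      simp only [funext_iff, Mem.nat_setNat]
      simp
    · simp [Prog.run, Prog.setVar, hE, e26, e19, e20, h19]
      simp only [funext_iff, Mem.nat_setNat]
      simp
      omega
  obtain ⟨w, hw⟩ : ∃ w, ((thr ≤ top + s₂.real 4 x ∧ w = s₂.nat 8 x) ∨
      (top + s₂.real 4 x < thr ∧ w = s₂.nat 8 x + 1)) := by
    rcases le_or_gt thr (top + s₂.real 4 x) with h1 | h1
    · exact ⟨_, Or.inl ⟨h1, rfl⟩⟩
    · exact ⟨_, Or.inr ⟨h1, rfl⟩⟩
  obtain ⟨g1, g2, g3, g4⟩ := hfin w hw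
  rw [g1, g2, g3]
  refine ⟨by omega, ?_, h7₂, hp₂, _, cross w hw, g4⟩
  have := hso₁.trans hso₂
  intro y hy
  rw [g1, g2, g3]
  exact this y hy

end RealRAM.Chores


/-! ### The competition between the remaining agents. -/

namespace RealRAM.Chores

/-- Run a program for every remaining agent. -/
def forActive (p : Prog) : Prog :=
  .setVar 11 0 ;;
  .while (.natLT (.var 11) agents)
    (.ite (.natLE (.load 6 (.var 11)) 0) p .skip ;; .setVar 11 (.var 11 + 1))

/-- Let all remaining agents compete for the current bag. -/
def scanAgents : Prog := forActive scanAgent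

/-- Lower the end of the window of agent `11` below the new number of small items. -/
def dropWindow : Prog :=
  .while (.natLT (.var 14) (.load 8 (.var 11) + .var 22)) lowerEnd

/-- Adapt the cost of the window of agent `11` to the removal of the current bag. -/
def shiftCost : Prog :=
  .setVar 12 0 ;;
  .while (.natLT (.var 12) (.var 22))
    (.setReal 4 (.var 11) (.load 4 (.var 11) +
        (smallCost (.sup (.load 8 (.var 11)) (.var 21) + .var 12) -
          smallCost (.sup (.load 7 (.var 11)) (.var 21) + .var 12))) ;;
     .setVar 12 (.var 12 + 1))

/-- Adapt the windows of all remaining agents to the removal of the current bag. -/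
def updateAgents : Prog := forActive (dropWindow ;; shiftCost)

/-- The data that are common to the windows of all agents in one round. -/
structure RoundData (s : Mem) (n m lw up st E j : ℕ) (c : ℕ → ℕ → ℝ) (R : ℕ → ℕ)
    (thr : ℕ → ℝ) : Prop where
  agents_eq : s.nat 0 0 = n
  items_eq : s.nat 0 1 = m
  lw_eq : s.nat 16 0 = lw
  up_eq : s.nat 17 0 = up
  st_eq : s.nat 18 0 = st
  E_eq : s.nat 14 0 = E
  j_eq : s.nat 15 0 = j
  cost_eq : ∀ x r, s.real 1 (x * m + r) = c x r
  small_eq : ∀ i, s.nat 4 i = R i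
  thr_eq : ∀ x, s.real 3 x = thr x

variable {o : ℕ → ℕ → ℝ} {s : Mem} {k n m x lw up st E j : ℕ} {c : ℕ → ℕ → ℝ} {R : ℕ → ℕ}
  {thr : ℕ → ℝ}

/-- The counter is an explicit argument of `Inv`; `hInv` makes the invariant insensitive to the
variable `11` in which the program keeps it. -/
theorem runs_forActive {p : Prog} {Q : ℕ → Mem → Prop} (hn : s.nat 0 0 = n)
    (hp : ∀ a ∈ [0, 6, 11], a ∉ p.natWrites) (Inv : ℕ → ℕ → Mem → Prop)
    (hInv : ∀ x k s y, Inv x k s → Inv x k (s.setNat 11 0 y)) (hk : 10 ≤ k)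
    (h0 : Inv 0 (k - 10) s)
    (hstep : ∀ x < n, ∀ k' s', (forActive p).Frame s s' → s'.nat 11 0 = x → Inv x k' s' → 40 ≤ k' ∧
      (s.nat 6 x = 0 → p.Runs o s' (k' - 40) fun k'' s'' => 10 ≤ k'' ∧ Inv (x + 1) (k'' - 10) s'') ∧
      (s.nat 6 x ≠ 0 → Inv (x + 1) (k' - 40) s'))
    (hQ : ∀ k' s', Inv n k' s' → 10 ≤ k' ∧ Q (k' - 10) s') : (forActive p).Runs o s k Q := by
  have hw : ∀ a ∈ [0, 6], a ∉ (forActive p).natWrites := by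
    intro a ha
    have h1 := hp a (by simp at ha ⊢; omega)
    simp at ha
    simp [forActive, Prog.natWrites, Prog.setVar, h1]
    omega
  have hfr : ∀ s', (Prog.setVar 11 0).Frame s s' → (forActive p).Frame s s' := fun s' h =>
    ⟨fun a ha => h.nat a fun h' => ha (by
        simp [Prog.setVar, Prog.natWrites] at h'; simp [forActive, Prog.setVar, Prog.natWrites, h']),
      fun a ha => h.real a (by simp [Prog.setVar, Prog.realWrites])⟩
  refine .seq (.mono (.straight 10 (Q := fun k' s' => k' = k - 10 ∧ s' = s.setNat 11 0 0) rfl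
    (by decide) hk ⟨rfl, rfl⟩) ?_)
  rintro k₀ s₀ hf₀ ⟨rfl, rfl⟩
  refine .loop 10 (fun k' s' => s'.nat 11 0 ≤ n ∧ Inv (s'.nat 11 0) k' s') (by decide)
    ⟨by simp, by simpa using hInv _ _ _ _ h0⟩ ?_
  rintro k' s' hf ⟨hle, hi⟩
  have hf' : (forActive p).Frame s s' := by
    refine .trans (hfr _ hf₀) ⟨fun a ha => hf.nat a fun h => ha ?_, fun a ha => hf.real a fun h => ha ?_⟩
    · simp only [forActive, Prog.natWrites] at h ⊢; exact List.mem_append_right _ h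
    · simp only [forActive, Prog.realWrites] at h ⊢; exact List.mem_append_right _ h
  have e0 : s'.nat 0 0 = n := by rw [hf'.nat 0 (hw 0 (by decide)), hn]
  have e6 := hf'.nat 6 (hw 6 (by decide))
  rcases hle.lt_or_eq with hlt | heq
  · obtain ⟨g1, g2, g3⟩ := hstep _ hlt k' s' hf' rfl hi
    refine ⟨by omega, fun _ => ?_, fun hc => absurd hlt (by simpa [agents, e0] using hc)⟩
    have hcost : (BExp.natLE (.load 6 (.var 11)) 0).cost + 1 ≤ 10 := by decide
    refine .seq (.ite (by omega) (fun hb => ?_) (fun hb => ?_))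
    · simp [e6] at hb
      obtain ⟨t, s₁, k₁, he, ht, hk₁, hi₁⟩ := g2 hb
      have e11 : s₁.nat 11 0 = s'.nat 11 0 := by rw [he.frame.nat 11 (hp 11 (by decide))]
      refine ⟨t, s₁, k₁, he, by omega, .straight 10 rfl (by decide) (by omega) ?_⟩
      simp only [Prog.run, Prog.setVar, NExp.eval_add, NExp.eval_var, NExp.eval_const, e11]
      refine ⟨by simp; omega, ?_⟩
      have := hInv _ _ _ (s'.nat 11 0 + 1) hi₁
      simpa using this
    · simp [e6] at hb
      refine ⟨1, s', k' - 30, .skip s', by omega, .straight 10 rfl (by decide) (by omega) ?_⟩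
      simp only [Prog.run, Prog.setVar, NExp.eval_add, NExp.eval_var]
      have := hInv _ _ _ (s'.nat 11 0 + 1) (g3 (by omega))
      rw [Nat.sub_sub]
      exact ⟨by simp; omega, by simpa using this⟩
  · obtain ⟨g1, g2⟩ := hQ k' s' (heq ▸ hi)
    exact ⟨g1, fun hc => absurd heq (by simp [agents, e0] at hc; omega), fun _ => g2⟩

theorem RoundData.of_frame {s s' : Mem} {p : Prog} (h : RoundData s n m lw up st E j c R thr)
    (hf : p.Frame s s') (hn : ∀ a ∈ [0, 4, 14, 15, 16, 17, 18], a ∉ p.natWrites)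
    (hr : ∀ a ∈ [1, 3], a ∉ p.realWrites) : RoundData s' n m lw up st E j c R thr := by
  have h0 := hf.nat 0 (hn 0 (by decide))
  have h4 := hf.nat 4 (hn 4 (by decide))
  have h14 := hf.nat 14 (hn 14 (by decide))
  have h15 := hf.nat 15 (hn 15 (by decide))
  have h16 := hf.nat 16 (hn 16 (by decide))
  have h17 := hf.nat 17 (hn 17 (by decide))
  have h18 := hf.nat 18 (hn 18 (by decide))
  have r1 := hf.real 1 (hr 1 (by decide))
  have r3 := hf.real 3 (hr 3 (by decide))
  exact ⟨by rw [h0, h.agents_eq], by rw [h0, h.items_eq], by rw [h16, h.lw_eq],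
    by rw [h17, h.up_eq], by rw [h18, h.st_eq], by rw [h14, h.E_eq], by rw [h15, h.j_eq],
    fun x r => by rw [r1, h.cost_eq], fun i => by rw [h4, h.small_eq], fun x => by rw [r3, h.thr_eq]⟩

theorem RoundData.shows (h : RoundData s n m lw up st E j c R thr) (hx : s.nat 11 0 = x) :
    Shows s n m x lw up st E j (fun i => c x (R i)) (c x (m - n + j)) (thr x) :=
  ⟨h.agents_eq, h.items_eq, hx, h.lw_eq, h.up_eq, h.st_eq, h.E_eq, h.j_eq,
    fun q _ => by rw [h.small_eq, h.cost_eq], h.cost_eq _ _, h.thr_eq x⟩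

/-- The windows of agent `x` are represented in the memory. -/
def HasPointer (s : Mem) (n m lw up st E j : ℕ) (c : ℕ → ℕ → ℝ) (R : ℕ → ℕ) (thr : ℕ → ℝ)
    (x : ℕ) : Prop :=
  s.nat 7 x ≤ E ∧ IsPointer lw up st E (fun i => c x (R i)) (c x (m - n + j)) (thr x)
    (s.nat 7 x) (s.nat 8 x) (s.real 4 x)

/-- The total distance that the windows of the agents can still be lowered. -/
def potential (s : Mem) (n : ℕ) : ℕ := ∑ x ∈ Finset.range n, (s.nat 7 x + s.nat 8 x)

theorem SameOthers.potential_add {s s' : Mem} (h : SameOthers x s s') (hx : x < n) :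
    potential s' n + (s.nat 7 x + s.nat 8 x) = potential s n + (s'.nat 7 x + s'.nat 8 x) := by
  unfold potential
  rw [← Finset.sum_erase_add _ _ (Finset.mem_range.2 hx),
    ← Finset.sum_erase_add (Finset.range n) (fun x => s.nat 7 x + s.nat 8 x)
      (Finset.mem_range.2 hx)]
  have : ∑ y ∈ (Finset.range n).erase x, (s'.nat 7 y + s'.nat 8 y) =
      ∑ y ∈ (Finset.range n).erase x, (s.nat 7 y + s.nat 8 y) :=
    Finset.sum_congr rfl fun y hy => by
      rw [(h y (Finset.ne_of_mem_erase hy)).1, (h y (Finset.ne_of_mem_erase hy)).2.1]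
  omega

theorem potential_congr {s s' : Mem} (h7 : s'.nat 7 = s.nat 7) (h8 : s'.nat 8 = s.nat 8) :
    potential s' n = potential s n := by
  unfold potential; rw [h7, h8]

theorem SameOthers.hasPointer {s s' : Mem} (h : SameOthers x s s') {y : ℕ} (hy : y ≠ x)
    (hp : HasPointer s n m lw up st E j c R thr y) : HasPointer s' n m lw up st E j c R thr y := by
  unfold HasPointer at *
  rw [(h y hy).1, (h y hy).2.1, (h y hy).2.2]; exact hp

/-- The maximum of the crossings is the end of the bag: there every remaining agent has reached her
threshold or the list is exhausted, while its owner was not above hers one step earlier, unless it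
is the first window. -/
theorem runs_scanAgents (hd : RoundData s n m lw up st E j c R thr) (hlu : lw ≤ up)
    (h0 : ∀ x < n, ∀ i < E, 0 ≤ c x (R i))
    (hR : ∀ x < n, ∀ i i', i ≤ i' → i' < E → c x (R i) ≤ c x (R i'))
    (hp : ∀ x < n, s.nat 6 x = 0 → HasPointer s n m lw up st E j c R thr x)
    (hb : s.nat 26 0 ≤ E) (h19 : s.nat 19 0 = s.nat 26 0) (hact : ∃ x < n, s.nat 6 x = 0)
    (hk : 200 * potential s n + 300 * n + 50 ≤ k) :
    scanAgents.Runs o s k fun k' s' =>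
      k + 200 * potential s' n ≤ k' + 200 * potential s n + 300 * n + 50 ∧
      (∀ x < n, s.nat 6 x = 0 → HasPointer s' n m lw up st E j c R thr x ∧
        s'.nat 7 x = windowStart lw up st (s'.nat 8 x)) ∧
      (s'.nat 20 0 < n ∧ s.nat 6 (s'.nat 20 0) = 0 ∧ IsCrossing lw up st E (s.nat 26 0)
        (fun i => c (s'.nat 20 0) (R i)) (c (s'.nat 20 0) (m - n + j)) (thr (s'.nat 20 0))
          (s'.nat 19 0)) ∧
      ∀ x < n, s.nat 6 x = 0 → ∃ q ≤ s'.nat 19 0, IsCrossing lw up st E (s.nat 26 0)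
        (fun i => c x (R i)) (c x (m - n + j)) (thr x) q := by
  refine runs_forActive hd.agents_eq (by decide) (fun x k' s' =>
      k + 200 * potential s' n ≤ k' + 200 * potential s n + 300 * x + 10 ∧
      (∀ x < n, s.nat 6 x = 0 → HasPointer s' n m lw up st E j c R thr x) ∧
      (∀ y < x, s.nat 6 y = 0 → s'.nat 7 y = windowStart lw up st (s'.nat 8 y)) ∧
      s.nat 26 0 ≤ s'.nat 19 0 ∧
      -- The initial maximum belongs to no agent. It is a lower bound for all crossings and ties
      -- replace the record, so the first active agent takes over.
      ((s'.nat 19 0 = s.nat 26 0 ∧ ∀ y < x, s.nat 6 y ≠ 0) ∨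
        (s'.nat 20 0 < n ∧ s.nat 6 (s'.nat 20 0) = 0 ∧ IsCrossing lw up st E (s.nat 26 0)
          (fun i => c (s'.nat 20 0) (R i)) (c (s'.nat 20 0) (m - n + j)) (thr (s'.nat 20 0))
            (s'.nat 19 0))) ∧
      ∀ y < x, s.nat 6 y = 0 → ∃ q ≤ s'.nat 19 0, IsCrossing lw up st E (s.nat 26 0)
        (fun i => c y (R i)) (c y (m - n + j)) (thr y) q) (fun x k s y h => h) (by omega) ?_ ?_ ?_
  · exact ⟨by omega, hp, by simp, h19.ge, Or.inl ⟨h19, by simp⟩, by simp⟩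
  · rintro x hx k' s' hf h11 ⟨hk', hp', hst, hge, hrec, hcr⟩
    have hd' := hd.of_frame hf (by decide) (by decide)
    have h26 : s'.nat 26 0 = s.nat 26 0 := by rw [hf.nat 26 (by decide)]
    refine ⟨by omega, fun hact => ?_, fun hact => ⟨by omega, hp', fun y hy hy' => ?_, hge, ?_,
      fun y hy hy' => ?_⟩⟩
    · have hpot0 : s'.nat 7 x + s'.nat 8 x ≤ potential s' n :=
        Finset.single_le_sum (f := fun x => s'.nat 7 x + s'.nat 8 x) (fun _ _ => Nat.zero_le _)
          (Finset.mem_range.2 hx)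
      refine (runs_scanAgent (hd'.shows h11) hlu (h0 _ hx) (hR _ hx) (hp' _ hx hact).2
        (hp' _ hx hact).1 (by omega) (by omega)).mono ?_
      rintro k₁ s₁ hf₁ ⟨hk₁, hso, h7, hp₁, q, hq, hq'⟩
      have hpot := hso.potential_add hx
      have hpt : HasPointer s₁ n m lw up st E j c R thr x := by
        refine ⟨?_, hp₁⟩
        rw [h7]
        exact windowStart_le.trans hp₁.end_le
      rw [h26] at hq
      have h7x : s₁.nat 7 x + s₁.nat 8 x ≤ potential s₁ n :=
        Finset.single_le_sum (f := fun x => s₁.nat 7 x + s₁.nat 8 x) (fun _ _ => Nat.zero_le _)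
          (Finset.mem_range.2 hx)
      have hqge := hq.ge
      refine ⟨by omega, by omega, fun y hy hy' => ?_, fun y hy hy' => ?_, by omega, Or.inr ?_,
        fun y hy hy' => ?_⟩
      · rcases eq_or_ne y x with rfl | hne
        · exact hpt
        · exact hso.hasPointer hne (hp' y hy hy')
      · rcases eq_or_ne y x with rfl | hne
        · exact h7
        · rw [(hso y hne).1, (hso y hne).2.1]; exact hst y (by omega) hy'
      · rcases hq' with ⟨h1, h2, h3⟩ | ⟨h1, h2, h3⟩
        · rw [h2, h3]; exact ⟨hx, hact, hq⟩
        · rw [h2, h3]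
          rcases hrec with h | h
          · omega
          · exact h
      · rcases eq_or_ne y x with rfl | hne
        · exact ⟨q, by omega, hq⟩
        · obtain ⟨q', h1, h2⟩ := hcr y (by omega) hy'
          exact ⟨q', by omega, h2⟩
    · exact hst y (by rcases eq_or_ne y x with rfl | h <;> [exact absurd hy' hact; omega]) hy'
    · rcases hrec with ⟨h1, h2⟩ | h
      · refine Or.inl ⟨h1, fun y hy => ?_⟩
        rcases eq_or_ne y x with rfl | hne
        · exact hact
        · exact h2 y (by omega)
      · exact Or.inr h
    · exact hcr y (by rcases eq_or_ne y x with rfl | h <;> [exact absurd hy' hact; omega]) hy'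
  · rintro k' s' ⟨hk', hp', hst, hge, hrec, hcr⟩
    refine ⟨by omega, by omega, fun x hx hx' => ⟨hp' x hx hx', hst x hx hx'⟩, ?_, hcr⟩
    rcases hrec with h | h
    · obtain ⟨x, hx, hx'⟩ := hact
      exact absurd hx' (h.2 x hx)
    · exact h

end RealRAM.Chores


/-- For a fixed end the window, the large item and hence the bag become no cheaper, so ends that had
reached the threshold still do. This is why pointers never have to move up. -/
theorem IsPointer.removeWindow {lw up o o' E d a : ℕ} {β : ℕ → ℝ} {top top' thr : ℝ} {A e : ℕ}
    {S S' : ℝ} (h : IsPointer lw up o E β top thr A e S) (ho : o' ≤ o) (htop : top ≤ top')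
    (h0 : ∀ i < E, 0 ≤ β i) (hβ : ∀ i j, i ≤ j → j < E → β i ≤ β j) (hd : d ≤ E)
    (hS : S' = prefixSum (removeWindow a d β) (min e (E - d)) -
      prefixSum (removeWindow a d β) A) :
    IsPointer lw up o' (E - d) (removeWindow a d β) top' thr A (min e (E - d)) S' where
  end_le := min_le_right _ _
  start_le := (windowStart_mono ho (min_le_left _ _)).trans h.start_le
  cost := hS
  later b hb hb' := by
    have h1 := h.later b (by omega) (by omega)
    have h2 := windowCost_le_removeWindow (lw := lw) (up := up) (a := a) (d := d) (b := b) ho h0 hβ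
      (by omega)
    linarith

theorem IsPointer.congr {lw up o E : ℕ} {β β' : ℕ → ℝ} {top thr : ℝ} {A e : ℕ}
    {S : ℝ} (h : IsPointer lw up o E β top thr A e S) (hβ : ∀ i < E, β' i = β i) (hA : A ≤ E) :
    IsPointer lw up o E β' top thr A e S := by
  have hP : ∀ q ≤ E, prefixSum β' q = prefixSum β q := fun q hq =>
    Finset.sum_congr rfl fun i hi => hβ i (by simp at hi; omega)
  refine ⟨h.end_le, h.start_le, ?_, fun b hb hb' => ?_⟩
  · rw [hP _ h.end_le, hP _ hA, h.cost]
  · unfold windowCost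
    rw [hP _ hb', hP _ (windowStart_le.trans hb')]
    exact h.later b hb hb'

/-! ### Adapting the pointers to the removal of a bag. -/

namespace RealRAM.Chores

variable {o : ℕ → ℕ → ℝ} {s : Mem} {k n m x lw up st E j d a : ℕ} {β : ℕ → ℝ} {top thr : ℝ}

theorem runs_dropWindow (h : Shows s n m x lw up st E j β top thr) (hd : s.nat 22 0 = d)
    (hdE : d ≤ E) (hE : s.nat 8 x ≤ E) (hk : 200 * s.nat 8 x + 50 ≤ k) :
    dropWindow.Runs o s k fun k' s' => k + 200 * s'.nat 8 x ≤ k' + 200 * s.nat 8 x + 50 ∧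
      SameOthers x s s' ∧ s'.nat 7 x = s.nat 7 x ∧ s'.nat 8 x = min (s.nat 8 x) (E - d) ∧
      s'.real 4 x + prefixSum β (s.nat 8 x) = s.real 4 x + prefixSum β (s'.nat 8 x) := by
  refine .loop 50 (fun k' s' => k + 200 * s'.nat 8 x ≤ k' + 200 * s.nat 8 x ∧
      SameOthers x s s' ∧ s'.nat 7 x = s.nat 7 x ∧ min (s.nat 8 x) (E - d) ≤ s'.nat 8 x ∧
      s'.nat 8 x ≤ s.nat 8 x ∧
      s'.real 4 x + prefixSum β (s.nat 8 x) = s.real 4 x + prefixSum β (s'.nat 8 x)) (by decide)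
    ⟨le_rfl, fun _ _ => ⟨rfl, rfl, rfl⟩, rfl, min_le_left _ _, le_rfl, rfl⟩ ?_
  rintro k' s' hf ⟨hk', hso, h7, h8, h8', hS⟩
  have h' := h.of_frame hf (by decide) (by decide)
  have hd' : s'.nat 22 0 = d := by rw [hf.nat 22 (by decide), hd]
  refine ⟨by omega, fun hb => ?_, fun hb => ?_⟩
  · simp [h'.agent_eq, h'.E_eq, hd'] at hb
    obtain ⟨e, he⟩ : ∃ e, s'.nat 8 x = e + 1 := ⟨s'.nat 8 x - 1, by omega⟩
    obtain ⟨e1, e2, e3, e4⟩ := h'.run_lowerEnd (o := o) he (by omega)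
    refine .straight 50 (by decide) (by decide) (by omega) ?_
    rw [e1, e2, e3]
    refine ⟨by omega, hso.trans e4, h7, by omega, by omega, ?_⟩
    rw [he, prefixSum_succ] at hS
    linarith
  · simp [h'.agent_eq, h'.E_eq, hd'] at hb
    exact ⟨by omega, hso, h7, by omega, hS⟩

/-- When `prefixSum_removeWindow` is applied at both ends of the agent's window, the terms for the
removed items cancel. What remains is a sum of `d` differences, however long the window is. -/
theorem runs_shiftCost (h : Shows s n m x lw up st E j β top thr) (hd : s.nat 22 0 = d)
    (ha : s.nat 21 0 = a) (h8 : max (s.nat 8 x) a + d ≤ E) (h7 : max (s.nat 7 x) a + d ≤ E)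
    (hk : 100 * d + 50 ≤ k) :
    shiftCost.Runs o s k fun k' s' => k ≤ k' + 100 * d + 50 ∧ SameOthers x s s' ∧
      s'.nat 7 x = s.nat 7 x ∧ s'.nat 8 x = s.nat 8 x ∧
      s'.real 4 x = s.real 4 x + ∑ t ∈ Finset.range d,
        (β (max (s.nat 8 x) a + t) - β (max (s.nat 7 x) a + t)) := by
  refine .seq (.mono (.straight 10 (Q := fun k' s' => k' = k - 10 ∧ s' = s.setNat 12 0 0) rfl
    (by decide) (by omega) ⟨rfl, rfl⟩) ?_)
  rintro k₀ s₀ hf₀ ⟨rfl, rfl⟩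
  have h₀ := h.of_frame hf₀ (by decide) (by decide)
  refine .loop 10 (fun k' s' => s'.nat 12 0 ≤ d ∧ k ≤ k' + 100 * s'.nat 12 0 + 20 ∧
      (∀ y, y ≠ x → s'.real 4 y = s.real 4 y) ∧
      s'.real 4 x = s.real 4 x + ∑ t ∈ Finset.range (s'.nat 12 0),
        (β (max (s.nat 8 x) a + t) - β (max (s.nat 7 x) a + t))) (by decide) ?_ ?_
  · simp; omega
  rintro k' s' hf ⟨hle, hk', hoth, hS⟩
  have h' := h₀.of_frame hf (by decide) (by decide)
  have e22 : s'.nat 22 0 = d := by rw [hf.nat 22 (by decide)]; simpa using hd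
  have e21 : s'.nat 21 0 = a := by rw [hf.nat 21 (by decide)]; simpa using ha
  have e7 : ∀ y, s'.nat 7 y = s.nat 7 y := fun y => by rw [hf.nat 7 (by decide)]; simp
  have e8 : ∀ y, s'.nat 8 y = s.nat 8 y := fun y => by rw [hf.nat 8 (by decide)]; simp
  refine ⟨by omega, fun hb => ?_, fun hb => ?_⟩
  · simp [e22] at hb
    have r8 := h'.small (max (s.nat 8 x) a + s'.nat 12 0) (by omega)
    have r7 := h'.small (max (s.nat 7 x) a + s'.nat 12 0) (by omega)
    refine .straight 80 (by decide) (by decide) (by omega) ?_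
    simp [Prog.run, Prog.setVar, smallCost, items, h'.items_eq, h'.agent_eq, e7, e8, e21, r8, r7]
    refine ⟨by omega, by omega, fun y hy => by rw [if_neg hy]; exact hoth y hy, ?_⟩
    rw [hS]
    simp only [Finset.sum_sub_distrib, Finset.sum_range_succ]
    ring
  · simp [e22] at hb
    have : s'.nat 12 0 = d := by omega
    rw [this] at hS
    exact ⟨by omega, fun y hy => ⟨e7 y, e8 y, hoth y hy⟩, e7 x, e8 x, hS⟩

theorem runs_updateAgents {c : ℕ → ℕ → ℝ} {R : ℕ → ℕ} {thr : ℕ → ℝ} {p o' j' : ℕ}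
    (h : RoundData s n m lw up st E j c R thr) (hlu : lw ≤ up)
    (h0 : ∀ x < n, ∀ i < E, 0 ≤ c x (R i))
    (hR : ∀ x < n, ∀ i i', i ≤ i' → i' < E → c x (R i) ≤ c x (R i'))
    (hp : ∀ x < n, s.nat 6 x = 0 → HasPointer s n m lw up st E j c R thr x ∧
      s.nat 7 x = windowStart lw up st (s.nat 8 x))
    (hpE : p ≤ E) (ha : s.nat 21 0 = a) (hap : a = windowStart lw up st p)
    (hd : s.nat 22 0 = d) (hdp : d = p - a) (ho : o' ≤ st)
    (htop : ∀ x < n, c x (m - n + j) ≤ c x (m - n + j'))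
    (hk : 200 * potential s n + n * (100 * d + 200) + 50 ≤ k) :
    updateAgents.Runs o s k fun k' s' =>
      k + 200 * potential s' n ≤ k' + 200 * potential s n + n * (100 * d + 200) + 50 ∧
      ∀ x < n, s.nat 6 x = 0 → HasPointer s' n m lw up o' (E - d) j' c (removeWindow a d R)
        thr x := by
  have hapE : a ≤ p := hap ▸ windowStart_le
  refine runs_forActive h.agents_eq (by decide) (fun x k' s' =>
      k + 200 * potential s' n ≤ k' + 200 * potential s n + x * (100 * d + 200) + 10 ∧
      (∀ y, x ≤ y → s'.nat 7 y = s.nat 7 y ∧ s'.nat 8 y = s.nat 8 y ∧ s'.real 4 y = s.real 4 y) ∧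
      (∀ y < x, s.nat 6 y = 0 → HasPointer s' n m lw up o' (E - d) j' c (removeWindow a d R)
        thr y)) (fun x k s y h => h) (by omega) ?_ ?_ ?_
  · exact ⟨by omega, by simp, by simp⟩
  · rintro x hx k' s' hf h11 ⟨hk', hge, hlt⟩
    have h' := h.of_frame hf (by decide) (by decide)
    have e21 : s'.nat 21 0 = a := by rw [hf.nat 21 (by decide), ha]
    have e22 : s'.nat 22 0 = d := by rw [hf.nat 22 (by decide), hd]
    obtain ⟨e7, e8, e4⟩ := hge x le_rfl
    obtain ⟨r, hr⟩ : ∃ r, n = x + 1 + r := ⟨n - (x + 1), by omega⟩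
    have hex1 : n * (100 * d + 200) = x * (100 * d + 200) + (100 * d + 200) + r * (100 * d + 200) := by
      rw [hr]; ring
    have hex2 : (x + 1) * (100 * d + 200) = x * (100 * d + 200) + (100 * d + 200) := by ring
    have hpot0 : s'.nat 7 x + s'.nat 8 x ≤ potential s' n :=
      Finset.single_le_sum (f := fun x => s'.nat 7 x + s'.nat 8 x) (fun _ _ => Nat.zero_le _)
        (Finset.mem_range.2 hx)
    refine ⟨by omega, fun hact => ?_, fun hact => ⟨by omega, fun y hy => hge y (by omega),
      fun y hy hy' => hlt y ?_ hy'⟩⟩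
    · obtain ⟨⟨hAE, hptr⟩, hA⟩ := hp x hx hact
      have hend := hptr.end_le
      -- Windows get longer along the path, so the one ending at `E` has at least `d` items. Hence
      -- every start is at most `E - d`, and the positions read by `shiftCost` lie in the list.
      have hw1 := windowStart_diff_mono (lw := lw) (up := up) (o := st) hlu hpE
      have hw2 := windowStart_mono (lw := lw) (up := up) (le_refl st) hend
      have hw3 := windowStart_le (lw := lw) (up := up) (o := st) (b := E)
      refine .seq ((runs_dropWindow (h'.shows h11) e22 (by omega) (by omega) (by omega)).mono ?_)
      rintro k₁ s₁ hf₁ ⟨hk₁, hso₁, h7₁, h8₁, hS₁⟩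
      have h₁ := (h'.shows h11).of_frame hf₁ (by decide) (by decide)
      refine (runs_shiftCost h₁ (d := d) (a := a) ?_ ?_ ?_ ?_ ?_).mono ?_
      · rw [hf₁.nat 22 (by decide), e22]
      · rw [hf₁.nat 21 (by decide), e21]
      · omega
      · omega
      · omega
      rintro k₂ s₂ hf₂ ⟨hk₂, hso₂, h7₂, h8₂, hS₂⟩
      have hso := hso₁.trans hso₂
      have hpot := hso.potential_add hx
      have hpot1 : s₂.nat 7 x + s₂.nat 8 x ≤ potential s₂ n :=
        Finset.single_le_sum (f := fun x => s₂.nat 7 x + s₂.nat 8 x) (fun _ _ => Nat.zero_le _)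
          (Finset.mem_range.2 hx)
      have hpt : HasPointer s₂ n m lw up o' (E - d) j' c (removeWindow a d R) thr x := by
        have hcomp : (fun i => c x (removeWindow a d R i)) =
            removeWindow a d fun i => c x (R i) := by
          funext i; unfold removeWindow; split <;> rfl
        refine ⟨by omega, ?_⟩
        rw [hcomp, show s₂.nat 7 x = s.nat 7 x by omega,
          show s₂.nat 8 x = min (s.nat 8 x) (E - d) by omega]
        refine hptr.removeWindow ho (htop x hx) (h0 x hx) (hR x hx) (by omega) ?_
        rw [prefixSum_removeWindow, prefixSum_removeWindow, hS₂, Finset.sum_sub_distrib,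
          Finset.sum_sub_distrib, Finset.sum_sub_distrib]
        have := hptr.cost
        rw [e8, e4] at hS₁
        rw [h8₁, h7₁, e7, e8]
        rw [h8₁, e8] at hS₁
        linarith
      refine ⟨by omega, by omega, fun y hy => ?_, fun y hy hy' => ?_⟩
      · obtain ⟨f1, f2, f3⟩ := hso y (by omega)
        rw [f1, f2, f3]; exact hge y (by omega)
      · rcases eq_or_ne y x with rfl | hne
        · exact hpt
        · exact hso.hasPointer hne (hlt y (by omega) hy')
    · rcases eq_or_ne y x with rfl | hne
      · exact absurd hy' hact
      · omega
  · rintro k' s' ⟨hk', hge, hlt⟩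
    exact ⟨by omega, by omega, hlt⟩

end RealRAM.Chores


/-! ### The program for the bags. -/

namespace RealRAM.Chores

/-- Determine the path of the windows for the current bag. -/
def startRound : Prog :=
  .setVar 18 (((agents - .var 15 - 1) * .var 17 + .var 16 - .var 14 + (.var 17 - .var 16) - 1) /
    (.var 17 - .var 16) * .var 16) ;;
  .setVar 26 (.sup (.var 16) (.var 14 - (agents - .var 15 - 1) * .var 17)) ;;
  .setVar 19 (.var 26)

/-- Determine the window of the current bag. -/
def chooseWindow : Prog := .setVar 21 (startExp (.var 19)) ;; .setVar 22 (.var 19 - .var 21)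

/-- Give the current bag to agent `20`. -/
def recordBag : Prog :=
  .setVar 12 (.var 21) ;;
  .while (.natLT (.var 12) (.var 19))
    (.setNat 5 (.load 4 (.var 12)) (.var 20) ;; .setVar 12 (.var 12 + 1)) ;;
  .setNat 5 (items - agents + .var 15) (.var 20) ;;
  .setNat 6 (.var 20) 1

/-- Remove the small items of the current bag. -/
def compact : Prog :=
  .setVar 12 (.var 21) ;;
  .while (.natLT (.var 12 + .var 22) (.var 14))
    (.setNat 4 (.var 12) (.load 4 (.var 12 + .var 22)) ;; .setVar 12 (.var 12 + 1)) ;;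
  .setVar 14 (.var 14 - .var 22) ;;
  .setVar 15 (.var 15 + 1)

/-- Fill one bag and give it to an agent. -/
def fillBag : Prog :=
  startRound ;; scanAgents ;; chooseWindow ;; recordBag ;; updateAgents ;; compact

/-- Prepare the list of small items and the windows. -/
def initBags : Prog :=
  .setVar 14 (items - agents) ;;
  .setVar 15 0 ;;
  .setVar 12 0 ;;
  .while (.natLT (.var 12) (.var 14))
    (.setNat 4 (.var 12) (.var 12) ;; .setVar 12 (.var 12 + 1)) ;;
  .setVar 11 0 ;;
  .while (.natLT (.var 11) agents)
    (.setNat 6 (.var 11) 0 ;; .setNat 7 (.var 11) (.var 14) ;; .setNat 8 (.var 11) (.var 14) ;;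
     .setReal 4 (.var 11) (.ofNat 0) ;; .setVar 11 (.var 11 + 1))

/-- Determine the owners of the ranks. -/
def fillBags : Prog := initBags ;; .while (.natLT (.var 15) agents) fillBag

variable {o : ℕ → ℕ → ℝ} {s : Mem} {k n m lw up st E j d a p i : ℕ}

theorem runs_recordBag (hn : s.nat 0 0 = n) (hm : s.nat 0 1 = m) (hj : s.nat 15 0 = j)
    (hp : s.nat 19 0 = p) (hi : s.nat 20 0 = i) (ha : s.nat 21 0 = a) (hap : a ≤ p)
    (hk : 50 * (p - a) + 100 ≤ k) :
    recordBag.Runs o s k fun k' s' => k ≤ k' + 50 * (p - a) + 100 ∧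
      s'.nat 5 (m - n + j) = i ∧ (∀ q, a ≤ q → q < p → s'.nat 5 (s.nat 4 q) = i) ∧
      (∀ r, r ≠ m - n + j → (∀ q, a ≤ q → q < p → s.nat 4 q ≠ r) → s'.nat 5 r = s.nat 5 r) ∧
      ∀ x, s'.nat 6 x = if x = i then 1 else s.nat 6 x := by
  refine .seq (.mono (.straight 10 (Q := fun k' s' => k' = k - 10 ∧ s' = s.setNat 12 0 a) rfl
    (by decide) (by omega) ⟨rfl, by simp [Prog.run, Prog.setVar, ha]⟩) ?_)
  rintro k₀ s₀ hf₀ ⟨rfl, rfl⟩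
  refine .seq (.loop 10 (fun k' s' => a ≤ s'.nat 12 0 ∧ s'.nat 12 0 ≤ p ∧
    k ≤ k' + 50 * (s'.nat 12 0 - a) + 10 ∧
    (∀ q, a ≤ q → q < s'.nat 12 0 → s'.nat 5 (s.nat 4 q) = i) ∧
    ∀ r, (∀ q, a ≤ q → q < p → s.nat 4 q ≠ r) → s'.nat 5 r = s.nat 5 r) (by decide) ?_ ?_)
  · simp
    exact ⟨hap, by omega, fun q hq hq' => by omega⟩
  rintro k' s' hf ⟨hge, hle, hk', h1, h2⟩
  have e4 : ∀ q, s'.nat 4 q = s.nat 4 q := fun q => by rw [hf.nat 4 (by decide)]; simp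
  have e6 : ∀ q, s'.nat 6 q = s.nat 6 q := fun q => by rw [hf.nat 6 (by decide)]; simp
  have e0 : ∀ q, s'.nat 0 q = s.nat 0 q := fun q => by rw [hf.nat 0 (by decide)]; simp
  have e15 : s'.nat 15 0 = j := by rw [hf.nat 15 (by decide)]; simpa using hj
  have e19 : s'.nat 19 0 = p := by rw [hf.nat 19 (by decide)]; simpa using hp
  have e20 : s'.nat 20 0 = i := by rw [hf.nat 20 (by decide)]; simpa using hi
  refine ⟨by omega, fun hb => ?_, fun hb => ?_⟩
  · simp [e19] at hb
    refine .straight 30 (by decide) (by decide) (by omega) ?_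
    simp [Prog.run, Prog.setVar, e4, e20]
    refine ⟨by omega, by omega, by omega, fun q hq hq' => ?_, fun r hr => ?_⟩
    · intro hne
      exact h1 q hq (lt_of_le_of_ne (by omega) fun h => hne (by rw [h]))
    · rw [if_neg fun h => hr _ hge hb h.symm]; exact h2 r hr
  · simp [e19] at hb
    have : s'.nat 12 0 = p := by omega
    rw [this] at h1 hk'
    refine .straight 30 (by decide) (by decide) (by omega) ?_
    simp [Prog.run, e20, e0, e15, e6, items, agents, hn, hm]
    refine ⟨by omega, fun q hq hq' => fun _ => h1 q hq hq', fun r hr hr' => ?_⟩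
    rw [if_neg hr]; exact h2 r hr'

theorem runs_compact (hE : s.nat 14 0 = E) (hj : s.nat 15 0 = j) (ha : s.nat 21 0 = a)
    (hd : s.nat 22 0 = d) (hadE : a + d ≤ E) (hk : 50 * E + 100 ≤ k) :
    compact.Runs o s k fun k' s' => k ≤ k' + 50 * E + 100 ∧ s'.nat 14 0 = E - d ∧
      s'.nat 15 0 = j + 1 ∧ ∀ q < E - d, s'.nat 4 q = removeWindow a d (s.nat 4) q := by
  refine .seq (.mono (.straight 10 (Q := fun k' s' => k' = k - 10 ∧ s' = s.setNat 12 0 a) rfl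
    (by decide) (by omega) ⟨rfl, by simp [Prog.run, Prog.setVar, ha]⟩) ?_)
  rintro k₀ s₀ hf₀ ⟨rfl, rfl⟩
  refine .seq (.loop 20 (fun k' s' => a ≤ s'.nat 12 0 ∧ s'.nat 12 0 ≤ E - d ∧
    k ≤ k' + 50 * s'.nat 12 0 + 10 ∧
    (∀ q < s'.nat 12 0, s'.nat 4 q = removeWindow a d (s.nat 4) q) ∧
    ∀ q, s'.nat 12 0 ≤ q → s'.nat 4 q = s.nat 4 q) (by decide) ?_ ?_)
  · simp
    refine ⟨by omega, by omega, fun q hq => by rw [removeWindow, if_pos hq]⟩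
  rintro k' s' hf ⟨hge, hle, hk', h1, h2⟩
  have e14 : s'.nat 14 0 = E := by rw [hf.nat 14 (by decide)]; simpa using hE
  have e15 : s'.nat 15 0 = j := by rw [hf.nat 15 (by decide)]; simpa using hj
  have e22 : s'.nat 22 0 = d := by rw [hf.nat 22 (by decide)]; simpa using hd
  refine ⟨by omega, fun hb => ?_, fun hb => ?_⟩
  · simp [e14, e22] at hb
    refine .straight 30 (by decide) (by decide) (by omega) ?_
    have e4 := h2 (s'.nat 12 0 + d) (by omega)
    simp [Prog.run, Prog.setVar, e22, e4]
    refine ⟨by omega, by omega, by omega, fun q hq => ?_, fun q hq => ?_⟩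
    · split
      · rename_i h; rw [h, removeWindow, if_neg (by omega)]
      · exact h1 q (by omega)
    · rw [if_neg (by omega)]; exact h2 q (by omega)
  · simp [e14, e22] at hb
    have : s'.nat 12 0 = E - d := by omega
    rw [this] at h1
    refine .straight 30 (by decide) (by decide) (by omega) ?_
    simp [Prog.run, Prog.setVar, e14, e22, e15]
    exact ⟨by omega, h1⟩

/-- The state of the memory after `j` bags. -/
structure BagMemory (s : Mem) (n m lw up : ℕ) (c : ℕ → ℕ → ℝ) (τ : ℕ → ℝ) (j E : ℕ) : Prop where
  data : RoundData s n m lw up (s.nat 18 0) E j c (s.nat 4) fun x => τ x - τ x / (2 * n)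
  state : ∃ B, BagState n m lw up c τ j E (s.nat 4) (s.nat 5) (s.nat 6) B
  pointer : j < n → ∀ x < n, s.nat 6 x = 0 → HasPointer s n m lw up (pivot lw up (n - j) E * lw) E
    j c (s.nat 4) (fun x => τ x - τ x / (2 * n)) x

variable {c : ℕ → ℕ → ℝ} {τ : ℕ → ℝ}

theorem runs_initBags (h : SortedCosts n m lw up c τ) (hn : s.nat 0 0 = n) (hm : s.nat 0 1 = m)
    (hlw : s.nat 16 0 = lw) (hup : s.nat 17 0 = up)
    (hc : ∀ x r, s.real 1 (x * m + r) = c x r) (ht : ∀ x, s.real 3 x = τ x - τ x / (2 * n))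
    (hk : 200 * m + 100 ≤ k) :
    initBags.Runs o s k fun k' s' => k ≤ k' + 200 * m + 100 ∧
      BagMemory s' n m lw up c τ 0 (m - n) ∧ potential s' n = 2 * (n * (m - n)) := by
  have hlt := h.lt
  refine .seq (.straight 10 rfl (by decide) (by omega) ?_)
  refine .seq (.straight 10 rfl (by decide) (by omega) ?_)
  refine .seq (.mono (.straight 10 (Q := fun k' s' => k' = k - 30 ∧
    s' = ((s.setNat 14 0 (m - n)).setNat 15 0 0).setNat 12 0 0) rfl
    (by decide) (by omega) ⟨by omega, by simp [Prog.run, Prog.setVar, hn, hm, items, agents]⟩) ?_)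
  rintro k₀ s₀ hf₀ ⟨rfl, hs₀⟩
  have a0 : ∀ q, s₀.nat 0 q = s.nat 0 q := by intro q; simp [hs₀]
  have a14 : s₀.nat 14 0 = m - n := by simp [hs₀]
  have a15 : s₀.nat 15 0 = 0 := by simp [hs₀]
  have a16 : s₀.nat 16 0 = lw := by simp [hs₀, hlw]
  have a17 : s₀.nat 17 0 = up := by simp [hs₀, hup]
  have ar : s₀.real = s.real := by simp [hs₀]
  refine .seq (.loop 10 (fun k' s' => s'.nat 12 0 ≤ m - n ∧ k ≤ k' + 50 * s'.nat 12 0 + 30 ∧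
    ∀ q < s'.nat 12 0, s'.nat 4 q = q) (by decide) ?_ ?_)
  · simp [hs₀]; omega
  rintro k₁ s₁ hf₁ ⟨hle, hk₁, h1⟩
  have b0 : ∀ q, s₁.nat 0 q = s.nat 0 q := fun q => by rw [hf₁.nat 0 (by decide), a0]
  have b14 : s₁.nat 14 0 = m - n := by rw [hf₁.nat 14 (by decide), a14]
  refine ⟨by omega, fun hb => ?_, fun hb => ?_⟩
  · simp [b14] at hb
    refine .straight 30 rfl (by decide) (by omega) ?_
    simp [Prog.run, Prog.setVar]
    refine ⟨by omega, by omega, fun q hq => ?_⟩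
    split
    · rename_i hq'; exact hq'.symm
    · exact h1 q (by omega)
  simp [b14] at hb
  have h12 : s₁.nat 12 0 = m - n := by omega
  rw [h12] at h1
  refine .seq (.mono (.straight 10 (Q := fun k' s' => k' = k₁ - 20 ∧
    s' = s₁.setNat 11 0 0) rfl
    (by decide) (by omega) ⟨by omega, by simp [Prog.run, Prog.setVar]⟩) ?_)
  rintro k₂ s₂ hf₂ ⟨rfl, hs₂⟩
  refine .loop 10 (fun k' s' => s'.nat 11 0 ≤ n ∧ k ≤ k' + 50 * m + 100 * s'.nat 11 0 + 50 ∧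
    ∀ x < s'.nat 11 0, s'.nat 6 x = 0 ∧ s'.nat 7 x = m - n ∧ s'.nat 8 x = m - n ∧ s'.real 4 x = 0)
    (by decide) ?_ ?_
  · simp [hs₂]; omega
  rintro k₃ s₃ hf₃ ⟨hle₃, hk₃, h3⟩
  have c0 : ∀ q, s₃.nat 0 q = s.nat 0 q := fun q => by
    rw [hf₃.nat 0 (by decide), hf₂.nat 0 (by decide), b0]
  have c14 : s₃.nat 14 0 = m - n := by rw [hf₃.nat 14 (by decide), hf₂.nat 14 (by decide), b14]
  refine ⟨by omega, fun hb => ?_, fun hb => ?_⟩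
  · simp [agents, c0, hn] at hb
    refine .straight 60 rfl (by decide) (by omega) ?_
    simp [Prog.run, Prog.setVar, c14]
    refine ⟨by omega, by omega, fun x hx => ?_⟩
    rcases eq_or_ne x (s₃.nat 11 0) with rfl | hne
    · simp
    · simp [hne]
      exact h3 x (by omega)
  · simp [agents, c0, hn] at hb
    have h11 : s₃.nat 11 0 = n := by omega
    rw [h11] at h3
    have hdata : RoundData s₃ n m lw up (s₃.nat 18 0) (m - n) 0 c (s₃.nat 4)
        fun x => τ x - τ x / (2 * n) := by
      refine ⟨by rw [c0, hn], by rw [c0, hm], ?_, ?_, rfl, c14, ?_, fun x r => ?_, fun _ => rfl,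
        fun x => ?_⟩
      · rw [hf₃.nat 16 (by decide), hf₂.nat 16 (by decide), hf₁.nat 16 (by decide), a16]
      · rw [hf₃.nat 17 (by decide), hf₂.nat 17 (by decide), hf₁.nat 17 (by decide), a17]
      · rw [hf₃.nat 15 (by decide), hf₂.nat 15 (by decide), hf₁.nat 15 (by decide), a15]
      · rw [hf₃.real 1 (by decide), hf₂.real 1 (by decide), hf₁.real 1 (by decide), ar, hc]
      · rw [hf₃.real 3 (by decide), hf₂.real 3 (by decide), hf₁.real 3 (by decide), ar, ht]
    have h4 : ∀ q < m - n, s₃.nat 4 q = q := fun q hq => by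
      rw [hf₃.nat 4 (by decide), hf₂.nat 4 (by decide), h1 q hq]
    refine ⟨by omega, ⟨hdata, ⟨_, h.bagState_zero (s₃.nat 5) (fun x hx => (h3 x hx).1) h4
      (fun _ => ∅)⟩, fun _ x hx hx' => ?_⟩, ?_⟩
    · obtain ⟨g1, g2, g3, g4⟩ := h3 x hx
      unfold HasPointer
      rw [g2, g3, g4]
      -- Every agent starts with the empty window at the end of the list, beyond which there is no
      -- later end to check.
      exact ⟨le_rfl, le_rfl, windowStart_le, by simp, fun b hb hb' => by omega⟩
    · unfold potential
      rw [Finset.sum_congr rfl fun x hx => by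
        rw [(h3 x (Finset.mem_range.1 hx)).2.1, (h3 x (Finset.mem_range.1 hx)).2.2.1]]
      simp; ring

end RealRAM.Chores


/-! ### A complete round and its time credits. -/

namespace RealRAM.Chores

variable {o : ℕ → ℕ → ℝ} {s : Mem} {k n m lw up E j : ℕ} {c : ℕ → ℕ → ℝ} {τ : ℕ → ℝ}

theorem runs_startRound {st : ℕ} {R : ℕ → ℕ} {thr : ℕ → ℝ}
    (h : RoundData s n m lw up st E j c R thr) (hk : 100 ≤ k) :
    startRound.Runs o s k fun k' s' => k ≤ k' + 100 ∧
      RoundData s' n m lw up (pivot lw up (n - j) E * lw) E j c R thr ∧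
      s'.nat 26 0 = firstEnd lw up (n - j) E ∧ s'.nat 19 0 = firstEnd lw up (n - j) E := by
  refine .straight 100 rfl (by decide) hk ?_
  have hs : startRound.run o s = ((s.setNat 18 0 (pivot lw up (n - j) E * lw)).setNat 26 0
      (firstEnd lw up (n - j) E)).setNat 19 0 (firstEnd lw up (n - j) E) := by
    simp [startRound, Prog.run, Prog.setVar, agents, h.agents_eq, h.lw_eq, h.up_eq, h.E_eq,
      h.j_eq, pivot, firstEnd]
  rw [hs]
  refine ⟨by omega, ⟨?_, ?_, ?_, ?_, ?_, ?_, ?_, ?_, ?_, ?_⟩, by simp, by simp⟩ <;>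
  simp [h.agents_eq, h.items_eq, h.lw_eq, h.up_eq, h.E_eq, h.j_eq, h.cost_eq, h.small_eq, h.thr_eq]

/-- Pointer moves are paid for by the potential. The removal of `d` small items releases `100 * (n *
d)` credits, which cover the cost updates of all agents; all other work is linear in `m`. -/
theorem runs_fillBag (h : SortedCosts n m lw up c τ) (hs : BagMemory s n m lw up c τ j E)
    (hj : j < n) (hE : E ≤ m)
    (hk : 200 * potential s n + 100 * (n * E) + 1000 * m ≤ k) :
    fillBag.Runs o s k fun k' s' => ∃ E' ≤ E, BagMemory s' n m lw up c τ (j + 1) E' ∧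
      k + 200 * potential s' n + 100 * (n * E') ≤
        k' + 200 * potential s n + 100 * (n * E) + 1000 * m := by
  obtain ⟨B, hst⟩ := hs.state
  have hlu := h.le
  have hlt := h.lt
  have hpos := h.agents_pos
  have hptr := hs.pointer hj
  have hfE : firstEnd lw up (n - j) E ≤ E := firstEnd_le (by omega) hst.low
  set st := pivot lw up (n - j) E * lw with hstdef
  set R := s.nat 4 with hR
  have h0 : ∀ x < n, ∀ i < E, 0 ≤ c x (R i) := fun x hx => hst.small_nonneg h hx
  have hmono : ∀ x < n, ∀ i i', i ≤ i' → i' < E → c x (R i) ≤ c x (R i') :=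
    fun x hx => hst.small_mono h hx
  refine .seq ((runs_startRound hs.data (by omega)).mono ?_)
  rintro k₁ s₁ hf₁ ⟨hk₁, hd₁, h26₁, h19₁⟩
  rw [← hstdef] at hd₁
  have hpot₁ : potential s₁ n = potential s n :=
    potential_congr (hf₁.nat 7 (by decide)) (hf₁.nat 8 (by decide))
  have e6₁ : s₁.nat 6 = s.nat 6 := hf₁.nat 6 (by decide)
  have e5₁ : s₁.nat 5 = s.nat 5 := hf₁.nat 5 (by decide)
  have hptr₁ : ∀ x < n, s₁.nat 6 x = 0 → HasPointer s₁ n m lw up st E j c R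
      (fun x => τ x - τ x / (2 * n)) x := by
    intro x hx hx'
    have := hptr x hx (by rw [← e6₁]; exact hx')
    unfold HasPointer at *
    rw [hf₁.nat 7 (by decide), hf₁.nat 8 (by decide), hf₁.real 4 (by decide)]
    exact this
  refine .seq ((runs_scanAgents hd₁ hlu h0 hmono hptr₁ (by omega) (by omega) ?_ (by omega)).mono ?_)
  · have hcard := hst.active
    obtain ⟨x, hx⟩ : ((Finset.range n).filter fun x => s.nat 6 x = 0).Nonempty :=
      Finset.card_pos.1 (by omega)
    simp at hx
    exact ⟨x, hx.1, by rw [e6₁]; exact hx.2⟩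
  rintro k₂ s₂ hf₂ ⟨hk₂, hptr₂, ⟨hrec, hrecd, hcross⟩, hall⟩
  have hd₂ := hd₁.of_frame hf₂ (by decide) (by decide)
  rw [h26₁] at hcross hall
  set rec := s₂.nat 20 0 with hrecdef
  set p := s₂.nat 19 0 with hp
  have hpE := hcross.le
  have hp0 := hcross.ge
  have hap : windowStart lw up st p ≤ p := windowStart_le
  set a := windowStart lw up st p with ha
  refine .seq (.mono (.straight 50 (Q := fun k' s' => k' = k₂ - 50 ∧
    s' = (s₂.setNat 21 0 a).setNat 22 0 (p - a)) rfl (by decide) (by omega) ⟨rfl, ?_⟩) ?_)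
  · simp [chooseWindow, startExp, Prog.run, Prog.setVar, hd₂.lw_eq, hd₂.up_eq, hd₂.st_eq, ← hp, ha,
      windowStart]
  rintro k₃ s₃ hf₃ ⟨rfl, hs₃⟩
  have hd₃ := hd₂.of_frame hf₃ (by decide) (by decide)
  have e21₃ : s₃.nat 21 0 = a := by simp [hs₃]
  have e22₃ : s₃.nat 22 0 = p - a := by simp [hs₃]
  have hnd : n * E = n * (E - (p - a)) + n * (p - a) := by
    rw [← Nat.mul_add, Nat.sub_add_cancel (by omega)]
  have hnd' : p - a ≤ n * (p - a) := Nat.le_mul_of_pos_left _ h.agents_pos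
  have hnd2 : n * (100 * (p - a) + 200) = 100 * (n * (p - a)) + 200 * n := by ring
  refine .seq ((runs_recordBag hd₃.agents_eq hd₃.items_eq hd₃.j_eq (p := p) (i := rec) (a := a)
    ?_ ?_ e21₃ hap (by omega)).mono ?_)
  · rw [hf₃.nat 19 (by decide)]
  · rw [hf₃.nat 20 (by decide)]
  rintro k₄ s₄ hf₄ ⟨hk₄, hown1, hown2, hown3, h6₄⟩
  have hd₄ := hd₃.of_frame hf₄ (by decide) (by decide)
  have e6₃ : s₃.nat 6 = s.nat 6 := by
    rw [hf₃.nat 6 (by decide), hf₂.nat 6 (by decide), e6₁]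
  have e7₄ : s₄.nat 7 = s₂.nat 7 := by rw [hf₄.nat 7 (by decide), hf₃.nat 7 (by decide)]
  have e8₄ : s₄.nat 8 = s₂.nat 8 := by rw [hf₄.nat 8 (by decide), hf₃.nat 8 (by decide)]
  have r4₄ : s₄.real 4 = s₂.real 4 := by rw [hf₄.real 4 (by decide), hf₃.real 4 (by decide)]
  have hpot₄ : potential s₄ n = potential s₂ n := potential_congr e7₄ e8₄
  have hact : ∀ x, s₄.nat 6 x = 0 → s₁.nat 6 x = 0 := by
    intro x hx
    rw [h6₄, e6₃] at hx
    rw [e6₁]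
    by_contra hne
    split at hx <;> omega
  obtain ⟨z1, z2, z3, z4⟩ := windowStart_size hlu (by omega) hst.low hst.high hp0 hpE
  rw [← hstdef, ← ha] at z1 z2 z3 z4
  -- After the last bag there is no next large item and no next path; the old data serve as dummies,
  -- since the pointers are no longer needed.
  obtain ⟨o', j', ho', htop, heq⟩ : ∃ o' j', o' ≤ st ∧
      (∀ x < n, c x (m - n + j) ≤ c x (m - n + j')) ∧
      (j + 1 < n → o' = pivot lw up (n - (j + 1)) (E - (p - a)) * lw ∧ j' = j + 1) := by
    by_cases hj' : j + 1 < n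
    · refine ⟨_, j + 1, Nat.mul_le_mul_right lw ?_, fun x hx => h.mono x hx _ _ (by omega) (by omega),
        fun _ => ⟨rfl, rfl⟩⟩
      exact pivot_mono hlu (by omega) hst.low z2 z3 (by omega)
    · exact ⟨st, j, le_rfl, fun _ _ => le_rfl, fun h => absurd h hj'⟩
  refine .seq ((runs_updateAgents hd₄ hlu h0 hmono (p := p) (a := a) (d := p - a) (o' := o') (j' := j') ?_ hpE
    ?_ ha ?_ rfl ho' htop (by omega)).mono ?_)
  · intro x hx hx'
    obtain ⟨g1, g2⟩ := hptr₂ x hx (hact x hx')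
    unfold HasPointer at *
    rw [e7₄, e8₄, r4₄]
    exact ⟨g1, g2⟩
  · rw [hf₄.nat 21 (by decide), e21₃]
  · rw [hf₄.nat 22 (by decide), e22₃]
  rintro k₅ s₅ hf₅ ⟨hk₅, hptr₅⟩
  have hd₅ := hd₄.of_frame hf₅ (by decide) (by decide)
  refine (runs_compact hd₅.E_eq hd₅.j_eq (a := a) (d := p - a) ?_ ?_ (by omega) (by omega)).mono ?_
  · rw [hf₅.nat 21 (by decide), hf₄.nat 21 (by decide), e21₃]
  · rw [hf₅.nat 22 (by decide), hf₄.nat 22 (by decide), e22₃]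
  rintro k₆ s₆ hf₆ ⟨hk₆, hE₆, hj₆, hR₆⟩
  have hpot₆ : potential s₆ n = potential s₅ n :=
    potential_congr (hf₆.nat 7 (by decide)) (hf₆.nat 8 (by decide))
  have e4₅ : s₅.nat 4 = R := funext hd₅.small_eq
  have e4₃ : s₃.nat 4 = R := funext hd₃.small_eq
  rw [e4₅] at hR₆
  rw [e4₃] at hown2 hown3
  have e5₆ : s₆.nat 5 = s₄.nat 5 := by rw [hf₆.nat 5 (by decide), hf₅.nat 5 (by decide)]
  have e6₆ : s₆.nat 6 = s₄.nat 6 := by rw [hf₆.nat 6 (by decide), hf₅.nat 6 (by decide)]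
  have e5₃ : s₃.nat 5 = s.nat 5 := by
    rw [hf₃.nat 5 (by decide), hf₂.nat 5 (by decide), e5₁]
  rw [e6₁] at hrecd
  refine ⟨E - (p - a), by omega, ⟨⟨?_, ?_, ?_, ?_, rfl, hE₆, hj₆, ?_, fun _ => rfl, ?_⟩, ?_, ?_⟩, ?_⟩
  · rw [hf₆.nat 0 (by decide), hd₅.agents_eq]
  · rw [hf₆.nat 0 (by decide), hd₅.items_eq]
  · rw [hf₆.nat 16 (by decide), hd₅.lw_eq]
  · rw [hf₆.nat 17 (by decide), hd₅.up_eq]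
  · intro x r; rw [hf₆.real 1 (by decide), hd₅.cost_eq]
  · intro x; rw [hf₆.real 3 (by decide), hd₅.thr_eq]
  · rw [e5₆, e6₆]
    refine hst.step h hj hp0 hpE ha hrec hrecd ?_ ?_ hR₆ hown1 hown2 ?_ ?_ ?_
    · intro x hx hx'
      obtain ⟨q, hq, hq'⟩ := hall x hx (by rw [e6₁]; exact hx')
      exact hq'.reached p hq hpE
    · exact hcross.minimal
    · intro r hr hr'; rw [hown3 r hr hr', e5₃]
    · rw [h6₄, if_pos rfl]; decide
    · intro x hx; rw [h6₄, if_neg hx, e6₃]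
  · intro hj' x hx hx'
    rw [e6₆] at hx'
    have hpt := hptr₅ x hx hx'
    rw [(heq hj').1, (heq hj').2] at hpt
    unfold HasPointer at hpt ⊢
    rw [hf₆.nat 7 (by decide), hf₆.nat 8 (by decide), hf₆.real 4 (by decide)]
    exact ⟨hpt.1, hpt.2.congr (fun i hi => by rw [hR₆ i hi]) hpt.1⟩
  · omega

theorem runs_fillBags (h : SortedCosts n m lw up c τ) (hn : s.nat 0 0 = n) (hm : s.nat 0 1 = m)
    (hlw : s.nat 16 0 = lw) (hup : s.nat 17 0 = up)
    (hc : ∀ x r, s.real 1 (x * m + r) = c x r) (ht : ∀ x, s.real 3 x = τ x - τ x / (2 * n))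
    (hk : 2000 * (n * m) + 400 * m + 200 ≤ k) :
    fillBags.Runs o s k fun k' s' => k ≤ k' + 2000 * (n * m) + 400 * m + 200 ∧
      (∀ r < m, s'.nat 5 r < n) ∧ ∀ x < n,
      lw + 1 ≤ ((Finset.range m).filter fun r => s'.nat 5 r = x).card ∧
      ((Finset.range m).filter fun r => s'.nat 5 r = x).card ≤ up + 1 ∧
      ∑ r ∈ (Finset.range m).filter (fun r => s'.nat 5 r = x), c x r ≤
        (3 - (n : ℝ)⁻¹) / 2 * τ x := by
  have hlt := h.lt
  have hnm : n * (m - n) ≤ n * m := Nat.mul_le_mul_left _ (by omega)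
  refine .seq ((runs_initBags h hn hm hlw hup hc ht (by omega)).mono ?_)
  rintro k₁ s₁ hf₁ ⟨hk₁, hmem, hpot⟩
  -- The initial potential is `2 * (n * (m - n))`, so potential and small items together need at
  -- most (400 + 100)nm credits; the rest is a fixed amount for each round.
  refine .loop 20 (fun k' s' => ∃ j E, j ≤ n ∧ E ≤ m ∧ BagMemory s' n m lw up c τ j E ∧
    k + 200 * potential s' n + 100 * (n * E) + (n - j) * (1000 * m + 20) ≤
      k' + 200 * m + 100 + 500 * (n * m) + n * (1000 * m + 20)) (by decide) ?_ ?_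
  · refine ⟨0, m - n, by omega, by omega, hmem, ?_⟩
    rw [hpot, Nat.sub_zero]; omega
  rintro k' s' hf ⟨j, E, hj, hE, hmem', hk'⟩
  have hex : n * (1000 * m + 20) = 1000 * (n * m) + 20 * n := by ring
  have hle : n ≤ n * m := Nat.le_mul_of_pos_right _ (by omega)
  refine ⟨by omega, fun hb => ?_, fun hb => ?_⟩
  · simp [agents, hmem'.data.agents_eq, hmem'.data.j_eq] at hb
    have hex' : (n - j) * (1000 * m + 20) = (n - (j + 1)) * (1000 * m + 20) + (1000 * m + 20) := by
      rw [show n - j = n - (j + 1) + 1 by omega]; ring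
    refine (runs_fillBag h hmem' hb hE (by omega)).mono ?_
    rintro k₂ s₂ hf₂ ⟨E', hE', hmem₂, hk₂⟩
    exact ⟨j + 1, E', by omega, by omega, hmem₂, by omega⟩
  · simp [agents, hmem'.data.agents_eq, hmem'.data.j_eq] at hb
    obtain rfl : j = n := by omega
    obtain ⟨B, hst⟩ := hmem'.state
    exact ⟨by omega, hst.final h⟩

end RealRAM.Chores


/-! ### From ranks to items. -/

namespace RealRAM.Chores

/-- Let the owners of the ranks choose items, in the order of the ranks: every owner takes the best
item that is left. -/
def pickItems : Prog :=
  .setVar 12 0 ;;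
  .while (.natLT (.var 12) items)
    (.setVar 11 (.load 5 (.var 12)) ;;
     .setVar 23 (.load 3 (.var 11 * items + .load 9 (.var 11))) ;;
     .ite (.natLE 1 (.load 10 (.var 23)))
       (.setNat 9 (.var 11) (.load 9 (.var 11) + 1))
       (.setNat 1 (.var 23) (.var 11) ;; .setNat 10 (.var 23) 1 ;; .setVar 12 (.var 12 + 1)))

variable {o : ℕ → ℕ → ℝ} {s : Mem} {k n m : ℕ} {c : ℕ → ℕ → ℝ}

/-- Each pass either assigns an item or advances the position of an agent in her sorted list. A
position never exceeds the number of items taken, which bounds both the cost of each pick and the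
total number of passes. -/
theorem runs_pickItems (hm : s.nat 0 1 = m) (hown : ∀ r < m, s.nat 5 r < n)
    (hsort : ∀ x < n, IsSorting m (o x) (fun r => s.nat 3 (x * m + r)) (c x))
    (h9 : ∀ x, s.nat 9 x = 0) (h10 : ∀ g, s.nat 10 g = 0)
    (hk : 100 * (n * m) + 100 * m + 200 ≤ k) :
    pickItems.Runs o s k fun k' s' => k ≤ k' + 100 * (n * m) + 100 * m + 200 ∧
      ∃ π : ℕ → ℕ, (∀ r < m, π r < m) ∧ Set.InjOn π (Finset.range m : Finset ℕ) ∧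
        ∀ r < m, s'.nat 1 (π r) = s.nat 5 r ∧ - o (s.nat 5 r) (π r) ≤ c (s.nat 5 r) r := by
  refine .seq (.straight 10 (by decide) (by decide) (by omega) ?_)
  simp only [Prog.run, Prog.setVar]
  refine .loop 10 (fun k' s' => s'.nat 12 0 ≤ m ∧
    k ≤ k' + 100 * ∑ x ∈ Finset.range n, s'.nat 9 x + 100 * s'.nat 12 0 + 20 ∧
    (∀ x < n, s'.nat 9 x ≤ s'.nat 12 0) ∧
    ∃ π : ℕ → ℕ, (∀ r < s'.nat 12 0, π r < m) ∧
      Set.InjOn π (Finset.range (s'.nat 12 0) : Finset ℕ) ∧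
      (∀ r < s'.nat 12 0, s'.nat 1 (π r) = s.nat 5 r ∧ - o (s.nat 5 r) (π r) ≤ c (s.nat 5 r) r) ∧
      (∀ g, s'.nat 10 g ≠ 0 ↔ ∃ r < s'.nat 12 0, π r = g) ∧
      ∀ x < n, ∀ r < s'.nat 9 x, s'.nat 10 (s.nat 3 (x * m + r)) ≠ 0) (by decide) ?_ ?_
  · simp [h9, h10]
    omega
  rintro k' s' hf ⟨hle, hk', hP, π, hlt, hinj, hpick, htak, hskip⟩
  have hsum : ∑ x ∈ Finset.range n, s'.nat 9 x ≤ n * m := by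
    simpa using Finset.sum_le_card_nsmul (Finset.range n) (fun x => s'.nat 9 x) m
      fun x hx => (hP x (Finset.mem_range.1 hx)).trans hle
  have e0 : s'.nat 0 1 = m := by rw [hf.nat 0 (by decide)]; simpa using hm
  have e3 : ∀ i, s'.nat 3 i = s.nat 3 i := fun i => by rw [hf.nat 3 (by decide)]; simp
  have e5 : ∀ i, s'.nat 5 i = s.nat 5 i := fun i => by rw [hf.nat 5 (by decide)]; simp
  refine ⟨by omega, fun hb => ?_, fun hb => ?_⟩
  · simp [items, e0] at hb
    set q := s'.nat 12 0 with hq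
    have hx := hown q hb
    set x := s.nat 5 q with hxdef
    have hPx := hP x hx
    set r₀ := s'.nat 9 x with hr₀
    have hs := hsort x hx
    set g := s.nat 3 (x * m + r₀) with hg
    have hglt : g < m := hs.lt r₀ (by omega)
    refine .straight 80 (by decide) (by decide) (by omega) ?_
    by_cases ht : s'.nat 10 g = 0
    · simp [Prog.run, items, e0, e3, e5, ← hq, ← hxdef, ← hr₀, ← hg, ht]
      have hnew : ∀ r < q, π r ≠ g := fun r hr h => (htak g).2 ⟨r, hr, h⟩ ht
      refine ⟨by omega, by omega, fun y hy => (hP y hy).trans (by omega), Function.update π q g,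
        fun r hr => ?_, ?_, fun r hr => ?_, fun g' => ?_, fun y hy r hr => ?_⟩
      · rcases eq_or_ne r q with rfl | hne
        · simpa using hglt
        · rw [Function.update_of_ne hne]; exact hlt r (by omega)
      · intro r hr r' hr' h
        simp at hr hr'
        by_cases h1 : r = q <;> by_cases h2 : r' = q
        · omega
        · rw [h1, Function.update_self, Function.update_of_ne h2] at h
          exact absurd h.symm (hnew r' (by omega))
        · rw [h2, Function.update_self, Function.update_of_ne h1] at h
          exact absurd h (hnew r (by omega))
        · rw [Function.update_of_ne h1, Function.update_of_ne h2] at h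
          exact hinj (by simp; omega) (by simp; omega) h
      · rcases eq_or_ne r q with rfl | hne
        · rw [Function.update_self, if_pos rfl]
          refine ⟨rfl, ?_⟩
          -- The item found has rank `r₀ ≤ q` for its owner, so it costs at most as much as her rank
          -- `q`.
          rw [← hs.cost r₀ (by omega)]
          exact hs.mono _ _ hPx hb
        · rw [Function.update_of_ne hne, if_neg (hnew r (by omega))]
          exact hpick r (by omega)
      · rcases eq_or_ne g' g with rfl | hne
        · simp only [if_true]
          exact ⟨fun _ => ⟨q, le_rfl, Function.update_self ..⟩, fun _ => one_ne_zero⟩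
        · rw [if_neg hne, ← ne_eq, htak g']
          constructor
          · rintro ⟨r, hr, h⟩
            exact ⟨r, by omega, by rwa [Function.update_of_ne (by omega)]⟩
          · rintro ⟨r, hr, h⟩
            have hrq : r ≠ q := by
              rintro rfl
              rw [Function.update_self] at h
              exact hne h.symm
            exact ⟨r, by omega, by rwa [Function.update_of_ne hrq] at h⟩
      · split
        · exact one_ne_zero
        · exact hskip y hy r hr
    · have ht' : 1 ≤ s'.nat 10 g := Nat.one_le_iff_ne_zero.2 ht
      simp [Prog.run, items, e0, e3, e5, ← hq, ← hxdef, ← hr₀, ← hg, ht']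
      have hskip' : ∀ r < r₀ + 1, s'.nat 10 (s.nat 3 (x * m + r)) ≠ 0 := by
        intro r hr
        rcases Nat.lt_succ_iff_lt_or_eq.1 hr with h | rfl
        · exact hskip x hx r h
        · exact ht
      -- The `r₀ + 1` skipped entries are distinct items, all among the `q` items that have been
      -- taken.
      have hcard : r₀ + 1 ≤ q := by
        have : ((Finset.range (r₀ + 1)).image fun r => s.nat 3 (x * m + r)) ⊆
            (Finset.range q).image π := by
          intro g' hg'
          obtain ⟨r, hr, rfl⟩ := Finset.mem_image.1 hg'
          obtain ⟨r', hr', h⟩ := (htak _).1 (hskip' r (Finset.mem_range.1 hr))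
          exact Finset.mem_image.2 ⟨r', Finset.mem_range.2 hr', h⟩
        have h1 := Finset.card_le_card this
        rw [Finset.card_image_of_injOn] at h1
        · simpa using h1.trans Finset.card_image_le
        · intro r hr r' hr' h
          simp at hr hr'
          exact hs.inj r (by omega) r' (by omega) h
      have hsum' : ∑ y ∈ Finset.range n, (if y = x then r₀ + 1 else s'.nat 9 y) =
          ∑ y ∈ Finset.range n, s'.nat 9 y + 1 := by
        rw [← Finset.sum_erase_add _ _ (Finset.mem_range.2 hx),
          ← Finset.sum_erase_add (Finset.range n) (fun y => s'.nat 9 y) (Finset.mem_range.2 hx),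
          if_pos rfl, ← hr₀, add_assoc]
        congr 1
        exact Finset.sum_congr rfl fun y hy => if_neg (Finset.ne_of_mem_erase hy)
      refine ⟨hle, by rw [hsum']; omega, fun y hy => ?_, π, hlt, by simpa using hinj, hpick,
        htak, fun y hy r hr => ?_⟩
      · split
        · exact hcard
        · exact hP y hy
      · rcases eq_or_ne y x with rfl | hne
        · rw [if_pos rfl] at hr; exact hskip' r hr
        · rw [if_neg hne] at hr; exact hskip y hy r hr
  · simp [items, e0] at hb
    have : s'.nat 12 0 = m := by omega
    rw [this] at hlt hinj hpick hk'
    exact ⟨by omega, π, hlt, hinj, hpick⟩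

end RealRAM.Chores


/-! ### The maximin share -/

/-- The first `K` costs are the smallest ones. -/
theorem sum_range_le_sum_of_mono {c : ℕ → ℝ} {m K : ℕ} {S : Finset ℕ}
    (h0 : ∀ r < m, 0 ≤ c r) (hc : ∀ r r', r ≤ r' → r' < m → c r ≤ c r')
    (hS : ∀ r ∈ S, r < m) (hK : K ≤ S.card) : ∑ r ∈ Finset.range K, c r ≤ ∑ r ∈ S, c r := by
  induction K generalizing S with
  | zero => simpa using Finset.sum_nonneg fun r hr => h0 r (hS r hr)
  | succ K ih =>
    have hne : S.Nonempty := Finset.card_pos.1 (by omega)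
    have hmem := S.max'_mem hne
    -- A set with more than `K` ranks has maximum at least `K`; this maximum is matched with rank
    -- `K`, and the rest with the smaller ranks.
    have hle : K ≤ S.max' hne := by
      have : S ⊆ Finset.range (S.max' hne + 1) := fun r hr =>
        Finset.mem_range.2 (Nat.lt_succ_of_le (S.le_max' r hr))
      have := Finset.card_le_card this
      simp at this
      omega
    rw [Finset.sum_range_succ, ← Finset.sum_erase_add S c hmem]
    refine add_le_add (ih (fun r hr => hS r (Finset.mem_of_mem_erase hr)) ?_) (hc _ _ hle (hS _ hmem))
    rw [Finset.card_erase_of_mem hmem]; omega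

section Bundles

variable {n m lo hi : ℕ} {c : ℕ → ℝ} {μ τ : ℝ} {a : ℕ → ℕ}

/-- The l dearest items lie in some l bundles. These contain at least `l * lo` items, and the other
bundles hold at most `(n - l) * hi`; the items beyond the l dearest cost at least as much as equally
many cheapest ones. -/
theorem sum_top_add_sum_fill_le (hnm : n < m) (hm : m ≤ hi * n) (h0 : ∀ r < m, 0 ≤ c r)
    (hc : ∀ r r', r ≤ r' → r' < m → c r ≤ c r') (ha : ∀ r < m, a r < n)
    (hlo : ∀ x < n, lo ≤ ((Finset.range m).filter fun r => a r = x).card)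
    (hhi : ∀ x < n, ((Finset.range m).filter fun r => a r = x).card ≤ hi)
    (hμ : ∀ x < n, ∑ r ∈ (Finset.range m).filter (fun r => a r = x), c r ≤ μ) {l : ℕ}
    (hl : 1 ≤ l) (hln : l ≤ n) :
    ∑ r ∈ Finset.Ico (m - l) m, c r +
      ∑ r ∈ Finset.range (fillCount (lo - 1) (hi - 1) n (m - n) l), c r ≤ l * μ := by
  -- The owners of the l dearest items may be fewer than l, so they are extended to a set of exactly
  -- l agents.
  obtain ⟨W, hTW, hWn, hW⟩ := Finset.exists_subsuperset_card_eq
    (s := (Finset.Ico (m - l) m).image a) (t := Finset.range n) (n := l)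
    (fun x hx => by
      obtain ⟨r, hr, rfl⟩ := Finset.mem_image.1 hx
      exact Finset.mem_range.2 (ha r (Finset.mem_Ico.1 hr).2))
    (Finset.card_image_le.trans (by rw [Nat.card_Ico]; omega)) (by rwa [Finset.card_range])
  set S := (Finset.range m).filter fun r => a r ∈ W with hS
  have hTS : Finset.Ico (m - l) m ⊆ S := fun r hr =>
    Finset.mem_filter.2 ⟨Finset.mem_range.2 (Finset.mem_Ico.1 hr).2,
      hTW (Finset.mem_image_of_mem a hr)⟩
  have hfiber : ∀ (V : Finset ℕ) x, x ∈ V →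
      ((Finset.range m).filter fun r => a r ∈ V).filter (fun r => a r = x) =
        (Finset.range m).filter fun r => a r = x := by
    intro V x hx
    ext r
    simp only [Finset.mem_filter]
    constructor
    · rintro ⟨⟨h1, _⟩, h2⟩; exact ⟨h1, h2⟩
    · rintro ⟨h1, h2⟩; exact ⟨⟨h1, h2 ▸ hx⟩, h2⟩
  have hsum : ∑ r ∈ S, c r ≤ l * μ := by
    rw [← Finset.sum_fiberwise_of_maps_to (t := W) (g := a)
      fun r hr => (Finset.mem_filter.1 hr).2, ← hW, ← nsmul_eq_mul]
    refine Finset.sum_le_card_nsmul _ _ _ fun x hx => ?_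
    rw [hfiber W x hx]
    exact hμ x (Finset.mem_range.1 (hWn hx))
  have hcard : ∀ V : Finset ℕ, ((Finset.range m).filter fun r => a r ∈ V).card =
      ∑ x ∈ V, ((Finset.range m).filter fun r => a r = x).card := fun V => by
    rw [Finset.card_eq_sum_card_fiberwise (s := (Finset.range m).filter fun r => a r ∈ V) (f := a)
      (t := V) fun r hr => Finset.mem_coe.2 (Finset.mem_filter.1 (Finset.mem_coe.1 hr)).2]
    exact Finset.sum_congr rfl fun x hx => by rw [hfiber V x hx]
  have h1 : l * lo ≤ S.card := by
    rw [hS, hcard, ← hW, ← smul_eq_mul]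
    exact Finset.card_nsmul_le_sum _ _ _ fun x hx => hlo x (Finset.mem_range.1 (hWn hx))
  have h2 : m ≤ S.card + (n - l) * hi := by
    have h3 : ((Finset.range m).filter fun r => a r ∈ Finset.range n \ W).card ≤ (n - l) * hi := by
      rw [hcard, show n - l = (Finset.range n \ W).card by
        rw [Finset.card_sdiff_of_subset hWn, Finset.card_range, hW], ← smul_eq_mul]
      exact Finset.sum_le_card_nsmul _ _ _ fun x hx =>
        hhi x (Finset.mem_range.1 (Finset.mem_sdiff.1 hx).1)
    have h4 : Finset.range m ⊆ S ∪ (Finset.range m).filter fun r => a r ∈ Finset.range n \ W := by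
      intro r hr
      simp only [hS, Finset.mem_union, Finset.mem_filter, Finset.mem_sdiff, Finset.mem_range]
      have := ha r (Finset.mem_range.1 hr)
      have := Finset.mem_range.1 hr
      tauto
    have h5 := (Finset.card_le_card h4).trans (Finset.card_union_le _ _)
    rw [Finset.card_range] at h5
    omega
  have hST : (S \ Finset.Ico (m - l) m).card = S.card - l := by
    rw [Finset.card_sdiff_of_subset hTS, Nat.card_Ico]; omega
  have hhi0 : 1 ≤ hi := by
    rcases Nat.eq_zero_or_pos hi with rfl | h
    · omega
    · exact h
  -- Taking one item off every bundle turns counts of all items into the counts of small items in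
  -- `fillCount`.
  have h6 : (n - l) * hi = (n - l) * (hi - 1) + (n - l) := by
    obtain ⟨t, rfl⟩ : ∃ t, hi = t + 1 := ⟨hi - 1, by omega⟩
    simp; ring
  have h7 : l * (lo - 1) ≤ S.card - l := by
    rcases Nat.eq_zero_or_pos lo with rfl | h
    · simp
    · have : l * lo = l * (lo - 1) + l := by
        obtain ⟨t, rfl⟩ : ∃ t, lo = t + 1 := ⟨lo - 1, by omega⟩
        simp; ring
      omega
  have key := sum_range_le_sum_of_mono (K := fillCount (lo - 1) (hi - 1) n (m - n) l)
    (S := S \ Finset.Ico (m - l) m) h0 hc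
    (fun r hr => Finset.mem_range.1 (Finset.mem_filter.1 (Finset.mem_sdiff.1 hr).1).1) (by
      rw [hST]; unfold fillCount; omega)
  have := Finset.sum_sdiff (f := c) hTS
  linarith

/-- Pigeonhole: two of the n + 1 dearest items are in the same bundle. -/
theorem two_mul_le_of_bundles (hn : 1 ≤ n) (hnm : n < m) (h0 : ∀ r < m, 0 ≤ c r)
    (hc : ∀ r r', r ≤ r' → r' < m → c r ≤ c r') (ha : ∀ r < m, a r < n)
    (hμ : ∀ x < n, ∑ r ∈ (Finset.range m).filter (fun r => a r = x), c r ≤ μ) :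
    c (m - n - 1) + c (m - n - 1) ≤ μ := by
  obtain ⟨r, hr, r', hr', hne, heq⟩ := Finset.exists_ne_map_eq_of_card_lt_of_maps_to
    (s := Finset.Ico (m - n - 1) m) (t := Finset.range n) (f := a)
    (by rw [Nat.card_Ico, Finset.card_range]; omega)
    (fun r hr => by
      have : r < m := (Finset.mem_Ico.1 hr).2
      exact Finset.mem_coe.2 (Finset.mem_range.2 (ha r this)))
  rw [Finset.mem_Ico] at hr hr'
  have h1 : ∑ i ∈ ({r, r'} : Finset ℕ), c i ≤
      ∑ i ∈ (Finset.range m).filter (fun i => a i = a r), c i := by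
    refine Finset.sum_le_sum_of_subset_of_nonneg ?_ fun i hi _ =>
      h0 i (Finset.mem_range.1 (Finset.mem_filter.1 hi).1)
    intro i hi
    simp only [Finset.mem_insert, Finset.mem_singleton] at hi
    simp only [Finset.mem_filter, Finset.mem_range]
    rcases hi with rfl | rfl
    · exact ⟨hr.2, rfl⟩
    · exact ⟨hr'.2, heq.symm⟩
  rw [Finset.sum_pair hne] at h1
  have h2 := hc _ r hr.1 hr.2
  have h3 := hc _ r' hr'.1 hr'.2
  have h4 := hμ _ (ha r hr.2)
  linarith

end Bundles

/-- A sum over the items as a sum over their ranks. -/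
theorem sum_filter_eq_sum_range {m : ℕ} {π : ℕ → ℕ} (hlt : ∀ r < m, π r < m)
    (hinj : ∀ r < m, ∀ r' < m, π r = π r' → r = r') {M : Type*} [AddCommMonoid M] (F : ℕ → M)
    (p : ℕ → Prop) [DecidablePred p] :
    ∑ g ∈ Finset.univ.filter (fun g : Fin m => p g), F g = ∑ r ∈ (Finset.range m).filter (fun r => p (π r)), F (π r) := by
  have hbij : Function.Bijective fun r : Fin m => (⟨π r, hlt r r.2⟩ : Fin m) :=
    Finite.injective_iff_bijective.1 fun r r' h =>
      Fin.ext (hinj r r.2 r' r'.2 (by simpa using h))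
  rw [Finset.sum_filter, Finset.sum_filter, Finset.sum_range, ← hbij.sum_comp]

/-! ### Upper bounds for the maximin share. -/

namespace FairInstance

variable {n m : ℕ} (I : FairInstance (Fin n) (Fin m))

theorem oracle_apply (i : Fin n) (g : Fin m) : I.oracle i g = I.v i g := by simp [oracle]

theorem IsChores.oracle_nonpos {I : FairInstance (Fin n) (Fin m)} (hI : I.IsChores) (i g : ℕ) :
    I.oracle i g ≤ 0 := by
  unfold oracle
  split
  · exact hI _ _
  · exact le_rfl

/-- An allocation of items is read as one of ranks. The cost of its worst bundle satisfies the
conditions that define τ, so τ is at most this cost by minimality. -/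
theorem mms_le {I : FairInstance (Fin n) (Fin m)} (hI : I.IsChores) (hnm : n < m) (i : Fin n)
    {f : ℕ → ℕ} {c : ℕ → ℝ} {τ : ℝ} (hs : IsSorting m (I.oracle i) f c)
    (hτ : IsProxy n m (I.lo - 1) (I.hi - 1) c τ) (hne : ∃ P, I.IsFeasible P) : I.mms i ≤ -τ := by
  obtain ⟨P₀, hP₀⟩ := hne
  -- A feasible allocation is needed here: the supremum of the empty set would be 0.
  refine csSup_le ⟨_, P₀, hP₀, rfl⟩ ?_
  rintro _ ⟨P, hP, rfl⟩
  rw [le_neg]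
  have hmul := I.le_hi_mul
  simp only [Fintype.card_fin] at hmul
  choose w hw hw' using hP.1
  have hPw : ∀ x g, g ∈ P x ↔ w g = x := fun x g =>
    ⟨fun h => (hw' g x h).symm, fun h => h ▸ hw g⟩
  set a : ℕ → ℕ := fun r => if h : r < m then w ⟨f r, hs.lt r h⟩ else 0 with ha
  have hPx : ∀ x : Fin n, P x = Finset.univ.filter fun g => w g = x := fun x => by
    ext g; simp [hPw]
  set wn : ℕ → ℕ := fun g => if h : g < m then w ⟨g, h⟩ else 0 with hwn
  have hPx' : ∀ x : Fin n, P x = Finset.univ.filter fun g : Fin m => wn g = x := fun x => by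
    ext g; simp [hPw, hwn, Fin.ext_iff]
  have hawn : ∀ x, (Finset.range m).filter (fun r => a r = x) =
      (Finset.range m).filter fun r => wn (f r) = x := fun x => by
    refine Finset.filter_congr fun r hr => ?_
    have hr' := Finset.mem_range.1 hr
    simp [ha, hwn, hr', hs.lt r hr']
  have hcard : ∀ x : Fin n, ((Finset.range m).filter fun r => a r = x).card = (P x).card := by
    intro x
    rw [hPx' x, hawn, Finset.card_eq_sum_ones, Finset.card_eq_sum_ones]
    exact (sum_filter_eq_sum_range hs.lt hs.inj (fun _ => 1) fun g => wn g = x).symm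
  have hval : ∀ x : Fin n, ∑ r ∈ (Finset.range m).filter (fun r => a r = x), c r =
      - I.value i (P x) := by
    intro x
    unfold value
    rw [hPx' x, hawn, ← Finset.sum_congr rfl fun g _ => I.oracle_apply i g,
      sum_filter_eq_sum_range hs.lt hs.inj (fun g => I.oracle i g) fun g => wn g = x,
      ← Finset.sum_neg_distrib]
    exact Finset.sum_congr rfl fun r hr =>
      hs.cost r (Finset.mem_range.1 (Finset.mem_filter.1 hr).1)
  have h0 : ∀ r < m, 0 ≤ c r := fun r hr => by
    rw [hs.cost r hr]; linarith [hI.oracle_nonpos i (f r)]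
  have han : ∀ r < m, a r < n := fun r hr => by simp [ha, hr]
  have hμ : ∀ x < n, ∑ r ∈ (Finset.range m).filter (fun r => a r = x), c r ≤
      - ⨅ k, I.value i (P k) := by
    intro x hx
    rw [hval ⟨x, hx⟩]
    exact neg_le_neg (ciInf_le (Set.finite_range _).bddBelow _)
  refine hτ.least _ (fun l hl hln => ?_) ?_
  · exact sum_top_add_sum_fill_le hnm hmul h0 hs.mono han
      (fun x hx => by rw [hcard ⟨x, hx⟩]; exact (hP.2 _).1)
      (fun x hx => by rw [hcard ⟨x, hx⟩]; exact (hP.2 _).2) hμ hl hln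
  · exact two_mul_le_of_bundles (by have := i.2; omega) hnm h0 hs.mono han hμ

/-- The maximin share is at most the value of any single item. -/
theorem mms_le_value {I : FairInstance (Fin n) (Fin m)} (hI : I.IsChores) (i : Fin n) (g : Fin m)
    (hne : ∃ P, I.IsFeasible P) : I.mms i ≤ I.v i g := by
  obtain ⟨P₀, hP₀⟩ := hne
  refine csSup_le ⟨_, P₀, hP₀, rfl⟩ ?_
  rintro _ ⟨P, hP, rfl⟩
  obtain ⟨x, hx, _⟩ := hP.1 g
  refine (ciInf_le (Set.finite_range _).bddBelow x).trans ?_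
  unfold value
  rw [← Finset.sum_erase_add _ _ hx]
  have : ∑ g ∈ (P x).erase g, I.v i g ≤ 0 := Finset.sum_nonpos fun g _ => hI i g
  linarith

theorem mms_nonpos {I : FairInstance (Fin n) (Fin m)} (hI : I.IsChores) (i : Fin n)
    (hne : ∃ P, I.IsFeasible P) : I.mms i ≤ 0 := by
  obtain ⟨P₀, hP₀⟩ := hne
  refine csSup_le ⟨_, P₀, hP₀, rfl⟩ ?_
  rintro _ ⟨P, hP, rfl⟩
  exact (ciInf_le (Set.finite_range _).bddBelow i).trans (Finset.sum_nonpos fun g _ => hI i g)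

end FairInstance


/-! ### Assembly of the algorithm. -/

namespace RealRAM

open FairInstance

variable {n m : ℕ}

/-- The allocation that is stored in the memory. -/
def Mem.allocation (s : Mem) (n m : ℕ) (i : Fin n) : Finset (Fin m) :=
  Finset.univ.filter fun g : Fin m => s.nat 1 g = i

theorem Mem.represents_allocation (s : Mem) : s.Represents (s.allocation n m) := fun i g => by
  simp [allocation]

theorem Mem.existsUnique_mem_allocation {s : Mem} (h : ∀ g < m, s.nat 1 g < n) (g : Fin m) :
    ∃! i, g ∈ s.allocation n m i :=
  ⟨⟨s.nat 1 g, h g g.2⟩, by simp [allocation], fun i hi => by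
    simp [allocation] at hi; exact Fin.ext hi.symm⟩

theorem one_le_ratio (n : ℕ) : (1 : ℝ) ≤ (3 - ((max n 1 : ℕ) : ℝ)⁻¹) / 2 := by
  have h1 : (1 : ℝ) ≤ ((max n 1 : ℕ) : ℝ) := by exact_mod_cast le_max_right n 1
  have := inv_le_one_of_one_le₀ h1
  linarith

namespace Chores

/-- Give every item to the agent with the same number. -/
def assignSingly : Prog :=
  .setVar 12 0 ;;
  .while (.natLT (.var 12) items)
    (.setNat 1 (.var 12) (.var 12) ;; .setVar 12 (.var 12 + 1))

/-- Allocate more items than agents. -/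
def allocateMany : Prog :=
  .setVar 16 (.load 0 2 - 1) ;; .setVar 17 (.load 0 3 - 1) ;;
  sortAll ;; thresholds ;; fillBags ;; pickItems

/-- Compute an allocation of chores. -/
def allocate : Prog := .ite (.natLE items agents) assignSingly allocateMany

variable {I : FairInstance (Fin n) (Fin m)} {k : ℕ}

/-- With at most as many items as agents, the inequalities between quotas and numbers make bundles
of at most one item feasible. The ratio is at least 1 and the share is nonpositive, so comparison
with the share itself suffices. -/
theorem runs_assignSingly (hI : I.IsChores) (hmn : m ≤ n) (hk : 50 * m + 50 ≤ k) :
    assignSingly.Runs I.oracle I.input k fun _ s' =>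
      I.IsApproxMMS ((3 - ((max n 1 : ℕ) : ℝ)⁻¹) / 2) (s'.allocation n m) := by
  have hm : I.input.nat 0 1 = m := by simp [input]
  refine .seq (.straight 10 rfl (by decide) (by omega) ?_)
  refine .loop 10 (fun k' s' => 50 * (m - s'.nat 12 0) + 20 ≤ k' ∧ s'.nat 12 0 ≤ m ∧
    ∀ g < s'.nat 12 0, s'.nat 1 g = g) (by decide) ?_ ?_
  · simp [Prog.run, Prog.setVar]; omega
  rintro k' s' hf ⟨hk', hle, h1⟩
  have hm' : s'.nat 0 1 = m := by
    rw [hf.nat 0 (by decide)]; simpa [Prog.run, Prog.setVar] using hm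
  refine ⟨by omega, fun hb => ?_, fun hb => ?_⟩
  · simp [items, hm'] at hb
    refine .straight 30 rfl (by decide) (by omega) ?_
    simp [Prog.run, Prog.setVar]
    refine ⟨by omega, by omega, fun g hg => ?_⟩
    split
    · rename_i h; exact h.symm
    · exact h1 g (by omega)
  simp [items, hm'] at hb
  have h12 : s'.nat 12 0 = m := by omega
  rw [h12] at h1
  have hlo := I.lo_mul_le
  have hhi := I.le_hi_mul
  simp only [Fintype.card_fin] at hlo hhi
  have hA : ∀ i : Fin n, s'.allocation n m i = if h : (i : ℕ) < m then {⟨i, h⟩} else ∅ := by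
    intro i
    ext g
    simp only [Mem.allocation, Finset.mem_filter, Finset.mem_univ, true_and, h1 g g.2]
    split
    · simp [Fin.ext_iff]
    · have := g.2
      simp; omega
  have hfeas : I.IsFeasible (s'.allocation n m) := by
    refine ⟨Mem.existsUnique_mem_allocation fun g hg => by rw [h1 g hg]; omega, fun i => ?_⟩
    have hi := i.2
    rw [hA]
    split
    · rename_i him
      simp only [Finset.card_singleton]
      constructor
      · by_contra hlt
        have : 2 * n ≤ I.lo * n := Nat.mul_le_mul_right _ (by omega)
        omega
      · by_contra hlt
        have : I.hi = 0 := by omega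
        simp [this] at hhi
        omega
    · rename_i him
      simp only [Finset.card_empty]
      refine ⟨?_, Nat.zero_le _⟩
      by_contra hlt
      have : 1 * n ≤ I.lo * n := Nat.mul_le_mul_right _ (by omega)
      omega
  refine ⟨hfeas, fun i => ?_⟩
  have hα := one_le_ratio n
  have h0 := mms_nonpos hI i ⟨_, hfeas⟩
  have hle : (3 - ((max n 1 : ℕ) : ℝ)⁻¹) / 2 * I.mms i ≤ I.mms i := by nlinarith
  refine hle.trans ?_
  rw [hA, value]
  split
  · rw [Finset.sum_singleton]
    exact mms_le_value hI i _ ⟨_, hfeas⟩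
  · simpa using h0

/-- A bound for the number of steps that are needed to allocate more items than agents, where
`2 ^ e` is at least the number of items. -/
def steps (n m e : ℕ) : ℕ :=
  500 * ((n + 1) * (m * (e + 1))) + 400 * ((n + 1) * m) + 2100 * (n * m) + 500 * m + 500

/-- The quotas for small items are smaller by one because each bag receives exactly one large item.
For `lo = 0` the truncated difference is 0, and bags are merely nonempty. -/
theorem runs_allocateMany (hI : I.IsChores) (hnm : n < m) {e : ℕ} (he : m ≤ 2 ^ e)
    (hk : steps n m e ≤ k) :
    allocateMany.Runs I.oracle I.input k fun _ s' =>
      I.IsApproxMMS ((3 - ((max n 1 : ℕ) : ℝ)⁻¹) / 2) (s'.allocation n m) := by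
  unfold steps at hk
  have hlo := I.lo_mul_le
  have hhi := I.le_hi_mul
  simp only [Fintype.card_fin] at hlo hhi
  have hn1 : 1 ≤ n := by
    rcases Nat.eq_zero_or_pos n with rfl | h
    · simp at hhi; omega
    · exact h
  have hhi1 : 1 ≤ I.hi := by
    rcases Nat.eq_zero_or_pos I.hi with h | h
    · rw [h] at hhi; omega
    · exact h
  have hlohi : I.lo ≤ I.hi := Nat.le_of_mul_le_mul_right (hlo.trans hhi) hn1
  have hlow : n * (I.lo - 1) ≤ m - n := by
    rw [Nat.mul_sub, mul_comm, mul_one]; omega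
  have hhigh : m - n ≤ n * (I.hi - 1) := by
    rw [Nat.mul_sub, mul_comm, mul_one]; omega
  set lw := I.lo - 1 with hlw
  set up := I.hi - 1 with hup
  refine .seq (.straight 10 rfl (by decide) (by omega) ?_)
  refine .seq (.mono (.straight 10 (Q := fun k' s' => k' = k - 10 - 10 ∧
    s' = (I.input.setNat 16 0 lw).setNat 17 0 up) rfl (by decide) (by omega)
      ⟨rfl, by simp [Prog.run, Prog.setVar, input, hlw, hup]⟩) ?_)
  rintro k₁ s₁ hf₁ ⟨rfl, hs₁⟩
  have hn₁ : s₁.nat 0 0 = n := by simp [hs₁, input]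
  have hm₁ : s₁.nat 0 1 = m := by simp [hs₁, input]
  have hlw₁ : s₁.nat 16 0 = lw := by simp [hs₁]
  have hup₁ : s₁.nat 17 0 = up := by simp [hs₁]
  have h9₁ : ∀ x, s₁.nat 9 x = 0 := by simp [hs₁, input]
  have h10₁ : ∀ x, s₁.nat 10 x = 0 := by simp [hs₁, input]
  clear_value lw up
  refine .seq ((runs_sortAll hn₁ hm₁ hI.oracle_nonpos (by omega) he (by omega)).mono ?_)
  rintro k₂ s₂ hf₂ ⟨hk₂, hsort⟩
  have e0₂ : s₂.nat 0 = s₁.nat 0 := hf₂.nat 0 (by decide)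
  refine .seq ((runs_thresholds (n := n) (m := m) (lw := lw) (up := up) ?_ ?_ ?_ ?_ hnm hlow
    (by omega)).mono ?_)
  · rw [e0₂, hn₁]
  · rw [e0₂, hm₁]
  · rw [hf₂.nat 16 (by decide), hlw₁]
  · rw [hf₂.nat 17 (by decide), hup₁]
  rintro k₃ s₃ hf₃ ⟨hk₃, hthr⟩
  have e0₃ : s₃.nat 0 = s₁.nat 0 := by rw [hf₃.nat 0 (by decide), e0₂]
  -- The bag program is specified by thresholds at all indices; beyond the agents, τ is obtained by
  -- solving τ(1 - 1/(2n)) = threshold.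
  have hτ : ∀ x, ∃ τ, (x < n → IsProxy n m lw up (fun r => s₂.real 1 (x * m + r)) τ) ∧
      s₃.real 3 x = τ - τ / (2 * n) := by
    intro x
    by_cases hx : x < n
    · obtain ⟨τ, h1, h2⟩ := hthr x hx
      exact ⟨τ, fun _ => h1, h2⟩
    · refine ⟨s₃.real 3 x / (1 - 1 / (2 * n)), fun h => absurd h hx, ?_⟩
      have hn0 : (1 : ℝ) ≤ n := by exact_mod_cast hn1
      have h1 : (1 - 1 / (2 * (n : ℝ))) ≠ 0 := by
        have : 1 / (2 * (n : ℝ)) ≤ 1 / 2 := by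
          apply one_div_le_one_div_of_le <;> linarith
        linarith
      have h2 := div_mul_cancel₀ (s₃.real 3 x) h1
      linear_combination -h2
  choose τ hproxy hthreq using hτ
  set c : ℕ → ℕ → ℝ := fun x r => s₂.real 1 (x * m + r) with hc
  have hS : SortedCosts n m lw up c τ := by
    refine ⟨hn1, hnm, by omega, hlow, hhigh, fun x hx r hr => ?_, fun x hx => (hsort x hx).mono,
      hproxy⟩
    have := (hsort x hx).cost r hr
    simp only [hc]
    rw [this]
    linarith [hI.oracle_nonpos x (s₂.nat 3 (x * m + r))]
  refine .seq ((runs_fillBags hS (by rw [e0₃, hn₁]) (by rw [e0₃, hm₁]) ?_ ?_ ?_ hthreq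
    (by omega)).mono ?_)
  · rw [hf₃.nat 16 (by decide), hf₂.nat 16 (by decide), hlw₁]
  · rw [hf₃.nat 17 (by decide), hf₂.nat 17 (by decide), hup₁]
  · intro x r; rw [hf₃.real 1 (by decide)]
  rintro k₄ s₄ hf₄ ⟨hk₄, hown, hbun⟩
  refine (runs_pickItems (n := n) (m := m) (c := c) ?_ hown ?_ ?_ ?_ (by omega)).mono ?_
  · rw [hf₄.nat 0 (by decide), e0₃, hm₁]
  · rw [hf₄.nat 3 (by decide), hf₃.nat 3 (by decide)]; exact hsort
  · intro x
    rw [hf₄.nat 9 (by decide), hf₃.nat 9 (by decide), hf₂.nat 9 (by decide), h9₁]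
  · intro x
    rw [hf₄.nat 10 (by decide), hf₃.nat 10 (by decide), hf₂.nat 10 (by decide), h10₁]
  rintro k₅ s₅ hf₅ ⟨hk₅, π, hπ, hinj, hpick⟩
  have hinj' : ∀ r < m, ∀ r' < m, π r = π r' → r = r' := fun r hr r' hr' h =>
    hinj (by simpa using hr) (by simpa using hr') h
  have hsurj : ∀ g < m, ∃ r < m, π r = g := fun g hg => by
    have := Finset.surj_on_of_inj_on_of_card_le (s := Finset.range m) (t := Finset.range m)
      (fun r _ => π r) (fun r hr => by simpa using hπ r (by simpa using hr))
      (fun r r' hr hr' h => hinj hr hr' h) le_rfl g (by simpa using hg)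
    obtain ⟨r, hr, h⟩ := this
    exact ⟨r, by simpa using hr, h.symm⟩
  have hfil : ∀ x, (Finset.range m).filter (fun r => s₅.nat 1 (π r) = x) =
      (Finset.range m).filter fun r => s₄.nat 5 r = x := fun x =>
    Finset.filter_congr fun r hr => by rw [(hpick r (Finset.mem_range.1 hr)).1]
  have hcard : ∀ i : Fin n, (s₅.allocation n m i).card =
      ((Finset.range m).filter fun r => s₄.nat 5 r = i).card := fun i => by
    rw [← hfil, Mem.allocation, Finset.card_eq_sum_ones, Finset.card_eq_sum_ones]
    exact sum_filter_eq_sum_range hπ hinj' (fun _ => 1) fun g => s₅.nat 1 g = i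
  have hfeas : I.IsFeasible (s₅.allocation n m) := by
    refine ⟨Mem.existsUnique_mem_allocation fun g hg => ?_, fun i => ?_⟩
    · obtain ⟨r, hr, rfl⟩ := hsurj g hg
      rw [(hpick r hr).1]; exact hown r hr
    · have := hbun i i.2
      rw [hcard]; omega
  refine ⟨hfeas, fun i => ?_⟩
  have hval : - ∑ r ∈ (Finset.range m).filter (fun r => s₄.nat 5 r = i), c i r ≤
      I.value i (s₅.allocation n m i) := by
    rw [value, Mem.allocation, ← Finset.sum_congr rfl fun g _ => I.oracle_apply i g,
      sum_filter_eq_sum_range hπ hinj' (fun g => I.oracle i g) fun g => s₅.nat 1 g = i, hfil,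
      ← Finset.sum_neg_distrib]
    refine Finset.sum_le_sum fun r hr => ?_
    obtain ⟨hr, hri⟩ := Finset.mem_filter.1 hr
    have := (hpick r (Finset.mem_range.1 hr)).2
    rw [hri] at this
    linarith
  have hmms := mms_le hI hnm i (hsort i i.2) (hlw ▸ hup ▸ hproxy i i.2) ⟨_, hfeas⟩
  have hcost := (hbun i i.2).2.2
  have hα := one_le_ratio n
  rw [max_eq_left hn1] at hα ⊢
  have : (3 - (n : ℝ)⁻¹) / 2 * I.mms i ≤ (3 - (n : ℝ)⁻¹) / 2 * -τ i :=
    mul_le_mul_of_nonneg_left hmms (by linarith)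
  linarith

theorem steps_le {e : ℕ} (hn : 1 ≤ n) (hm : 2 ≤ m) (he : e = Nat.log 2 m + 1) :
    ((steps n m e + 100 : ℕ) : ℝ) ≤ 20000 * ((n : ℝ) * m * Real.log m + 1) := by
  have hn' : (1 : ℝ) ≤ n := by exact_mod_cast hn
  have hm' : (2 : ℝ) ≤ m := by exact_mod_cast hm
  have hlog2 : (0.69 : ℝ) < Real.log 2 := by linarith [Real.log_two_gt_d9]
  have hlog : Real.log 2 ≤ Real.log m := Real.log_le_log (by norm_num) hm'
  have hnat : (Nat.log 2 m : ℝ) * Real.log 2 ≤ Real.log m := by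
    have := Real.natLog_le_logb m 2
    rwa [Real.logb, le_div_iff₀ (by positivity)] at this
  -- Here e + 1 = ⌊log₂ m⌋ + 2 ≤ 3 log m / log 2, because m ≥ 2, and 3 / 0.69 < 5.
  have hel : ((e : ℝ) + 1) ≤ 5 * Real.log m := by
    rw [he]; push_cast
    nlinarith
  have hnm : 0 ≤ (n : ℝ) * m := by positivity
  have h1 : ((n : ℝ) + 1) * (m * (e + 1)) ≤ 10 * (n * m * Real.log m) := by
    have : ((n : ℝ) + 1) * (m * (e + 1)) ≤ (2 * n) * (m * (5 * Real.log m)) := by gcongr; linarith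
    linarith
  have h2 : (n : ℝ) * m ≤ 2 * (n * m * Real.log m) := by nlinarith
  have h3 : (m : ℝ) ≤ n * m := by nlinarith
  unfold steps
  push_cast
  nlinarith

end Chores

end RealRAM

theorem theorem2 :
    ∃ (P : RealRAM.Prog) (c : ℝ), ∀ (n m : ℕ) (I : FairInstance (Fin n) (Fin m)), I.IsChores →
      ∃ (t : ℕ) (s : RealRAM.Mem) (A : Fin n → Finset (Fin m)),
        RealRAM.Exec I.oracle P I.input t s ∧
        (t : ℝ) ≤ c * ((n : ℝ) * (m : ℝ) * Real.log m + 1) ∧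
        s.Represents A ∧
        I.IsApproxMMS ((3 - ((max n 1 : ℕ) : ℝ)⁻¹) / 2) A := by
  refine ⟨RealRAM.Chores.allocate, 20000, fun n m I hI => ?_⟩
  suffices h : ∃ k, ((k : ℕ) : ℝ) ≤ 20000 * ((n : ℝ) * (m : ℝ) * Real.log m + 1) ∧
      RealRAM.Chores.allocate.Runs I.oracle I.input k fun _ s' =>
        I.IsApproxMMS ((3 - ((max n 1 : ℕ) : ℝ)⁻¹) / 2) (s'.allocation n m) by
    obtain ⟨k, hk, t, s, k', he, ht, hA⟩ := h
    refine ⟨t, s, _, he, le_trans ?_ hk, s.represents_allocation, hA⟩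
    exact_mod_cast (show t ≤ k by omega)
  have hn₀ : I.input.nat 0 0 = n := by simp [FairInstance.input]
  have hm₀ : I.input.nat 0 1 = m := by simp [FairInstance.input]
  have hcost : (RealRAM.BExp.natLE RealRAM.Chores.items RealRAM.Chores.agents).cost + 1 ≤ 10 := by
    decide
  by_cases hmn : m ≤ n
  · refine ⟨50 * m + 100, ?_, .ite (by omega) (fun _ => ?_) (fun hb => ?_)⟩
    · push_cast
      -- For m ≤ 1 the logarithm vanishes and the additive constant pays; for m ≥ 2 it is at least
      -- log 2 > 1/2.
      rcases Nat.lt_or_ge m 2 with hm | hm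
      · have h1 : (m : ℝ) ≤ 1 := by exact_mod_cast (show m ≤ 1 by omega)
        have h2 : 0 ≤ (n : ℝ) * m * Real.log m := by
          have := Real.log_natCast_nonneg m
          positivity
        linarith
      · have hm' : (2 : ℝ) ≤ m := by exact_mod_cast hm
        have hn' : (2 : ℝ) ≤ n := by exact_mod_cast hm.trans hmn
        have hlog : Real.log 2 ≤ Real.log m := Real.log_le_log (by norm_num) hm'
        have hlog2 := Real.log_two_gt_d9
        have h1 : (m : ℝ) ≤ n * m := by nlinarith
        have h2 : (n : ℝ) * m ≤ 2 * (n * m * Real.log m) := by nlinarith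
        linarith
    · exact RealRAM.Chores.runs_assignSingly hI hmn (by omega)
    · exact absurd (by simpa [RealRAM.Chores.items, RealRAM.Chores.agents, hn₀, hm₀] using hmn) hb
  · have hn1 : 1 ≤ n := by
      rcases Nat.eq_zero_or_pos n with rfl | h
      · have := I.le_hi_mul
        simp at this; omega
      · exact h
    refine ⟨RealRAM.Chores.steps n m (Nat.log 2 m + 1) + 100,
      RealRAM.Chores.steps_le hn1 (by omega) rfl, .ite (by omega) (fun hb => ?_) (fun _ => ?_)⟩
    · exact absurd (by simpa [RealRAM.Chores.items, RealRAM.Chores.agents, hn₀, hm₀] using hb) hmn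
    · exact RealRAM.Chores.runs_allocateMany (e := Nat.log 2 m + 1) hI (by omega)
        (Nat.lt_pow_succ_log_self one_lt_two m).le (by omega)
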